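/- (Schwinger propagator for the Volkov interaction.) Use units $\hbar=c=e=1$, coordinates $x=(ct,x_1,x_2,z)$ on $\mathbb R^4$, $x^2=c^2t^2-x_1^2-x_2^2-z^2$ and $\xi=ct-z$. Let $k_0>0$ and let $A_\mu=(A_1(\xi),A_2(\xi),0,0)$ be a Volkov potential with $A_1,A_2:\mathbb R\to\mathbb R$ continuous. For points $x',x''$ write $x=x'-x''$, $\langle f\rangle=(\xi'-\xi'')^{-1}\int_{\xi''}^{\xi'}f(\xi)\,d\xi$, $x_\mu\langle A_\mu\rangle=x_1\langle A_1\rangle+x_2\langle A_2\rangle$ and $$k_0^2(\xi',\xi'')=k_0^2+\langle A_1^2+A_2^2\rangle-\langle A_1\rangle^2-\langle A_2\rangle^2 .$$ Let $C(x',x'')=\exp\bigl(-i\int_{x''}^{x'}A_\mu\,dx_\mu\bigr)$, the integral being along the straight segment, and let $$I(x',x'')=\int_0^\infty\exp\Bigl(-\frac{i\,k_0^2(\xi',\xi'')}{4\alpha}-i\,x^2\alpha\Bigr)d\alpha ,\qquad G_S(x',x'')=-\frac1{4\pi^2}\,C(x',x'')\,I(x',x'')$$ be the proper-time integral and Schwinger's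 propagator. For a mass $k>0$ let $\Delta_C(x,k)=\frac12(\Delta_S+i\Delta^{(1)})$ be the free causal function, where $$\Delta_S=\frac1{2\pi}\Bigl\{\delta(\lambda^2)-\frac k2\,\theta(\lambda^2)\frac{J_1(k\lambda)}{\lambda}\Bigr\},\qquad \Delta^{(1)}=\frac{k}{4\pi}\Bigl\{\theta(\lambda^2)\frac{N_1(k\lambda)}{\lambda}+\frac2\pi\,\theta(\tilde\lambda^2)\frac{K_1(k\tilde\lambda)}{\tilde\lambda}\Bigr\},$$ $\lambda^2=x^2=-\tilde\lambda^2$. Here $\delta(\lambda^2)$ is the measure $\frac{1}{2r}\bigl(\delta(ct-r)+\delta(ct+r)\bigr)$, $r^2=x_1^2+x_2^2+z^2$, and $\Delta^{(1)}$ is understood as a principal value at the light cone (the limit $\varepsilon\to0^+$ of its restriction to $|x^2|>\varepsilon$). A mass depending on $x'$ is substituted for $k$ in these formulas. Fix $x''$. All identities below are identities of distributions in $x'\in\mathbb R^4$: they hold after pairing with every smooth compactly supported test function, where $I$ is paired by first integrating over $x'$ at fixed $\alpha$ and then over $\alpha\in(0,\infty)$. All these pairings exist (the integrals converge absolutely and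 the principal value limit exists), and: 1. $k_0^2(\xi',\xi'')\ge k_0^2$, so $k_0(\xi',\xi'')$ is a positive real number (at $\xi'=\xi''$ it is read as $k_0$). 2. For $\xi'\ne\xi''$, $\;C(x',x'')=\exp\Bigl(-i(x'-x'')_\mu\frac1{\xi'-\xi''}\int_{\xi''}^{\xi'}A_\mu(\xi)\,d\xi\Bigr)$. 3. $\operatorname{Re} I=\pi\Bigl\{\delta(\lambda^2)-\frac{k_0(\xi',\xi'')}{2}\theta(\lambda^2)\frac{J_1(k_0(\xi',\xi'')\lambda)}{\lambda}\Bigr\}$ and $\operatorname{Im} I=2\pi^2\,\Delta^{(1)}(x,k_0(\xi',\xi''))$. 4. $$G_S(x',x'')=-\exp\Bigl(-i(x'-x'')_\mu\frac1{\xi'-\xi''}\int_{\xi''}^{\xi'}A_\mu(\xi)\,d\xi\Bigr)\,\Delta_C\bigl(x'-x'',k_0(\xi',\xi'')\bigr).$$ -/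

import Mathlib

open MeasureTheory Filter Topology Set
open scoped ContDiff Distributions

noncomputable section

namespace Volkov

/-! ### Minkowski space -/

/-- Minkowski space `ℝ⁴` with coordinates `(ct, x₁, x₂, z)` and Lebesgue measure. -/
abbrev Spacetime : Type := ℝ × ℝ × ℝ × ℝ

/-- The Minkowski square `x_μ² = c²t² - x₁² - x₂² - z²`, positive on timelike vectors. -/
def minkSq (x : Spacetime) : ℝ := x.1 ^ 2 - (x.2.1 ^ 2 + x.2.2.1 ^ 2 + x.2.2.2 ^ 2)

/-- The characteristic coordinate `ξ = ct - z`. -/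
def xi (x : Spacetime) : ℝ := x.1 - x.2.2.2

/-- The Heaviside step function. -/
def heaviside (s : ℝ) : ℝ := if 0 < s then 1 else 0

/-! ### Bessel functions of order one of a positive argument -/

/-- The Bessel function of the first kind of order 1 (Bessel's integral). -/
def besselJ1 (x : ℝ) : ℝ :=
  (1 / Real.pi) * ∫ s in (0 : ℝ)..Real.pi, Real.cos (s - x * Real.sin s)

/-- The Bessel function of the second kind (Neumann function) of order 1
(Schläfli's integral, `x > 0`). -/
def besselN1 (x : ℝ) : ℝ :=
  (1 / Real.pi) * (∫ s in (0 : ℝ)..Real.pi, Real.sin (x * Real.sin s - s)) -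
    (1 / Real.pi) *
      ∫ t in Ioi (0 : ℝ), (Real.exp t - Real.exp (-t)) * Real.exp (-x * Real.sinh t)

/-- The MacDonald function of order 1 (`x > 0`). -/
def besselK1 (x : ℝ) : ℝ :=
  ∫ t in Ioi (0 : ℝ), Real.exp (-x * Real.cosh t) * Real.cosh t

/-! ### The causal function, with a mass that may depend on the point

All the functionals below are centred at a source point `y` and act on functions `ψ` of the field
point `x'`; their kernels depend on `x = x' - y`. The mass `κ` is a function of `x'`; the free
causal function is the case of a constant `κ`. -/

/-- The density of `δ((x' - y)²)` on the light cone of `y`, integrated against `ψ`: it is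
`(ψ(y + (|r|, r)) + ψ(y + (-|r|, r))) / (2|r|)`, a function of `r ∈ ℝ³`. -/
def coneDensity (y : Spacetime) (ψ : Spacetime → ℂ) (r : ℝ × ℝ × ℝ) : ℂ :=
  (ψ (y + (Real.sqrt (r.1 ^ 2 + r.2.1 ^ 2 + r.2.2 ^ 2), r)) +
      ψ (y + (-Real.sqrt (r.1 ^ 2 + r.2.1 ^ 2 + r.2.2 ^ 2), r))) /
    ((2 * Real.sqrt (r.1 ^ 2 + r.2.1 ^ 2 + r.2.2 ^ 2) : ℝ) : ℂ)

/-- The kernel `(κ/2) θ(λ²) J₁(κλ)/λ`, where `λ = √(x²)`. -/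
def timelikeKernel (κ : ℝ) (x : Spacetime) : ℝ :=
  κ / 2 * (heaviside (minkSq x) * besselJ1 (κ * Real.sqrt (minkSq x)) / Real.sqrt (minkSq x))

/-- The distribution `δ(λ²) - (κ/2) θ(λ²) J₁(κλ)/λ`, paired with `ψ`. -/
def bracket (κ : Spacetime → ℝ) (y : Spacetime) (ψ : Spacetime → ℂ) : ℂ :=
  (∫ r : ℝ × ℝ × ℝ, coneDensity y ψ r) -
    ∫ x' : Spacetime, (timelikeKernel (κ x') (x' - y) : ℂ) * ψ x'

/-- `Δ_S = (1/2π) (δ(λ²) - (κ/2) θ(λ²) J₁(κλ)/λ)`, paired with `ψ`. -/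
def deltaS (κ : Spacetime → ℝ) (y : Spacetime) (ψ : Spacetime → ℂ) : ℂ :=
  (1 / (2 * Real.pi) : ℂ) * bracket κ y ψ

/-- The function `Δ⁽¹⁾ = (κ/4π) (θ(λ²) N₁(κλ)/λ + (2/π) θ(-λ²) K₁(κλ̃)/λ̃)` off the light cone,
where `λ = √(x²)` and `λ̃ = √(-x²)`. -/
def delta1Kernel (κ : ℝ) (x : Spacetime) : ℝ :=
  κ / (4 * Real.pi) *
    (heaviside (minkSq x) * besselN1 (κ * Real.sqrt (minkSq x)) / Real.sqrt (minkSq x) +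
      2 / Real.pi *
        (heaviside (-minkSq x) * besselK1 (κ * Real.sqrt (-minkSq x)) / Real.sqrt (-minkSq x)))

/-- The integral of `Δ⁽¹⁾ ψ` over the region `|x²| > ε`. -/
def delta1Trunc (κ : Spacetime → ℝ) (y : Spacetime) (ψ : Spacetime → ℂ) (ε : ℝ) : ℂ :=
  ∫ x' in {x' : Spacetime | ε < |minkSq (x' - y)|}, (delta1Kernel (κ x') (x' - y) : ℂ) * ψ x'

/-- `Δ⁽¹⁾` paired with `ψ`: the kernel is singular like `1/x²` at the light cone, and the pairing
is the principal value there. -/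
def delta1 (κ : Spacetime → ℝ) (y : Spacetime) (ψ : Spacetime → ℂ) : ℂ :=
  limUnder (𝓝[>] (0 : ℝ)) (delta1Trunc κ y ψ)

/-- The causal function `Δ_C = (Δ_S + i Δ⁽¹⁾) / 2`, paired with `ψ`. -/
def deltaC (κ : Spacetime → ℝ) (y : Spacetime) (ψ : Spacetime → ℂ) : ℂ :=
  (1 / 2 : ℂ) * (deltaS κ y ψ + Complex.I * delta1 κ y ψ)

/-- All integrals and the principal value limit in the pairing of `Δ_C` with `ψ` exist. -/
def CausalPairingExists (κ : Spacetime → ℝ) (y : Spacetime) (ψ : Spacetime → ℂ) : Prop :=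
  Integrable (coneDensity y ψ) ∧
  Integrable (fun x' : Spacetime => (timelikeKernel (κ x') (x' - y) : ℂ) * ψ x') ∧
  (∀ ε : ℝ, 0 < ε → IntegrableOn
    (fun x' : Spacetime => (delta1Kernel (κ x') (x' - y) : ℂ) * ψ x')
    {x' : Spacetime | ε < |minkSq (x' - y)|}) ∧
  Tendsto (delta1Trunc κ y ψ) (𝓝[>] (0 : ℝ)) (𝓝 (delta1 κ y ψ))

/-! ### The proper-time integral -/

/-- The integrand `exp(-i m²(x')/(4α) - i x² α)` of the proper-time integral, `x = x' - y`. -/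
def properTimeKernel (msq : Spacetime → ℝ) (y : Spacetime) (α : ℝ) (x' : Spacetime) : ℂ :=
  Complex.exp (-Complex.I * (msq x' : ℂ) / (4 * (α : ℂ)) -
    Complex.I * (minkSq (x' - y) : ℂ) * (α : ℂ))

/-- The integrand of the proper-time integral at a fixed `α`, paired with `ψ`. -/
def properTimeSlice (msq : Spacetime → ℝ) (y : Spacetime) (ψ : Spacetime → ℂ) (α : ℝ) : ℂ :=
  ∫ x' : Spacetime, properTimeKernel msq y α x' * ψ x'

/-- The proper-time integral `∫₀^∞ exp(-i m²/(4α) - i x² α) dα` as a distribution (weak integral),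
paired with `ψ`. -/
def properTimeIntegral (msq : Spacetime → ℝ) (y : Spacetime) (ψ : Spacetime → ℂ) : ℂ :=
  ∫ α in Ioi (0 : ℝ), properTimeSlice msq y ψ α

/-- The integrals in the pairing of the proper-time integral with `ψ` converge absolutely. -/
def ProperTimePairingExists (msq : Spacetime → ℝ) (y : Spacetime) (ψ : Spacetime → ℂ) : Prop :=
  (∀ α : ℝ, 0 < α → Integrable (fun x' : Spacetime => properTimeKernel msq y α x' * ψ x')) ∧
  IntegrableOn (properTimeSlice msq y ψ) (Ioi (0 : ℝ))

/-! ### The Volkov potential `A_μ = (A₁(ξ), A₂(ξ), 0, 0)` -/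

/-- The mean value `(b - a)⁻¹ ∫_a^b f(ξ) dξ`. -/
def mean (f : ℝ → ℝ) (a b : ℝ) : ℝ := (b - a)⁻¹ * ∫ s in a..b, f s

/-- The shifted squared mass
`k₀²(ξ', ξ'') = k₀² + (ξ'-ξ'')⁻¹ ∫ A_μ² dξ - ((ξ'-ξ'')⁻¹ ∫ A_μ dξ)²`, where
`A_μ² = A₁² + A₂²` and the integrals are over `[ξ'', ξ']`. -/
def massSq (A₁ A₂ : ℝ → ℝ) (k₀ ξ' ξ'' : ℝ) : ℝ :=
  k₀ ^ 2 + mean (fun s => A₁ s ^ 2 + A₂ s ^ 2) ξ'' ξ' -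
    (mean A₁ ξ'' ξ' ^ 2 + mean A₂ ξ'' ξ' ^ 2)

/-- The shifted mass `k₀(ξ', ξ'')`. -/
def mass (A₁ A₂ : ℝ → ℝ) (k₀ ξ' ξ'' : ℝ) : ℝ := Real.sqrt (massSq A₁ A₂ k₀ ξ' ξ'')

/-- The factor `C(x', x'') = exp(-i ∫ A_μ dx_μ)`, the integral being taken along the straight
segment from `x''` to `x'`. -/
def gaugeFactor (A₁ A₂ : ℝ → ℝ) (x' x'' : Spacetime) : ℂ :=
  Complex.exp (-Complex.I *
    ((∫ s in (0 : ℝ)..1,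
      ((x' - x'').2.1 * A₁ (xi (x'' + s • (x' - x''))) +
        (x' - x'').2.2.1 * A₂ (xi (x'' + s • (x' - x'')))) : ℝ) : ℂ))

/-- The phase factor `exp(-i (x'-x'')_μ (ξ'-ξ'')⁻¹ ∫_{ξ''}^{ξ'} A_μ dξ)`. -/
def volkovPhase (A₁ A₂ : ℝ → ℝ) (x' x'' : Spacetime) : ℂ :=
  Complex.exp (-Complex.I *
    (((x' - x'').2.1 * mean A₁ (xi x'') (xi x') +
      (x' - x'').2.2.1 * mean A₂ (xi x'') (xi x') : ℝ) : ℂ))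

/-- Schwinger's propagator
`G_S(x', x'') = -(1/4π²) C(x', x'') ∫₀^∞ exp(-i k₀²(ξ', ξ'')/(4α) - i x² α) dα`,
`x = x' - x''`, as a distribution in `x'`, paired with `φ`. -/
def schwingerPropagator (A₁ A₂ : ℝ → ℝ) (k₀ : ℝ) (x'' : Spacetime) (φ : Spacetime → ℂ) : ℂ :=
  -(1 / (4 * Real.pi ^ 2) : ℂ) *
    properTimeIntegral (fun x' => massSq A₁ A₂ k₀ (xi x') (xi x'')) x''
      (fun x' => gaugeFactor A₁ A₂ x' x'' * φ x')

end Volkov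

end

/-! The mass depends on `x'` only through ξ'. In the volume-preserving coordinates (x₁, x₂, ξ, z)
centred at `x''` (`chart`) the Minkowski square is s = 2ξz + ξ² − x₁² − x₂². On a fibre w = (x₁, x₂,
ξ) with ξ ≠ 0 the mass is therefore a constant m and s is an affine coordinate with |ds| = 2|ξ|
|dz|. Everything reduces to the one-dimensional identity ∫₀^∞ exp(−im²/(4α) − isα) dα = π δ(s) +
p.v. `properTimeDensity m s`, integrated over the base with the weight 1/(2|ξ|).

For the one-dimensional identity a regulator exp(−δα) is inserted. Off s = 0, the substitution α =
(m/(2√|s|)) eᵗ and a rotation of both half-lines of integration allow δ → 0 and produce the integral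
representations of J₁ and N₁ for s > 0, of K₁ for s < 0 (`tendsto_regProperTime`). Near s = 0 the
integral is compared with the massless one, 1/(δ + is), whose limit is π δ(s) + p.v. 1/(is); the
difference is at most 2m|s|^(−1/2) + m²/2 uniformly in δ (`norm_regProperTime_sub_le`). The
regularized and the truncated pairings on a fibre thus have limits that differ by π g(0) only
(`IsFiberFunction.tendsto_integral_reg`, `IsFiberFunction.tendsto_integral_offCone`).

Integrating over the base needs a dominating function, although 1/|ξ| is not integrable and a test
function becomes steep in s as ξ → 0. Hölder continuity of order 1/4 in s brings the cost to
|ξ|^(−5/4); for given s and ξ, however, only a set of x₁ of measure O(|ξ|^(1/2)) meets the support,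
and |ξ|^(−3/4) is integrable (`integrable_domIntegrand`). The values at s = 0 assemble to the
measure on the light cone by the change of variable ξ ↦ z on each sheet
(`sheet_change_of_variables`).

The regulator can be removed under the α-integral because the slices are absolutely integrable:
stationary phase in x₁ and one integration by parts in z give decay α^(−5/4)
(`HasChartDerivs.exists_norm_slice_le`). Only derivatives in x₁ and z at fixed ξ occur, so the
factor C, which is merely continuous in ξ, can be absorbed into the test function.

Finally, C is the phase with mean potentials because ξ is affine along the segment, except on the
hyperplane ξ' = ξ'', which is null for the volume and for the cone measure. The bound on the shifted
mass is the nonnegativity of a variance. -/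

namespace Volkov

/-! ### Contour rotation and the exponential form of the proper-time integral. -/

/-- Rotation of a half-line of integration for an entire function. -/
theorem integral_Ioi_eq_integral_Ioi_add_mul_I {g : ℂ → ℂ} (hg : Differentiable ℂ g) {w K : ℝ}
    (hb : ∀ u : ℝ, 0 ≤ u → ∀ y ∈ uIcc 0 w, ‖g (u + y * Complex.I)‖ ≤ K * Real.exp (-u)) :
    ∫ u in Ioi (0 : ℝ), g u = (∫ u in Ioi (0 : ℝ), g (u + w * Complex.I)) +
      Complex.I * ∫ y in (0 : ℝ)..w, g (y * Complex.I) := by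
  have hc := hg.continuous
  have hexp : IntegrableOn (fun u : ℝ => K * Real.exp (-u)) (Ioi 0) := by
    have := (exp_neg_integrableOn_Ioi 0 one_pos).const_mul K
    simpa [IntegrableOn] using this
  have hint : ∀ y ∈ uIcc 0 w, IntegrableOn (fun u : ℝ => g (u + y * Complex.I)) (Ioi 0) := by
    intro y hy
    refine Integrable.mono' hexp ?_ ?_
    · exact (by fun_prop : Continuous fun u : ℝ => g (u + y * Complex.I)).aestronglyMeasurable
    · exact (ae_restrict_mem measurableSet_Ioi).mono fun u hu => hb u (le_of_lt hu) y hy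
  have h0 : IntegrableOn (fun u : ℝ => g u) (Ioi 0) := by
    simpa using hint 0 left_mem_uIcc
  have h1 := hint w right_mem_uIcc
  have l0 := intervalIntegral_tendsto_integral_Ioi 0 h0 tendsto_id
  have l1 := intervalIntegral_tendsto_integral_Ioi 0 h1 tendsto_id
  have l2 : Tendsto (fun T : ℝ => ∫ y in (0 : ℝ)..w, g (T + y * Complex.I)) atTop (𝓝 0) := by
    have : Tendsto (fun T : ℝ => K * Real.exp (-T) * |w - 0|) atTop (𝓝 0) := by
      have := ((Real.tendsto_exp_neg_atTop_nhds_zero).const_mul K).mul_const |w - 0|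
      simpa using this
    refine squeeze_zero_norm' ?_ this
    filter_upwards [eventually_ge_atTop 0] with T hT
    exact intervalIntegral.norm_integral_le_of_norm_le_const fun y hy =>
      hb T hT y (uIoc_subset_uIcc hy)
  -- Cauchy's theorem on the rectangle with opposite corners 0 and T + iw; its far vertical side is
  -- the term that `l2` sends to 0.
  have key : ∀ T : ℝ, (∫ u in (0 : ℝ)..T, g u) = (∫ u in (0 : ℝ)..T, g (u + w * Complex.I)) -
      Complex.I * (∫ y in (0 : ℝ)..w, g (T + y * Complex.I)) +
      Complex.I * ∫ y in (0 : ℝ)..w, g (y * Complex.I) := by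
    intro T
    have := Complex.integral_boundary_rect_eq_zero_of_differentiableOn g 0 (T + w * Complex.I)
      hg.differentiableOn
    simp only [Complex.zero_re, Complex.zero_im, Complex.add_re, Complex.ofReal_re,
      Complex.mul_re, Complex.I_re, mul_zero, Complex.ofReal_im, Complex.I_im, mul_one, sub_self,
      add_zero, Complex.add_im, Complex.mul_im, zero_add, Complex.ofReal_zero, zero_mul,
      smul_eq_mul] at this
    linear_combination this
  refine tendsto_nhds_unique l0 ?_
  have := (l1.sub (l2.const_mul Complex.I)).add_const
    (Complex.I * ∫ y in (0 : ℝ)..w, g (y * Complex.I))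
  rw [mul_zero, sub_zero] at this
  exact this.congr fun T => (key T).symm

/-- The entire integrand `exp (pτ - A e^{-τ} - B e^τ)`. -/
noncomputable def expIntegrand (p : ℝ) (A B τ : ℂ) : ℂ :=
  Complex.exp (p * τ - A * Complex.exp (-τ) - B * Complex.exp τ)

theorem differentiable_expIntegrand (p : ℝ) (A B : ℂ) : Differentiable ℂ (expIntegrand p A B) := by
  unfold expIntegrand; fun_prop

theorem expIntegrand_neg (p : ℝ) (A B τ : ℂ) :
    expIntegrand p A B (-τ) = expIntegrand (-p) B A τ := by
  unfold expIntegrand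
  congr 1
  push_cast
  rw [neg_neg]; ring

theorem norm_expIntegrand (p : ℝ) (A B : ℂ) (u y : ℝ) :
    ‖expIntegrand p A B (u + y * Complex.I)‖ =
      Real.exp (p * u - Real.exp (-u) * (A.re * Real.cos y + A.im * Real.sin y) -
        Real.exp u * (B.re * Real.cos y - B.im * Real.sin y)) := by
  unfold expIntegrand
  rw [Complex.norm_exp]
  congr 1
  simp only [Complex.sub_re, Complex.mul_re, Complex.exp_re, Complex.exp_im, Complex.neg_re,
    Complex.neg_im, Complex.add_re, Complex.add_im, Complex.ofReal_re, Complex.ofReal_im,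
    Complex.I_re, Complex.I_im, Complex.mul_im, Real.cos_neg, Real.sin_neg]
  simp only [mul_zero, mul_one, sub_zero, add_zero, zero_mul, zero_add]
  ring

/-- Only eˣ ≥ x²/2 at x = κeᵘ is needed: it trades the growth eᵘ for the decay e⁻ᵘ that the rotation
of contours asks for. -/
theorem exp_sub_mul_exp_le {κ : ℝ} (hκ : 0 < κ) (u : ℝ) :
    Real.exp (u - κ * Real.exp u) ≤ 2 / κ ^ 2 * Real.exp (-u) := by
  have h1 := Real.quadratic_le_exp_of_nonneg (x := κ * Real.exp u) (by positivity)
  have h2 : (κ * Real.exp u) ^ 2 / 2 ≤ Real.exp (κ * Real.exp u) := by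
    have : 0 < κ * Real.exp u := by positivity
    linarith
  rw [Real.exp_sub, div_le_iff₀ (Real.exp_pos _)]
  calc Real.exp u = 2 / κ ^ 2 * Real.exp (-u) * ((κ * Real.exp u) ^ 2 / 2) := by
        rw [Real.exp_neg]; field_simp
    _ ≤ _ := by gcongr

/-- The regularized proper-time integral. -/
noncomputable def regProperTime (δ m s : ℝ) : ℂ :=
  ∫ α in Ioi (0 : ℝ), Complex.exp (-Complex.I * ((m ^ 2 : ℝ) : ℂ) / (4 * (α : ℂ)) -
    ((δ : ℂ) + Complex.I * (s : ℂ)) * (α : ℂ))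

/-- The kernel `(m/2) θ(s) J₁(m√s)/√s`. -/
noncomputable def timelikeDensity (m s : ℝ) : ℝ :=
  m / 2 * (heaviside s * besselJ1 (m * Real.sqrt s) / Real.sqrt s)

/-- The function `Δ⁽¹⁾` of the Minkowski square. -/
noncomputable def delta1Density (m s : ℝ) : ℝ :=
  m / (4 * Real.pi) *
    (heaviside s * besselN1 (m * Real.sqrt s) / Real.sqrt s +
      2 / Real.pi *
        (heaviside (-s) * besselK1 (m * Real.sqrt (-s)) / Real.sqrt (-s)))

/-- The value of the proper-time integral off the light cone. -/
noncomputable def properTimeDensity (m s : ℝ) : ℂ :=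
  -(Real.pi * timelikeDensity m s : ℝ) + Complex.I * (2 * Real.pi ^ 2 * delta1Density m s : ℝ)

theorem integral_Ioi_zero_eq_integral_exp {c : ℝ} (hc : 0 < c) (h : ℝ → ℂ) :
    ∫ α in Ioi (0 : ℝ), h α = ∫ t : ℝ, (c * Real.exp t) • h (c * Real.exp t) := by
  have himg : (fun t : ℝ => c * Real.exp t) '' univ = Ioi 0 := by
    ext α
    simp only [image_univ, mem_range, mem_Ioi]
    constructor
    · rintro ⟨t, rfl⟩; positivity
    · intro hα
      refine ⟨Real.log (α / c), ?_⟩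
      rw [Real.exp_log (by positivity)]; field_simp
  rw [← himg, integral_image_eq_integral_abs_deriv_smul MeasurableSet.univ
    (fun t _ => ((Real.hasDerivAt_exp t).const_mul c).hasDerivWithinAt), setIntegral_univ]
  · congr 1; ext t; rw [abs_of_pos (by positivity)]
  · intro t _ t' _ h
    exact Real.exp_injective (mul_left_cancel₀ hc.ne' h)

theorem integral_eq_Ioi_add_Ioi_neg {f : ℝ → ℂ} (h1 : IntegrableOn f (Ioi 0))
    (h2 : IntegrableOn (fun t => f (-t)) (Ioi 0)) :
    ∫ t, f t = (∫ t in Ioi (0 : ℝ), f t) + ∫ t in Ioi (0 : ℝ), f (-t) := by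
  have h3 : IntegrableOn f (Iic 0) := by
    rw [integrableOn_Iic_iff_integrableOn_Iio]
    have h4 : IntegrableOn (fun t => f (-(-t))) (Iio 0) := by
      refine IntegrableOn.comp_neg_Iio (f := fun t => f (-t)) ?_
      rwa [neg_zero]
    simpa only [neg_neg] using h4
  rw [integral_comp_neg_Ioi, neg_zero, add_comm, intervalIntegral.integral_Iic_add_Ioi h3 h1]

end Volkov

/-! ### Rotation to steepest descent and removal of the regulator. -/

namespace Volkov

/-- The contour integral obtained by rotating the two half-lines of
`∫ exp (t - (ix/2) e^{-t} - (d + iσx/2) e^t) dt` onto the directions of steepest descent. -/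
noncomputable def rotatedIntegral (σ x d : ℝ) : ℂ :=
  ((∫ u in Ioi (0 : ℝ), expIntegrand 1 (Complex.I * (x / 2 : ℝ))
      (d + Complex.I * (σ * x / 2 : ℝ)) (u + (-(σ * (Real.pi / 2)) : ℝ) * Complex.I)) +
    Complex.I * ∫ y in (0 : ℝ)..(-(σ * (Real.pi / 2))), expIntegrand 1 (Complex.I * (x / 2 : ℝ))
      (d + Complex.I * (σ * x / 2 : ℝ)) (y * Complex.I)) +
  ((∫ u in Ioi (0 : ℝ), expIntegrand (-1) (d + Complex.I * (σ * x / 2 : ℝ))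
      (Complex.I * (x / 2 : ℝ)) (u + (-(Real.pi / 2) : ℝ) * Complex.I)) +
    Complex.I * ∫ y in (0 : ℝ)..(-(Real.pi / 2)), expIntegrand (-1)
      (d + Complex.I * (σ * x / 2 : ℝ)) (Complex.I * (x / 2 : ℝ)) (y * Complex.I))

/-- Serves to bound d cos y + (x/2)|sin y| below by min(d, x/2) on the whole strip swept by the
rotation. -/
theorem one_le_abs_sin_add_cos {y : ℝ} (hy : |y| ≤ Real.pi / 2) :
    1 ≤ |Real.sin y| + Real.cos y := by
  have hc := Real.cos_nonneg_of_mem_Icc (abs_le.1 hy)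
  nlinarith [Real.sin_sq_add_cos_sq y, abs_nonneg (Real.sin y), sq_abs (Real.sin y),
    mul_nonneg (abs_nonneg (Real.sin y)) hc]

/-- The rotation goes to the side where σ sin y ≤ 0, so that the coefficient of −eᵘ in the exponent
is d cos y + (x/2)|sin y|, which is positive. The term in e⁻ᵘ costs at most exp(x/2). The constant
degenerates as d → 0, so this bound justifies the rotation at fixed d only. -/
theorem norm_expIntegrand_right_le {σ x d : ℝ} (hσ : σ = 1 ∨ σ = -1) (hx : 0 < x) (hd : 0 < d)
    {u : ℝ} (hu : 0 ≤ u) {y : ℝ} (hy : y ∈ uIcc 0 (-(σ * (Real.pi / 2)))) :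
    ‖expIntegrand 1 (Complex.I * (x / 2 : ℝ)) (d + Complex.I * (σ * x / 2 : ℝ))
      (u + y * Complex.I)‖ ≤
      Real.exp (x / 2) * (2 / (min d (x / 2)) ^ 2) * Real.exp (-u) := by
  have hpi := Real.pi_pos
  have hκ : 0 < min d (x / 2) := lt_min hd (by positivity)
  have hy' : |y| ≤ Real.pi / 2 ∧ |Real.sin y| = -(σ * Real.sin y) := by
    rcases hσ with rfl | rfl
    · rw [uIcc_of_ge (by linarith)] at hy
      have h := Real.sin_nonpos_of_nonpos_of_neg_pi_le (x := y) hy.2 (by linarith [hy.1])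
      exact ⟨abs_le.2 ⟨by linarith [hy.1], by linarith [hy.2]⟩, by rw [abs_of_nonpos h]; ring⟩
    · rw [uIcc_of_le (by linarith)] at hy
      have h := Real.sin_nonneg_of_nonneg_of_le_pi (x := y) hy.1 (by linarith [hy.2])
      exact ⟨abs_le.2 ⟨by linarith [hy.1], by linarith [hy.2]⟩, by rw [abs_of_nonneg h]; ring⟩
  have h1 := one_le_abs_sin_add_cos hy'.1
  have hcos := Real.cos_nonneg_of_mem_Icc (abs_le.1 hy'.1)
  rw [norm_expIntegrand, mul_assoc]
  refine le_trans ?_ (mul_le_mul_of_nonneg_left (exp_sub_mul_exp_le hκ u) (Real.exp_pos _).le)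
  rw [← Real.exp_add]
  apply Real.exp_le_exp.2
  simp only [Complex.mul_re, Complex.mul_im, Complex.I_re, Complex.I_im, Complex.ofReal_re,
    Complex.ofReal_im, Complex.add_re, Complex.add_im]
  have h2 : min d (x / 2) ≤ d * Real.cos y + x / 2 * |Real.sin y| := by
    have a1 : min d (x / 2) * Real.cos y ≤ d * Real.cos y :=
      mul_le_mul_of_nonneg_right (min_le_left _ _) hcos
    have a2 : min d (x / 2) * |Real.sin y| ≤ x / 2 * |Real.sin y| :=
      mul_le_mul_of_nonneg_right (min_le_right _ _) (abs_nonneg _)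
    nlinarith
  have h3 : Real.exp u * min d (x / 2) ≤ Real.exp u * (d * Real.cos y + x / 2 * |Real.sin y|) :=
    mul_le_mul_of_nonneg_left h2 (Real.exp_pos _).le
  have h4 : -(x / 2) ≤ Real.exp (-u) * (x / 2 * Real.sin y) := by
    have e1 : Real.exp (-u) ≤ 1 := Real.exp_le_one_iff.2 (by linarith)
    have e2 : |Real.exp (-u) * Real.sin y| ≤ 1 := by
      rw [abs_mul, abs_of_pos (Real.exp_pos _)]
      exact mul_le_one₀ e1 (abs_nonneg _) (Real.abs_sin_le_one _)
    nlinarith [(abs_le.1 e2).1]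
  rw [hy'.2] at h3
  nlinarith

/-- Here p = −1 already supplies e⁻ᵘ and the term in eᵘ has a favourable sign for sin y ≤ 0. No
decay is drawn from d, so the bound is uniform in d ≥ 0. -/
theorem norm_expIntegrand_left_le {σ x d : ℝ} (hσ : σ = 1 ∨ σ = -1) (hx : 0 < x) (hd : 0 ≤ d)
    {u : ℝ} (hu : 0 ≤ u) {y : ℝ} (hy : y ∈ uIcc 0 (-(Real.pi / 2))) :
    ‖expIntegrand (-1) (d + Complex.I * (σ * x / 2 : ℝ)) (Complex.I * (x / 2 : ℝ))
      (u + y * Complex.I)‖ ≤ Real.exp (x / 2) * Real.exp (-u) := by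
  have hpi := Real.pi_pos
  rw [uIcc_of_ge (by linarith)] at hy
  have hsin := Real.sin_nonpos_of_nonpos_of_neg_pi_le (x := y) hy.2 (by linarith [hy.1])
  have hcos := Real.cos_nonneg_of_mem_Icc (x := y) ⟨by linarith [hy.1], by linarith [hy.2]⟩
  rw [norm_expIntegrand, ← Real.exp_add]
  apply Real.exp_le_exp.2
  simp only [Complex.mul_re, Complex.mul_im, Complex.I_re, Complex.I_im, Complex.ofReal_re,
    Complex.ofReal_im, Complex.add_re, Complex.add_im]
  have h4 : -(x / 2) ≤ Real.exp (-u) * (σ * x / 2 * Real.sin y) := by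
    have e1 : Real.exp (-u) ≤ 1 := Real.exp_le_one_iff.2 (by linarith)
    have e2 : |Real.exp (-u) * Real.sin y| ≤ 1 := by
      rw [abs_mul, abs_of_pos (Real.exp_pos _)]
      exact mul_le_one₀ e1 (abs_nonneg _) (Real.abs_sin_le_one _)
    rcases hσ with rfl | rfl
    · nlinarith [(abs_le.1 e2).1]
    · nlinarith [(abs_le.1 e2).2]
  have h5 : 0 ≤ Real.exp (-u) * (d * Real.cos y) := by positivity
  have h6 : Real.exp u * (x / 2 * Real.sin y) ≤ 0 :=
    mul_nonpos_of_nonneg_of_nonpos (Real.exp_pos _).le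
      (mul_nonpos_of_nonneg_of_nonpos (by positivity) hsin)
  nlinarith

theorem integrableOn_expIntegrand {p K w : ℝ} {A B : ℂ}
    (hb : ∀ u : ℝ, 0 ≤ u → ‖expIntegrand p A B (u + w * Complex.I)‖ ≤ K * Real.exp (-u)) :
    IntegrableOn (fun u : ℝ => expIntegrand p A B (u + w * Complex.I)) (Ioi 0) := by
  have hexp : IntegrableOn (fun u : ℝ => K * Real.exp (-u)) (Ioi 0) := by
    have := (exp_neg_integrableOn_Ioi 0 one_pos).const_mul K
    simpa [IntegrableOn] using this
  have hc := (differentiable_expIntegrand p A B).continuous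
  refine Integrable.mono' hexp ?_ ?_
  · exact (by fun_prop :
      Continuous fun u : ℝ => expIntegrand p A B (u + w * Complex.I)).aestronglyMeasurable
  · exact (ae_restrict_mem measurableSet_Ioi).mono fun u hu => hb u (le_of_lt hu)

theorem integral_expIntegrand_eq_rotatedIntegral {σ x d : ℝ} (hσ : σ = 1 ∨ σ = -1) (hx : 0 < x)
    (hd : 0 < d) :
    ∫ t : ℝ, expIntegrand 1 (Complex.I * (x / 2 : ℝ)) (d + Complex.I * (σ * x / 2 : ℝ)) t =
      rotatedIntegral σ x d := by
  have hR : ∀ u : ℝ, 0 ≤ u → ∀ y ∈ uIcc 0 (-(σ * (Real.pi / 2))), _ :=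
    fun u hu y hy => norm_expIntegrand_right_le hσ hx hd hu hy
  have hL : ∀ u : ℝ, 0 ≤ u → ∀ y ∈ uIcc 0 (-(Real.pi / 2)), _ :=
    fun u hu y hy => norm_expIntegrand_left_le hσ hx hd.le hu hy
  have e1 := integral_Ioi_eq_integral_Ioi_add_mul_I (differentiable_expIntegrand _ _ _) hR
  have e2 := integral_Ioi_eq_integral_Ioi_add_mul_I (differentiable_expIntegrand _ _ _) hL
  have i1 := integrableOn_expIntegrand (w := 0) fun u hu => hR u hu 0 left_mem_uIcc
  have i2 := integrableOn_expIntegrand (w := 0) fun u hu => hL u hu 0 left_mem_uIcc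
  simp only [Complex.ofReal_zero, zero_mul, add_zero] at i1 i2
  rw [rotatedIntegral, ← e1, ← e2, integral_eq_Ioi_add_Ioi_neg i1]
  · congr 1
    refine integral_congr_ae (ae_of_all _ fun t => ?_)
    simp only [Complex.ofReal_neg]
    rw [expIntegrand_neg]
  · refine i2.congr (ae_of_all _ fun t => ?_)
    simp only [Complex.ofReal_neg]
    rw [expIntegrand_neg]

/-- On the final line cos y = 0, so d drops out of the modulus and the decay comes from x alone.
This uniformity is what allows d → 0. -/
theorem norm_expIntegrand_right_rotated_le {σ x d : ℝ} (hσ : σ = 1 ∨ σ = -1) (hx : 0 < x)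
    {u : ℝ} (hu : 0 ≤ u) :
    ‖expIntegrand 1 (Complex.I * (x / 2 : ℝ)) (d + Complex.I * (σ * x / 2 : ℝ))
      (u + (-(σ * (Real.pi / 2)) : ℝ) * Complex.I)‖ ≤
      Real.exp (x / 2) * (2 / (x / 2) ^ 2) * Real.exp (-u) := by
  rw [norm_expIntegrand, mul_assoc]
  refine le_trans ?_ (mul_le_mul_of_nonneg_left
    (exp_sub_mul_exp_le (half_pos hx) u) (Real.exp_pos _).le)
  rw [← Real.exp_add]
  apply Real.exp_le_exp.2
  have e1 : Real.exp (-u) ≤ 1 := Real.exp_le_one_iff.2 (by linarith)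
  have e3 := Real.exp_pos (-u)
  rcases hσ with rfl | rfl
  · simp
    nlinarith
  · simp
    nlinarith

theorem tendsto_rotatedIntegral {σ x : ℝ} (hσ : σ = 1 ∨ σ = -1) (hx : 0 < x) :
    Tendsto (rotatedIntegral σ x) (𝓝[>] 0) (𝓝 (rotatedIntegral σ x 0)) := by
  have hexp : ∀ K : ℝ, IntegrableOn (fun u : ℝ => K * Real.exp (-u)) (Ioi 0) := by
    intro K
    have := (exp_neg_integrableOn_Ioi 0 one_pos).const_mul K
    simpa [IntegrableOn] using this
  unfold rotatedIntegral
  refine ((Tendsto.add ?_ (Tendsto.const_mul _ ?_)).add (Tendsto.add ?_ (Tendsto.const_mul _ ?_)))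
  · refine tendsto_integral_filter_of_dominated_convergence
      (fun u => Real.exp (x / 2) * (2 / (x / 2) ^ 2) * Real.exp (-u)) ?_ ?_ (hexp _) ?_
    · refine Eventually.of_forall fun d => ?_
      exact (by unfold expIntegrand; fun_prop : Continuous fun u : ℝ => expIntegrand 1 _ _
        (u + (-(σ * (Real.pi / 2)) : ℝ) * Complex.I)).aestronglyMeasurable
    · refine Eventually.of_forall fun d => ?_
      exact (ae_restrict_mem measurableSet_Ioi).mono fun u hu =>
        norm_expIntegrand_right_rotated_le hσ hx (le_of_lt hu)
    · refine ae_of_all _ fun u => ?_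
      refine Tendsto.mono_left (Continuous.tendsto ?_ 0) nhdsWithin_le_nhds
      unfold expIntegrand; fun_prop
  · refine Tendsto.mono_left (Continuous.tendsto ?_ 0) nhdsWithin_le_nhds
    refine intervalIntegral.continuous_parametric_intervalIntegral_of_continuous' ?_ _ _
    unfold Function.uncurry expIntegrand; fun_prop
  · refine tendsto_integral_filter_of_dominated_convergence
      (fun u => Real.exp (x / 2) * Real.exp (-u)) ?_ ?_ (hexp _) ?_
    · refine Eventually.of_forall fun d => ?_
      exact (by unfold expIntegrand; fun_prop : Continuous fun u : ℝ => expIntegrand (-1) _ _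
        (u + (-(Real.pi / 2) : ℝ) * Complex.I)).aestronglyMeasurable
    · filter_upwards [self_mem_nhdsWithin] with d hd
      exact (ae_restrict_mem measurableSet_Ioi).mono fun u hu =>
        norm_expIntegrand_left_le hσ hx (le_of_lt hd) (le_of_lt hu) right_mem_uIcc
    · refine ae_of_all _ fun u => ?_
      refine Tendsto.mono_left (Continuous.tendsto ?_ 0) nhdsWithin_le_nhds
      unfold expIntegrand; fun_prop
  · refine Tendsto.mono_left (Continuous.tendsto ?_ 0) nhdsWithin_le_nhds
    refine intervalIntegral.continuous_parametric_intervalIntegral_of_continuous' ?_ _ _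
    unfold Function.uncurry expIntegrand; fun_prop

/-- The scale m/(2l) in α = (m/(2l)) eᵗ balances the two phases: m²/(4α) and l²α become (ml/2)e⁻ᵗ
and (ml/2)eᵗ. -/
theorem regProperTime_eq {σ l m δ : ℝ} (hσ : σ = 1 ∨ σ = -1) (hl : 0 < l) (hm : 0 < m)
    (hδ : 0 < δ) :
    regProperTime δ m (σ * l ^ 2) =
      (m / (2 * l) : ℝ) * rotatedIntegral σ (m * l) (δ * (m / (2 * l))) := by
  have hc : 0 < m / (2 * l) := by positivity
  rw [regProperTime, integral_Ioi_zero_eq_integral_exp hc,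
    ← integral_expIntegrand_eq_rotatedIntegral hσ (by positivity) (by positivity),
    ← integral_const_mul]
  congr 1
  ext t
  have hl' : (l : ℂ) ≠ 0 := by exact_mod_cast hl.ne'
  have he := Complex.exp_ne_zero t
  have hm' : (m : ℂ) ≠ 0 := by exact_mod_cast hm.ne'
  rw [expIntegrand, Complex.real_smul, Complex.ofReal_mul (m / (2 * l)), Complex.ofReal_exp,
    mul_assoc, ← Complex.exp_add]
  refine congrArg _ (congrArg Complex.exp ?_)
  rw [Complex.exp_neg]
  push_cast
  field_simp
  ring

end Volkov

/-! ### Identification of the Bessel functions J₁, N₁ and K₁. -/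

namespace Volkov

theorem exp_neg_half_pi_mul_I :
    Complex.exp ((-(Real.pi / 2) : ℝ) * Complex.I) = -Complex.I := by
  have : ((-(Real.pi / 2) : ℝ) : ℂ) * Complex.I = -(Real.pi / 2 * Complex.I) := by push_cast; ring
  rw [this, Complex.exp_neg, Complex.exp_pi_div_two_mul_I, Complex.inv_I]

theorem exp_half_pi_mul_I :
    Complex.exp ((Real.pi / 2 : ℝ) * Complex.I) = Complex.I := by
  conv_rhs => rw [← Complex.exp_pi_div_two_mul_I]
  push_cast; rfl

theorem exp_sub_half_pi_mul_I (u : ℂ) :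
    Complex.exp (u + (-(Real.pi / 2) : ℝ) * Complex.I) = -Complex.I * Complex.exp u := by
  rw [Complex.exp_add, exp_neg_half_pi_mul_I, mul_comm]

theorem exp_add_half_pi_mul_I (u : ℂ) :
    Complex.exp (u + (Real.pi / 2 : ℝ) * Complex.I) = Complex.I * Complex.exp u := by
  rw [Complex.exp_add, exp_half_pi_mul_I, mul_comm]

theorem expIntegrand_one_sub (A B : ℂ) (u : ℝ) :
    expIntegrand 1 A B (u + (-(Real.pi / 2) : ℝ) * Complex.I) =
      -Complex.I * Complex.exp u *
        Complex.exp (-(A * Complex.I * Complex.exp (-u)) + B * Complex.I * Complex.exp u) := by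
  have h : -((u : ℂ) + (-(Real.pi / 2) : ℝ) * Complex.I) =
    -u + (Real.pi / 2 : ℝ) * Complex.I := by push_cast; ring
  rw [← exp_sub_half_pi_mul_I, ← Complex.exp_add, expIntegrand, h, exp_add_half_pi_mul_I,
    exp_sub_half_pi_mul_I]
  congr 1
  push_cast; ring

theorem expIntegrand_neg_one_sub (A B : ℂ) (u : ℝ) :
    expIntegrand (-1) A B (u + (-(Real.pi / 2) : ℝ) * Complex.I) =
      Complex.I * Complex.exp (-u) *
        Complex.exp (-(A * Complex.I * Complex.exp (-u)) + B * Complex.I * Complex.exp u) := by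
  have h : -((u : ℂ) + (-(Real.pi / 2) : ℝ) * Complex.I) =
    -u + (Real.pi / 2 : ℝ) * Complex.I := by push_cast; ring
  rw [← exp_add_half_pi_mul_I, ← Complex.exp_add, expIntegrand, h, exp_add_half_pi_mul_I,
    exp_sub_half_pi_mul_I]
  congr 1
  push_cast; ring

theorem expIntegrand_one_add (A B : ℂ) (u : ℝ) :
    expIntegrand 1 A B (u + (Real.pi / 2 : ℝ) * Complex.I) =
      Complex.I * Complex.exp u *
        Complex.exp (A * Complex.I * Complex.exp (-u) - B * Complex.I * Complex.exp u) := by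
  have h : -((u : ℂ) + (Real.pi / 2 : ℝ) * Complex.I) =
    -u + (-(Real.pi / 2) : ℝ) * Complex.I := by push_cast; ring
  rw [← exp_add_half_pi_mul_I, ← Complex.exp_add, expIntegrand, h, exp_add_half_pi_mul_I,
    exp_sub_half_pi_mul_I]
  congr 1
  push_cast; ring

/-- For A = B the exponentials combine to 2 cos y on the imaginary axis. Reflecting y in one of the
two vertical segments joins them to a single segment from −π/2 to π/2, and s = π/2 − y turns cos y
into sin s. -/
theorem integral_besselPhase (x : ℝ) :
    (Complex.I * ∫ y in (0 : ℝ)..(-(Real.pi / 2)), expIntegrand 1 (Complex.I * (x / 2 : ℝ))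
      (Complex.I * (x / 2 : ℝ)) (y * Complex.I)) +
    (Complex.I * ∫ y in (0 : ℝ)..(-(Real.pi / 2)), expIntegrand (-1) (Complex.I * (x / 2 : ℝ))
      (Complex.I * (x / 2 : ℝ)) (y * Complex.I)) =
    -∫ s in (0 : ℝ)..Real.pi, Complex.exp (Complex.I * ((s - x * Real.sin s : ℝ) : ℂ)) := by
  have hc : ∀ p : ℝ, Continuous fun y : ℝ => expIntegrand p (Complex.I * (x / 2 : ℝ))
      (Complex.I * (x / 2 : ℝ)) (y * Complex.I) := by
    intro p; unfold expIntegrand; fun_prop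
  have h1 : ∫ y in (0 : ℝ)..(-(Real.pi / 2)), expIntegrand 1 (Complex.I * (x / 2 : ℝ))
      (Complex.I * (x / 2 : ℝ)) (y * Complex.I) =
      -∫ y in (0 : ℝ)..(Real.pi / 2), expIntegrand (-1) (Complex.I * (x / 2 : ℝ))
        (Complex.I * (x / 2 : ℝ)) (y * Complex.I) := by
    rw [← intervalIntegral.integral_symm, ← neg_zero, ← intervalIntegral.integral_comp_neg, neg_zero]
    refine intervalIntegral.integral_congr fun y _ => ?_
    simp only [Complex.ofReal_neg, neg_mul, expIntegrand_neg]
  have h2 : ∫ s in (0 : ℝ)..Real.pi, Complex.exp (Complex.I * ((s - x * Real.sin s : ℝ) : ℂ)) =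
      ∫ y in (-(Real.pi / 2))..(Real.pi / 2), Complex.I *
        expIntegrand (-1) (Complex.I * (x / 2 : ℝ)) (Complex.I * (x / 2 : ℝ)) (y * Complex.I) := by
    have := intervalIntegral.integral_comp_sub_left (a := -(Real.pi / 2)) (b := Real.pi / 2)
      (fun s : ℝ => Complex.exp (Complex.I * ((s - x * Real.sin s : ℝ) : ℂ))) (Real.pi / 2)
    rw [sub_self, sub_neg_eq_add, add_halves] at this
    rw [← this]
    refine intervalIntegral.integral_congr fun y _ => ?_
    simp only [expIntegrand]
    rw [Real.sin_pi_div_two_sub]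
    have hI : ∀ z : ℂ, Complex.I * Complex.exp z =
        Complex.exp ((Real.pi / 2 : ℝ) * Complex.I + z) := fun z => by
      rw [Complex.exp_add, exp_half_pi_mul_I]
    rw [hI]
    congr 1
    have hcos := Complex.two_cos (y : ℂ)
    push_cast
    rw [neg_mul] at hcos
    linear_combination (-Complex.I * x / 2) * hcos
  have h3 := intervalIntegral.integral_add_adjacent_intervals (μ := volume)
    ((hc (-1)).intervalIntegrable (-(Real.pi / 2)) 0) ((hc (-1)).intervalIntegrable 0 (Real.pi / 2))
  rw [intervalIntegral.integral_symm] at h3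
  rw [h1, h2, intervalIntegral.integral_const_mul]
  linear_combination -Complex.I * h3

/-- For σ = 1 the half-lines turn to opposite sides in the original variable. The horizontal pieces
give the sinh-integral in N₁, the vertical ones the integrals over [0, π] in J₁ and N₁; the total is
−π times the Hankel function of the second kind. -/
theorem rotatedIntegral_one {x : ℝ} (hx : 0 < x) :
    rotatedIntegral 1 x 0 =
      -Real.pi * besselJ1 x + Complex.I * (Real.pi * besselN1 x : ℝ) := by
  have hpi : (Real.pi : ℂ) ≠ 0 := by exact_mod_cast Real.pi_ne_zero
  have hv := integral_besselPhase x
  have i1 := integrableOn_expIntegrand fun u hu =>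
    norm_expIntegrand_right_rotated_le (d := 0) (Or.inl rfl) hx hu
  have i2 := integrableOn_expIntegrand fun u hu =>
    norm_expIntegrand_left_le (Or.inl rfl) hx le_rfl hu right_mem_uIcc
  rw [rotatedIntegral]
  simp only [one_mul, Complex.ofReal_zero, zero_add] at i1 i2 ⊢
  have hH : (∫ u in Ioi (0 : ℝ), expIntegrand 1 (Complex.I * (x / 2 : ℝ))
      (Complex.I * (x / 2 : ℝ)) (u + (-(Real.pi / 2) : ℝ) * Complex.I)) +
      (∫ u in Ioi (0 : ℝ), expIntegrand (-1) (Complex.I * (x / 2 : ℝ))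
      (Complex.I * (x / 2 : ℝ)) (u + (-(Real.pi / 2) : ℝ) * Complex.I)) =
      -Complex.I * ((∫ t in Ioi (0 : ℝ),
        (Real.exp t - Real.exp (-t)) * Real.exp (-x * Real.sinh t) : ℝ) : ℂ) := by
    rw [← integral_add i1 i2, ← integral_complex_ofReal, ← integral_const_mul]
    refine integral_congr_ae (ae_of_all _ fun u => ?_)
    simp only [expIntegrand_one_sub, expIntegrand_neg_one_sub]
    rw [show -(Complex.I * ((x / 2 : ℝ) : ℂ) * Complex.I * Complex.exp (-u)) +
      Complex.I * ((x / 2 : ℝ) : ℂ) * Complex.I * Complex.exp u = ((-x * Real.sinh u : ℝ) : ℂ) by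
        rw [Real.sinh_eq]; push_cast
        linear_combination (x / 2 * (Complex.exp u - Complex.exp (-u)) : ℂ) * Complex.I_sq]
    push_cast
    ring
  have hJ : ∫ s in (0 : ℝ)..Real.pi, Complex.exp (Complex.I * ((s - x * Real.sin s : ℝ) : ℂ)) =
      ((∫ s in (0 : ℝ)..Real.pi, Real.cos (s - x * Real.sin s) : ℝ) : ℂ) - Complex.I *
      ((∫ s in (0 : ℝ)..Real.pi, Real.sin (x * Real.sin s - s) : ℝ) : ℂ) := by
    rw [← intervalIntegral.integral_ofReal, ← intervalIntegral.integral_ofReal,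
      ← intervalIntegral.integral_const_mul, ← intervalIntegral.integral_sub]
    · refine intervalIntegral.integral_congr fun s _ => ?_
      rw [mul_comm, Complex.exp_mul_I, ← neg_sub s, Real.sin_neg]
      push_cast
      ring
    · exact (by fun_prop : Continuous fun s : ℝ =>
        ((Real.cos (s - x * Real.sin s) : ℝ) : ℂ)).intervalIntegrable _ _
    · exact (by fun_prop : Continuous fun s : ℝ =>
        Complex.I * ((Real.sin (x * Real.sin s - s) : ℝ) : ℂ)).intervalIntegrable _ _
  rw [hJ] at hv
  rw [besselJ1, besselN1]
  have hN : Real.pi * (1 / Real.pi * (∫ s in (0 : ℝ)..Real.pi, Real.sin (x * Real.sin s - s)) -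
      1 / Real.pi * ∫ t in Ioi (0 : ℝ),
        (Real.exp t - Real.exp (-t)) * Real.exp (-x * Real.sinh t)) =
      (∫ s in (0 : ℝ)..Real.pi, Real.sin (x * Real.sin s - s)) - ∫ t in Ioi (0 : ℝ),
        (Real.exp t - Real.exp (-t)) * Real.exp (-x * Real.sinh t) := by
    have := Real.pi_ne_zero
    field_simp
  have hJ' : (-Real.pi : ℂ) * ((1 / Real.pi * ∫ s in (0 : ℝ)..Real.pi,
      Real.cos (s - x * Real.sin s) : ℝ) : ℂ) =
      -((∫ s in (0 : ℝ)..Real.pi, Real.cos (s - x * Real.sin s) : ℝ) : ℂ) := by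
    push_cast
    field_simp
  rw [hN, hJ', Complex.ofReal_sub]
  linear_combination hH + hv

/-- For σ = −1 both half-lines turn to the same side in the original variable: the vertical segments
cancel and the horizontal ones form the line Im t = π/2, where the integrand decays like exp(−x cosh
u). -/
theorem rotatedIntegral_neg_one {x : ℝ} (hx : 0 < x) :
    rotatedIntegral (-1) x 0 = 2 * Complex.I * (besselK1 x : ℂ) := by
  have i1 := integrableOn_expIntegrand fun u hu =>
    norm_expIntegrand_right_rotated_le (d := 0) (Or.inr rfl) hx hu
  have i2 := integrableOn_expIntegrand fun u hu =>
    norm_expIntegrand_left_le (Or.inr rfl) hx le_rfl hu right_mem_uIcc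
  have hv : (∫ y in (0 : ℝ)..(-(-1 * (Real.pi / 2))), expIntegrand 1 (Complex.I * (x / 2 : ℝ))
      ((0 : ℝ) + Complex.I * (-1 * x / 2 : ℝ)) (y * Complex.I)) =
      -∫ y in (0 : ℝ)..(-(Real.pi / 2)), expIntegrand (-1)
        ((0 : ℝ) + Complex.I * (-1 * x / 2 : ℝ)) (Complex.I * (x / 2 : ℝ)) (y * Complex.I) := by
    have := intervalIntegral.integral_comp_neg (a := 0) (b := -(-1 * (Real.pi / 2)))
      fun y : ℝ => expIntegrand (-1) ((0 : ℝ) + Complex.I * (-1 * x / 2 : ℝ))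
        (Complex.I * (x / 2 : ℝ)) (y * Complex.I)
    rw [neg_zero, neg_neg, show -1 * (Real.pi / 2) = -(Real.pi / 2) by ring, neg_neg] at this
    rw [← intervalIntegral.integral_symm, show -1 * (Real.pi / 2) = -(Real.pi / 2) by ring,
      neg_neg, ← this]
    refine intervalIntegral.integral_congr fun y _ => ?_
    simp only [Complex.ofReal_neg, neg_mul, expIntegrand_neg, neg_neg]
  have hH : (∫ u in Ioi (0 : ℝ), expIntegrand 1 (Complex.I * (x / 2 : ℝ))
      ((0 : ℝ) + Complex.I * (-1 * x / 2 : ℝ)) (u + (-(-1 * (Real.pi / 2)) : ℝ) * Complex.I)) +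
      (∫ u in Ioi (0 : ℝ), expIntegrand (-1) ((0 : ℝ) + Complex.I * (-1 * x / 2 : ℝ))
      (Complex.I * (x / 2 : ℝ)) (u + (-(Real.pi / 2) : ℝ) * Complex.I)) =
      2 * Complex.I * (besselK1 x : ℂ) := by
    rw [← integral_add i1 i2, besselK1, ← integral_complex_ofReal, ← integral_const_mul]
    refine integral_congr_ae (ae_of_all _ fun u => ?_)
    simp only [neg_mul, one_mul, neg_neg, expIntegrand_one_add, expIntegrand_neg_one_sub]
    rw [show Complex.I * ((x / 2 : ℝ) : ℂ) * Complex.I * Complex.exp (-u) -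
      ((0 : ℝ) + Complex.I * ((-x / 2 : ℝ) : ℂ)) * Complex.I * Complex.exp u =
        ((-(x * Real.cosh u) : ℝ) : ℂ) by
        rw [Real.cosh_eq]; push_cast
        linear_combination (x / 2 * (Complex.exp u + Complex.exp (-u)) : ℂ) * Complex.I_sq,
      show -(((0 : ℝ) + Complex.I * ((-x / 2 : ℝ) : ℂ)) * Complex.I * Complex.exp (-u)) +
      Complex.I * ((x / 2 : ℝ) : ℂ) * Complex.I * Complex.exp u =
        ((-(x * Real.cosh u) : ℝ) : ℂ) by
        rw [Real.cosh_eq]; push_cast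
        linear_combination (x / 2 * (Complex.exp u + Complex.exp (-u)) : ℂ) * Complex.I_sq]
    rw [Complex.ofReal_mul (Real.exp _) (Real.cosh u), Complex.ofReal_exp]
    -- Only the prefactor cosh u is expanded; the ones in the exponents stay as they are so that
    -- both sides match.
    nth_rw 4 [Real.cosh_eq]
    push_cast
    ring
  rw [rotatedIntegral, hv]
  linear_combination hH

theorem tendsto_regProperTime {m s : ℝ} (hm : 0 < m) (hs : s ≠ 0) :
    Tendsto (fun δ => regProperTime δ m s) (𝓝[>] 0) (𝓝 (properTimeDensity m s)) := by
  have main : ∀ σ l : ℝ, σ = 1 ∨ σ = -1 → 0 < l →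
      Tendsto (fun δ => regProperTime δ m (σ * l ^ 2)) (𝓝[>] 0)
        (𝓝 ((m / (2 * l) : ℝ) * rotatedIntegral σ (m * l) 0)) := by
    intro σ l hσ hl
    have hc : 0 < m / (2 * l) := by positivity
    have ht : Tendsto (fun δ : ℝ => δ * (m / (2 * l))) (𝓝[>] 0) (𝓝[>] 0) := by
      refine tendsto_nhdsWithin_iff.2 ⟨?_, ?_⟩
      · refine Tendsto.mono_left (Continuous.tendsto' (by fun_prop) _ _ (by simp))
          nhdsWithin_le_nhds
      · filter_upwards [self_mem_nhdsWithin] with δ hδ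
        exact mul_pos hδ hc
    refine Tendsto.congr' ?_
      (((tendsto_rotatedIntegral hσ (mul_pos hm hl)).comp ht).const_mul ((m / (2 * l) : ℝ) : ℂ))
    filter_upwards [self_mem_nhdsWithin] with δ hδ
    exact (regProperTime_eq hσ hl hm hδ).symm
  rcases lt_or_gt_of_ne hs with h | h
  · have hl : 0 < Real.sqrt (-s) := Real.sqrt_pos.2 (by linarith)
    have h1 := main (-1) (Real.sqrt (-s)) (Or.inr rfl) hl
    rw [Real.sq_sqrt (by linarith), neg_one_mul, neg_neg, rotatedIntegral_neg_one (by positivity)]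
      at h1
    convert h1 using 2
    have hpi : (Real.pi : ℂ) ≠ 0 := by exact_mod_cast Real.pi_ne_zero
    have hl' : (Real.sqrt (-s) : ℂ) ≠ 0 := by exact_mod_cast hl.ne'
    simp only [properTimeDensity, timelikeDensity, delta1Density, heaviside, if_neg h.not_gt,
      if_pos (neg_pos.2 h)]
    push_cast
    field_simp
    ring
  · have hl : 0 < Real.sqrt s := Real.sqrt_pos.2 h
    have h1 := main 1 (Real.sqrt s) (Or.inl rfl) hl
    rw [Real.sq_sqrt h.le, one_mul, rotatedIntegral_one (by positivity)] at h1
    convert h1 using 2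
    have hpi : (Real.pi : ℂ) ≠ 0 := by exact_mod_cast Real.pi_ne_zero
    have hl' : (Real.sqrt s : ℂ) ≠ 0 := by exact_mod_cast hl.ne'
    simp only [properTimeDensity, timelikeDensity, delta1Density, heaviside, if_pos h,
      if_neg (by linarith : ¬ 0 < -s)]
    push_cast
    field_simp
    ring

end Volkov

/-! ### Comparison with the massless case, uniformly in the regulator. -/

namespace Volkov

/-- The deviation `exp (-i m²/(4α)) - 1` of the proper-time phase from the massless case. -/
noncomputable def massPhase (m α : ℝ) : ℂ :=
  Complex.exp (Complex.I * (-(m ^ 2 / (4 * α)) : ℝ)) - 1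

theorem norm_massPhase_le {m α : ℝ} (hα : 0 < α) : ‖massPhase m α‖ ≤ m ^ 2 / (4 * α) := by
  have := Real.norm_exp_I_mul_ofReal_sub_one_le (x := -(m ^ 2 / (4 * α)))
  rwa [norm_neg, Real.norm_of_nonneg (by positivity)] at this

theorem norm_massPhase_le_two (m α : ℝ) : ‖massPhase m α‖ ≤ 2 := by
  refine (norm_sub_le _ _).trans ?_
  rw [mul_comm, Complex.norm_exp_ofReal_mul_I, norm_one]
  norm_num

/-- Geometric mean of the bounds 2 and m²/(4α): a power of α that is integrable at 0 and of first
order in m. -/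
theorem norm_massPhase_le_rpow {m α : ℝ} (hm : 0 ≤ m) (hα : 0 < α) :
    ‖massPhase m α‖ ≤ m * α ^ (-(1 / 2) : ℝ) := by
  have h1 := norm_massPhase_le (m := m) hα
  have h2 := norm_massPhase_le_two m α
  rw [Real.rpow_neg hα.le, ← Real.sqrt_eq_rpow]
  have hs := Real.sqrt_pos.2 hα
  apply le_of_sq_le_sq _ (by positivity)
  rw [mul_pow, inv_pow, Real.sq_sqrt hα.le, sq]
  calc ‖massPhase m α‖ * ‖massPhase m α‖ ≤ m ^ 2 / (4 * α) * 2 := by gcongr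
    _ ≤ m ^ 2 * α⁻¹ := by
      rw [div_mul_eq_mul_div, div_le_iff₀ (by positivity)]
      field_simp
      nlinarith [sq_nonneg m]

theorem hasDerivAt_massPhase {m α : ℝ} (hα : α ≠ 0) :
    HasDerivAt (massPhase m)
      (Complex.exp (Complex.I * (-(m ^ 2 / (4 * α)) : ℝ)) *
        (Complex.I * (m ^ 2 / (4 * α ^ 2) : ℝ))) α := by
  have h1 : HasDerivAt (fun α : ℝ => -(m ^ 2 / (4 * α))) (m ^ 2 / (4 * α ^ 2)) α := by
    have h := ((hasDerivAt_inv hα).const_mul (-(m ^ 2 / 4)))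
    refine (h.congr_deriv ?_).congr_of_eventuallyEq ?_
    · field_simp
    · filter_upwards with a
      ring
  exact ((h1.ofReal_comp.const_mul Complex.I).cexp).sub_const 1

theorem measurable_massPhase (m : ℝ) : Measurable (massPhase m) := by
  unfold massPhase; fun_prop

/-- The subtracted term is the massless integral ∫₀^∞ exp(−(δ + is)α) dα. -/
theorem regProperTime_sub_eq {δ m s : ℝ} (hδ : 0 < δ) :
    regProperTime δ m s - 1 / (δ + Complex.I * s) =
      ∫ α in Ioi (0 : ℝ), massPhase m α * Complex.exp (-(δ + Complex.I * s) * α) := by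
  have hγ : (-(δ + Complex.I * s) : ℂ).re < 0 := by simpa using hδ
  have hi := integrableOn_exp_mul_complex_Ioi hγ 0
  have h1 := integral_exp_mul_complex_Ioi hγ 0
  rw [Complex.ofReal_zero, mul_zero, Complex.exp_zero, neg_div_neg_eq] at h1
  have hi' : IntegrableOn (fun α : ℝ => massPhase m α * Complex.exp (-(δ + Complex.I * s) * α))
      (Ioi 0) := by
    refine Integrable.bdd_mul (c := 2) hi (measurable_massPhase m).aestronglyMeasurable
      (ae_of_all _ fun α => norm_massPhase_le_two m α)
  rw [← h1, sub_eq_iff_eq_add, ← integral_add hi' hi, regProperTime]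
  refine integral_congr_ae (ae_of_all _ fun α => ?_)
  simp only [massPhase]
  rw [sub_mul, one_mul, sub_add_cancel, ← Complex.exp_add]
  congr 1
  push_cast
  ring

theorem norm_exp_neg_mul {δ s α : ℝ} :
    ‖Complex.exp (-(δ + Complex.I * s) * α)‖ = Real.exp (-δ * α) := by
  rw [Complex.norm_exp]; simp

/-- Integration by parts against the exponential, with γ = δ + is and |γ| ≥ |s|. The boundary term
and the remaining integral of m²/(4α²) each contribute m²/(4A|γ|). -/
theorem norm_integral_massPhase_tail_le {δ m s A : ℝ} (hδ : 0 < δ) (hA : 0 < A) (hs : s ≠ 0) :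
    ‖∫ α in Ioi A, massPhase m α * Complex.exp (-(δ + Complex.I * s) * α)‖ ≤
      m ^ 2 / (2 * A * |s|) := by
  set γ : ℂ := δ + Complex.I * s with hγdef
  have hγre : γ.re = δ := by simp [hγdef]
  have hγ0 : γ ≠ 0 := fun h => by rw [h] at hγre; simp at hγre; exact hδ.ne hγre
  have hγs : |s| ≤ ‖γ‖ := by
    have := Complex.abs_im_le_norm γ
    simpa [hγdef] using this
  have hs' := abs_pos.2 hs
  have hγn : 0 < ‖γ‖ := norm_pos_iff.2 hγ0
  have hexp1 : ∀ α : ℝ, 0 ≤ α → ‖Complex.exp (-γ * α)‖ ≤ 1 := by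
    intro α hα
    rw [norm_exp_neg_mul]
    exact Real.exp_le_one_iff.2 (by nlinarith)
  have hi := integrableOn_exp_mul_complex_Ioi (a := -γ) (by simp [hγre, hδ]) A
  have hrpow : IntegrableOn (fun α : ℝ => m ^ 2 / 4 * α ^ (-2 : ℝ)) (Ioi A) :=
    (integrableOn_Ioi_rpow_of_lt (by norm_num) hA).const_mul _
  have hrpow_eq : ∀ α : ℝ, 0 < α → m ^ 2 / 4 * α ^ (-2 : ℝ) = m ^ 2 / (4 * α ^ 2) := by
    intro α hα
    rw [Real.rpow_neg hα.le]
    norm_cast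
    field_simp
  set u' : ℝ → ℂ := fun α => Complex.exp (Complex.I * (-(m ^ 2 / (4 * α)) : ℝ)) *
        (Complex.I * (m ^ 2 / (4 * α ^ 2) : ℝ)) with hu'
  have hu'n : ∀ α : ℝ, 0 < α → ‖u' α‖ = m ^ 2 / (4 * α ^ 2) := by
    intro α hα
    rw [hu', norm_mul, mul_comm Complex.I, Complex.norm_exp_ofReal_mul_I, one_mul, norm_mul,
      Complex.norm_I, one_mul, Complex.norm_real, Real.norm_of_nonneg (by positivity)]
  have hbound : ∀ α ∈ Ioi A, ‖u' α * (-(Complex.exp (-γ * α) / γ))‖ ≤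
      (m ^ 2 / 4 * α ^ (-2 : ℝ)) * ‖γ‖⁻¹ := by
    intro α hα
    have hα0 : 0 < α := hA.trans hα
    rw [norm_mul, norm_neg, norm_div, hu'n α hα0, hrpow_eq α hα0, div_eq_mul_inv _ ‖γ‖]
    exact mul_le_mul_of_nonneg_left
      (mul_le_of_le_one_left (by positivity) (hexp1 α hα0.le)) (by positivity)
  have hu'v : IntegrableOn (u' * fun α : ℝ => -(Complex.exp (-γ * α) / γ)) (Ioi A) := by
    refine Integrable.mono' (hrpow.mul_const ‖γ‖⁻¹) ?_
      ((ae_restrict_mem measurableSet_Ioi).mono hbound)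
    exact Measurable.aestronglyMeasurable (by rw [hu']; fun_prop)
  have huv' : IntegrableOn (massPhase m * fun α : ℝ => Complex.exp (-γ * α)) (Ioi A) :=
    Integrable.bdd_mul (c := 2) hi (measurable_massPhase m).aestronglyMeasurable
      (ae_of_all _ fun α => norm_massPhase_le_two m α)
  have hv : ∀ α : ℝ, HasDerivAt (fun α : ℝ => -(Complex.exp (-γ * α) / γ))
      (Complex.exp (-γ * α)) α := by
    intro α
    have h := ((((hasDerivAt_id (α : ℂ)).const_mul (-γ)).cexp.div_const γ).neg).comp_ofReal
    refine h.congr_deriv ?_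
    simp only [id, mul_one]
    field_simp
  have hparts := integral_Ioi_mul_deriv_eq_deriv_mul (a := A) (u := massPhase m) (u' := u')
    (v := fun α : ℝ => -(Complex.exp (-γ * α) / γ)) (v' := fun α : ℝ => Complex.exp (-γ * α))
    (a' := massPhase m A * -(Complex.exp (-γ * A) / γ)) (b' := 0)
    (fun α hα => hasDerivAt_massPhase (hA.trans hα).ne') (fun α _ => hv α) huv' hu'v
    (((hasDerivAt_massPhase hA.ne').continuousAt.mul (hv A).continuousAt).tendsto.mono_left
      nhdsWithin_le_nhds) ?_
  · rw [hparts]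
    have e1 : ‖massPhase m A * -(Complex.exp (-γ * A) / γ)‖ ≤ m ^ 2 / (4 * A) * ‖γ‖⁻¹ := by
      rw [norm_mul, norm_neg, norm_div, div_eq_mul_inv _ ‖γ‖]
      exact mul_le_mul (norm_massPhase_le hA)
        (mul_le_of_le_one_left (by positivity) (hexp1 A hA.le)) (by positivity) (by positivity)
    have e2 : ‖∫ α in Ioi A, u' α * (-(Complex.exp (-γ * α) / γ))‖ ≤
        m ^ 2 / (4 * A) * ‖γ‖⁻¹ := by
      refine (norm_integral_le_of_norm_le (hrpow.mul_const ‖γ‖⁻¹)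
        ((ae_restrict_mem measurableSet_Ioi).mono hbound)).trans (le_of_eq ?_)
      rw [integral_mul_const, integral_const_mul, integral_Ioi_rpow_of_lt (by norm_num) hA]
      rw [show (-2 : ℝ) + 1 = -1 by norm_num, Real.rpow_neg_one, neg_div_neg_eq, div_one]
      field_simp
    rw [zero_sub]
    refine (norm_sub_le _ _).trans ?_
    rw [norm_neg]
    refine (add_le_add e1 e2).trans ?_
    have : ‖γ‖⁻¹ ≤ |s|⁻¹ := inv_anti₀ hs' hγs
    calc m ^ 2 / (4 * A) * ‖γ‖⁻¹ + m ^ 2 / (4 * A) * ‖γ‖⁻¹ = m ^ 2 / (2 * A) * ‖γ‖⁻¹ := by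
          field_simp; ring
      _ ≤ m ^ 2 / (2 * A) * |s|⁻¹ := by gcongr
      _ = _ := by field_simp
  · have hlim : Tendsto (fun α : ℝ => 2 * (Real.exp (-δ * α) / ‖γ‖)) atTop (𝓝 0) := by
      have : Tendsto (fun α : ℝ => Real.exp (-δ * α)) atTop (𝓝 0) :=
        Real.tendsto_exp_atBot.comp (tendsto_id.const_mul_atTop_of_neg (by linarith))
      simpa using (this.div_const ‖γ‖).const_mul 2
    refine squeeze_zero_norm (fun α => ?_) hlim
    rw [Pi.mul_apply, norm_mul, norm_neg, norm_div, norm_exp_neg_mul]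
    exact mul_le_mul_of_nonneg_right (norm_massPhase_le_two m α) (by positivity)

/-- The integral is split at the scale A = 1/|s| of the oscillation. Below it, mα^(−1/2) integrates
to 2m|s|^(−1/2); above it, the tail bound m²/(2A|s|) equals m²/2. -/
theorem norm_regProperTime_sub_le {δ m s : ℝ} (hδ : 0 < δ) (hm : 0 ≤ m) (hs : s ≠ 0) :
    ‖regProperTime δ m s - 1 / (δ + Complex.I * s)‖ ≤
      2 * m * |s| ^ (-(1 / 2) : ℝ) + m ^ 2 / 2 := by
  have hs' := abs_pos.2 hs
  have hA : 0 < |s|⁻¹ := inv_pos.2 hs'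
  have hγ : (-(δ + Complex.I * s) : ℂ).re < 0 := by simpa using hδ
  have hi' : IntegrableOn (fun α : ℝ => massPhase m α * Complex.exp (-(δ + Complex.I * s) * α))
      (Ioi 0) :=
    Integrable.bdd_mul (c := 2) (integrableOn_exp_mul_complex_Ioi hγ 0)
      (measurable_massPhase m).aestronglyMeasurable
      (ae_of_all _ fun α => norm_massPhase_le_two m α)
  rw [regProperTime_sub_eq hδ, ← Ioc_union_Ioi_eq_Ioi hA.le,
    setIntegral_union Ioc_disjoint_Ioi_same measurableSet_Ioi
      (hi'.mono_set Ioc_subset_Ioi_self) (hi'.mono_set (Ioi_subset_Ioi hA.le))]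
  refine (norm_add_le _ _).trans (add_le_add ?_ ?_)
  · have hint : IntegrableOn (fun α : ℝ => m * α ^ (-(1 / 2) : ℝ)) (Ioc 0 |s|⁻¹) :=
      ((intervalIntegrable_iff_integrableOn_Ioc_of_le hA.le).1
        (intervalIntegral.intervalIntegrable_rpow' (by norm_num))).const_mul m
    refine (norm_integral_le_of_norm_le hint
      ((ae_restrict_mem measurableSet_Ioc).mono fun α hα => ?_)).trans (le_of_eq ?_)
    · rw [norm_mul, norm_exp_neg_mul]
      refine (mul_le_of_le_one_right (norm_nonneg _)
        (Real.exp_le_one_iff.2 (by nlinarith [hα.1]))).trans (norm_massPhase_le_rpow hm hα.1)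
    · rw [integral_const_mul, ← intervalIntegral.integral_of_le hA.le,
        integral_rpow (Or.inl (by norm_num)), Real.zero_rpow (by norm_num), Real.inv_rpow hs'.le,
        ← Real.rpow_neg hs'.le]
      norm_num
      ring
  · refine (norm_integral_massPhase_tail_le hδ hA hs).trans (le_of_eq ?_)
    field_simp

/-- Passing to the limit δ → 0 in the uniform bound yields the behaviour at the light cone without
any asymptotics of Bessel functions. -/
theorem norm_properTimeDensity_add_le {m s : ℝ} (hm : 0 < m) (hs : s ≠ 0) :
    ‖properTimeDensity m s - 1 / (Complex.I * s)‖ ≤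
      2 * m * |s| ^ (-(1 / 2) : ℝ) + m ^ 2 / 2 := by
  have h : Tendsto (fun δ : ℝ => regProperTime δ m s - 1 / (δ + Complex.I * s)) (𝓝[>] 0)
      (𝓝 (properTimeDensity m s - 1 / ((0 : ℝ) + Complex.I * s))) := by
    refine (tendsto_regProperTime hm hs).sub (Tendsto.mono_left ?_ nhdsWithin_le_nhds)
    refine ContinuousAt.tendsto (f := fun δ : ℝ => 1 / ((δ : ℂ) + Complex.I * s)) ?_
    refine ContinuousAt.div (by fun_prop) (by fun_prop) ?_
    simp [hs]
  rw [Complex.ofReal_zero, zero_add] at h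
  refine le_of_tendsto h.norm ?_
  filter_upwards [self_mem_nhdsWithin] with δ hδ
  exact norm_regProperTime_sub_le hδ hm.le hs

end Volkov

/-! ### Singular kernels on one fibre: bounds and limits of pairings. -/

namespace Volkov

theorem integrable_abs_rpow_Icc {p : ℝ} (hp : -1 < p) (S : ℝ) :
    IntegrableOn (fun s : ℝ => |s| ^ p) (Icc (-S) S) := by
  rcases lt_or_ge S 0 with hS | hS
  · rw [Icc_eq_empty (by linarith)]; exact integrableOn_empty
  have h1 : IntegrableOn (fun s : ℝ => |s| ^ p) (Ioc 0 S) := by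
    refine ((intervalIntegrable_iff_integrableOn_Ioc_of_le hS).1
      (intervalIntegral.intervalIntegrable_rpow' hp)).congr_fun (fun s hs => ?_) measurableSet_Ioc
    simp only [abs_of_pos hs.1]
  have h2 : IntegrableOn (fun s : ℝ => |s| ^ p) (Ico (-S) 0) := by
    have h3 : IntegrableOn (fun s : ℝ => |s| ^ p) (Ioc (-0) (- -S)) := by simpa using h1
    have := (Measure.measurePreserving_neg (volume : Measure ℝ)).integrableOn_comp_preimage
      (Homeomorph.neg ℝ).measurableEmbedding (f := fun s : ℝ => |s| ^ p) (s := Ioc (-0) (- -S))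
    rw [this.symm] at h3
    refine (h3.congr_fun (g := fun s : ℝ => |s| ^ p) (fun s _ => by simp) ?_).mono_set ?_
    · exact measurableSet_Ioc.preimage measurable_neg
    · intro s hs
      simp only [mem_preimage, mem_Ioc, mem_Ico] at hs ⊢
      exact ⟨by linarith [hs.2], by linarith [hs.1]⟩
  have h4 : IntegrableOn (fun s : ℝ => |s| ^ p) {0} := by
    rw [IntegrableOn, Measure.restrict_eq_zero.2 (by simp)]
    exact integrable_zero_measure
  refine ((h1.union h2).union h4).mono_set fun s hs => ?_
  rcases lt_trichotomy s 0 with h | h | h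
  · exact Or.inl (Or.inr ⟨hs.1, h⟩)
  · exact Or.inr h
  · exact Or.inl (Or.inl ⟨h, hs.2⟩)

/-- The weight of a set `E` of values of the Minkowski square that dominates the pairings on a
fibre. -/
noncomputable def fiberWeight (S : ℝ) (E : Set ℝ) : ℝ :=
  (∫ s in Icc (-S) S, |s| ^ (-(3 / 4) : ℝ) * E.indicator 1 s) + E.indicator 1 (0 : ℝ)

/-- The constant in the uniform bounds on a fibre. -/
noncomputable def fiberConst (S m : ℝ) : ℝ :=
  1 + (∫ s in Icc (-S) S, |s| ^ (-(3 / 4) : ℝ)) + Real.pi +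
    (2 * m * S ^ (1 / 4 : ℝ) + m ^ 2 / 2 * S ^ (3 / 4 : ℝ))

/-- A function of the Minkowski square that arises on a fibre: it lives on `[-S, S]`, is bounded
by `C` on `E` and zero elsewhere, and is Hölder continuous of order `1/4` at `0`. -/
structure IsFiberFunction (S H C : ℝ) (E : Set ℝ) (g : ℝ → ℂ) : Prop where
  measurable : Measurable g
  pos : 0 < S
  nonneg_H : 0 ≤ H
  nonneg_C : 0 ≤ C
  measurableSet : MeasurableSet E
  zero_of_lt : ∀ s, S < |s| → g s = 0
  holder : ∀ s, ‖g s - g 0‖ ≤ H * |s| ^ (1 / 4 : ℝ) * (E.indicator 1 s + E.indicator 1 (0 : ℝ))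
  bound : ∀ s, ‖g s‖ ≤ C * E.indicator 1 s

/-- The limit of the truncated pairings on a fibre. -/
noncomputable def fiberLimit (S m : ℝ) (g : ℝ → ℂ) : ℂ :=
  (∫ s in Icc (-S) S, (g s - g 0) * (1 / (Complex.I * s))) +
    ∫ s in Icc (-S) S, g s * (properTimeDensity m s - 1 / (Complex.I * s))

/-- A kernel on `[-S, S]` split into a part dominated by `1/|s|` and a milder remainder. -/
structure IsFiberKernel (S m : ℝ) (c r : ℝ → ℂ) : Prop where
  measurable_c : Measurable c
  measurable_r : Measurable r
  integrable : IntegrableOn c (Icc (-S) S)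
  norm_c_le : ∀ s ≠ 0, ‖c s‖ ≤ |s|⁻¹
  norm_r_le : ∀ s ≠ 0, ‖r s‖ ≤ 2 * m * |s| ^ (-(1 / 2) : ℝ) + m ^ 2 / 2
  norm_integral_le : ‖∫ s in Icc (-S) S, c s‖ ≤ Real.pi

theorem indicator_one_mem (E : Set ℝ) (s : ℝ) :
    0 ≤ E.indicator (1 : ℝ → ℝ) s ∧ E.indicator (1 : ℝ → ℝ) s ≤ 1 := by
  by_cases h : s ∈ E <;> simp [h]

theorem integrable_weight {E : Set ℝ} (hE : MeasurableSet E) (S : ℝ) :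
    IntegrableOn (fun s => |s| ^ (-(3 / 4) : ℝ) * E.indicator 1 s) (Icc (-S) S) := by
  refine Integrable.mul_bdd (c := 1) (integrable_abs_rpow_Icc (by norm_num) S)
    (measurable_const.indicator hE).aestronglyMeasurable (ae_of_all _ fun s => ?_)
  rw [Real.norm_of_nonneg (indicator_one_mem E s).1]
  exact (indicator_one_mem E s).2

/-- The shape of the dominating function: the Hölder modulus |s|^(1/4) against 1/|s| leaves
|s|^(−3/4), localized to `E` unless 0 lies in `E`. -/
theorem integrable_singularWeight {E : Set ℝ} (hE : MeasurableSet E) (S H : ℝ) :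
    IntegrableOn (fun s => H * (|s| ^ (-(3 / 4) : ℝ) * E.indicator 1 s) +
      H * E.indicator 1 (0 : ℝ) * |s| ^ (-(3 / 4) : ℝ)) (Icc (-S) S) :=
  ((integrable_weight hE S).const_mul H).add
    ((integrable_abs_rpow_Icc (by norm_num) S).const_mul (H * E.indicator 1 (0 : ℝ)))

theorem weight_nonneg (E : Set ℝ) (S : ℝ) :
    0 ≤ ∫ s in Icc (-S) S, |s| ^ (-(3 / 4) : ℝ) * E.indicator 1 s :=
  integral_nonneg fun s => mul_nonneg (by positivity) (indicator_one_mem E s).1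

theorem ae_restrict_Icc_ne_zero (S : ℝ) :
    ∀ᵐ s : ℝ ∂(volume.restrict (Icc (-S) S)), s ∈ Icc (-S) S ∧ s ≠ 0 :=
  (ae_restrict_mem measurableSet_Icc).and (ae_restrict_of_ae (Measure.ae_ne volume 0))

variable {S H C m M : ℝ} {E : Set ℝ} {g : ℝ → ℂ}

/-- Dominating function for the singular part. -/
theorem IsFiberFunction.norm_sub_mul_le (hg : IsFiberFunction S H C E g) {c : ℂ} {s : ℝ}
    (hs : s ≠ 0) (hc : ‖c‖ ≤ |s|⁻¹) :
    ‖(g s - g 0) * c‖ ≤ H * (|s| ^ (-(3 / 4) : ℝ) * E.indicator 1 s) +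
      H * E.indicator 1 (0 : ℝ) * |s| ^ (-(3 / 4) : ℝ) := by
  have hs' := abs_pos.2 hs
  have h0 := indicator_one_mem E s
  have h1 := indicator_one_mem E 0
  have := hg.nonneg_H
  rw [norm_mul]
  refine (mul_le_mul (hg.holder s) hc (norm_nonneg _) ?_).trans (le_of_eq ?_)
  · have := add_nonneg h0.1 h1.1
    positivity
  · have : |s| ^ (-(3 / 4) : ℝ) = |s| ^ (1 / 4 : ℝ) * |s|⁻¹ := by
      rw [← Real.rpow_neg_one, ← Real.rpow_add hs']; norm_num
    rw [this]; ring

/-- The milder singularities are weakened to |s|^(−3/4), so that one weight controls all terms. -/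
theorem rpow_mild_le (hm : 0 ≤ m) (hmM : m ≤ M) {s : ℝ} (hs : s ≠ 0) (hsS : |s| ≤ S) :
    2 * m * |s| ^ (-(1 / 2) : ℝ) + m ^ 2 / 2 ≤
      (2 * M * S ^ (1 / 4 : ℝ) + M ^ 2 / 2 * S ^ (3 / 4 : ℝ)) * |s| ^ (-(3 / 4) : ℝ) := by
  have hs' := abs_pos.2 hs
  have e1 : |s| ^ (-(1 / 2) : ℝ) = |s| ^ (1 / 4 : ℝ) * |s| ^ (-(3 / 4) : ℝ) := by
    rw [← Real.rpow_add hs']; norm_num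
  have e2 : (1 : ℝ) = |s| ^ (3 / 4 : ℝ) * |s| ^ (-(3 / 4) : ℝ) := by
    rw [← Real.rpow_add hs']; norm_num
  have b1 : |s| ^ (1 / 4 : ℝ) ≤ S ^ (1 / 4 : ℝ) := Real.rpow_le_rpow hs'.le hsS (by norm_num)
  have b2 : |s| ^ (3 / 4 : ℝ) ≤ S ^ (3 / 4 : ℝ) := Real.rpow_le_rpow hs'.le hsS (by norm_num)
  calc 2 * m * |s| ^ (-(1 / 2) : ℝ) + m ^ 2 / 2
      = (2 * m * |s| ^ (1 / 4 : ℝ) + m ^ 2 / 2 * |s| ^ (3 / 4 : ℝ)) * |s| ^ (-(3 / 4) : ℝ) := by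
        rw [e1]; linear_combination (m ^ 2 / 2) * e2
    _ ≤ _ := by gcongr; linarith

theorem IsFiberFunction.norm_mul_le (hg : IsFiberFunction S H C E g) (hm : 0 ≤ m) (hmM : m ≤ M)
    {r : ℂ} {s : ℝ} (hs : s ≠ 0) (hsS : |s| ≤ S)
    (hr : ‖r‖ ≤ 2 * m * |s| ^ (-(1 / 2) : ℝ) + m ^ 2 / 2) :
    ‖g s * r‖ ≤ C * (2 * M * S ^ (1 / 4 : ℝ) + M ^ 2 / 2 * S ^ (3 / 4 : ℝ)) *
      (|s| ^ (-(3 / 4) : ℝ) * E.indicator 1 s) := by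
  have h0 := indicator_one_mem E s
  rw [norm_mul]
  refine (mul_le_mul (hg.bound s) (hr.trans (rpow_mild_le hm hmM hs hsS)) (norm_nonneg _)
    (mul_nonneg hg.nonneg_C h0.1)).trans (le_of_eq ?_)
  ring

/-- Subtracting g(0) makes the singular part absolutely integrable; what is left over involves only
the total mass of `c`, which stays bounded although ∫|c| does not. -/
theorem IsFiberFunction.integral_split (hg : IsFiberFunction S H C E g) (hm : 0 ≤ m)
    {c r : ℝ → ℂ} (hk : IsFiberKernel S m c r) :
    IntegrableOn (fun s => (g s - g 0) * c s) (Icc (-S) S) ∧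
    IntegrableOn (fun s => g s * r s) (Icc (-S) S) ∧
    IntegrableOn (fun s => g s * (c s + r s)) (Icc (-S) S) ∧
    ∫ s in Icc (-S) S, g s * (c s + r s) =
      (∫ s in Icc (-S) S, (g s - g 0) * c s) + g 0 * (∫ s in Icc (-S) S, c s) +
        ∫ s in Icc (-S) S, g s * r s := by
  have hgm := hg.measurable
  have hcm := hk.measurable_c
  have hrm := hk.measurable_r
  have i1 : IntegrableOn (fun s => (g s - g 0) * c s) (Icc (-S) S) := by
    refine Integrable.mono' (integrable_singularWeight hg.measurableSet S H)
      (by fun_prop) ?_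
    filter_upwards [ae_restrict_Icc_ne_zero S] with s hs
    exact hg.norm_sub_mul_le hs.2 (hk.norm_c_le s hs.2)
  have i2 : IntegrableOn (fun s => g s * r s) (Icc (-S) S) := by
    refine Integrable.mono' ((integrable_weight hg.measurableSet S).const_mul
      (C * (2 * m * S ^ (1 / 4 : ℝ) + m ^ 2 / 2 * S ^ (3 / 4 : ℝ)))) (by fun_prop) ?_
    filter_upwards [ae_restrict_Icc_ne_zero S] with s hs
    exact hg.norm_mul_le hm le_rfl hs.2 (abs_le.2 hs.1) (hk.norm_r_le s hs.2)
  have i3 : IntegrableOn (fun s => g 0 * c s) (Icc (-S) S) := hk.integrable.const_mul _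
  have e : ∀ s, g s * (c s + r s) = (g s - g 0) * c s + g 0 * c s + g s * r s := fun s => by ring
  refine ⟨i1, i2, ?_, ?_⟩
  · simp only [e]; exact (i1.add i3).add i2
  · simp only [e]
    rw [integral_add (f := fun s => (g s - g 0) * c s + g 0 * c s) (i1.add i3) i2,
      integral_add i1 i3, integral_const_mul]

theorem fiberWeight_nonneg (S : ℝ) (E : Set ℝ) : 0 ≤ fiberWeight S E :=
  add_nonneg (weight_nonneg E S) (indicator_one_mem E 0).1

theorem IsFiberFunction.norm_integral_le (hg : IsFiberFunction S H C E g) (hm : 0 ≤ m)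
    (hmM : m ≤ M) {c r : ℝ → ℂ} (hk : IsFiberKernel S m c r) :
    ‖∫ s in Icc (-S) S, g s * (c s + r s)‖ ≤ (H + C) * fiberConst S M * fiberWeight S E := by
  rw [(hg.integral_split hm hk).2.2.2]
  have hH := hg.nonneg_H
  have hC := hg.nonneg_C
  have hS := hg.pos
  have hM := hm.trans hmM
  set w := ∫ s in Icc (-S) S, |s| ^ (-(3 / 4) : ℝ) * E.indicator 1 s with hw
  set σ := ∫ s in Icc (-S) S, |s| ^ (-(3 / 4) : ℝ) with hσ
  set χ := E.indicator (1 : ℝ → ℝ) 0 with hχ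
  set κ := 2 * M * S ^ (1 / 4 : ℝ) + M ^ 2 / 2 * S ^ (3 / 4 : ℝ) with hκ
  have hw0 : 0 ≤ w := weight_nonneg E S
  have hσ0 : 0 ≤ σ := integral_nonneg fun s => by positivity
  have hχ0 : 0 ≤ χ := (indicator_one_mem E 0).1
  have hκ0 : 0 ≤ κ := by positivity
  have b1 : ‖∫ s in Icc (-S) S, (g s - g 0) * c s‖ ≤ H * w + H * χ * σ := by
    refine (norm_integral_le_of_norm_le (integrable_singularWeight hg.measurableSet S H) ?_).trans (le_of_eq ?_)
    · filter_upwards [ae_restrict_Icc_ne_zero S] with s hs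
      exact hg.norm_sub_mul_le hs.2 (hk.norm_c_le s hs.2)
    · rw [integral_add ((integrable_weight hg.measurableSet S).const_mul H)
        ((integrable_abs_rpow_Icc (by norm_num) S).const_mul (H * χ)), integral_const_mul,
        integral_const_mul]
  have b2 : ‖g 0 * ∫ s in Icc (-S) S, c s‖ ≤ C * χ * Real.pi := by
    rw [norm_mul]
    exact mul_le_mul (hg.bound 0) hk.norm_integral_le (norm_nonneg _) (by positivity)
  have b3 : ‖∫ s in Icc (-S) S, g s * r s‖ ≤ C * κ * w := by
    refine (norm_integral_le_of_norm_le
      ((integrable_weight hg.measurableSet S).const_mul (C * κ)) ?_).trans (le_of_eq ?_)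
    · filter_upwards [ae_restrict_Icc_ne_zero S] with s hs
      exact hg.norm_mul_le hm hmM hs.2 (abs_le.2 hs.1) (hk.norm_r_le s hs.2)
    · rw [integral_const_mul]
  refine (norm_add_le _ _).trans ((add_le_add ((norm_add_le _ _).trans (add_le_add b1 b2))
    b3).trans ?_)
  have hpi := Real.pi_pos
  change _ ≤ (H + C) * (1 + σ + Real.pi + κ) * (w + χ)
  -- The second bracket collects the terms of the product that the three bounds do not use; all are
  -- nonnegative.
  have expand : (H + C) * (1 + σ + Real.pi + κ) * (w + χ) =
      (H * w + H * χ * σ + C * χ * Real.pi + C * κ * w) +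
      (H * χ + H * w * σ + C * w * Real.pi + C * κ * χ + C * w + C * χ + C * σ * (w + χ) +
        H * Real.pi * (w + χ) + H * κ * (w + χ)) := by ring
  rw [expand]
  have : 0 ≤ H * χ + H * w * σ + C * w * Real.pi + C * κ * χ + C * w + C * χ + C * σ * (w + χ) +
        H * Real.pi * (w + χ) + H * κ * (w + χ) := by positivity
  linarith

/-- Dominated convergence handles the two integrable parts. The limit `a` of the total mass of the
singular kernel carries the whole difference between the applications: π for the regulator, 0 for
the symmetric truncation. -/
theorem IsFiberFunction.tendsto_integral (hg : IsFiberFunction S H C E g) (hm : 0 ≤ m)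
    {l : Filter ℝ} [l.IsCountablyGenerated] {c r : ℝ → ℝ → ℂ} {c₀ r₀ : ℝ → ℂ} {a : ℂ}
    (hk : ∀ᶠ i in l, IsFiberKernel S m (c i) (r i))
    (hc : ∀ s ≠ 0, Tendsto (fun i => c i s) l (𝓝 (c₀ s)))
    (hr : ∀ s ≠ 0, Tendsto (fun i => r i s) l (𝓝 (r₀ s)))
    (ha : Tendsto (fun i => ∫ s in Icc (-S) S, c i s) l (𝓝 a)) :
    Tendsto (fun i => ∫ s in Icc (-S) S, g s * (c i s + r i s)) l
      (𝓝 (g 0 * a + ((∫ s in Icc (-S) S, (g s - g 0) * c₀ s) +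
        ∫ s in Icc (-S) S, g s * r₀ s))) := by
  have hgm := hg.measurable
  have t1 : Tendsto (fun i => ∫ s in Icc (-S) S, (g s - g 0) * c i s) l
      (𝓝 (∫ s in Icc (-S) S, (g s - g 0) * c₀ s)) := by
    refine tendsto_integral_filter_of_dominated_convergence _ ?_ ?_
      (integrable_singularWeight hg.measurableSet S H) ?_
    · filter_upwards [hk] with i hi
      have := hi.measurable_c
      fun_prop
    · filter_upwards [hk] with i hi
      filter_upwards [ae_restrict_Icc_ne_zero S] with s hs
      exact hg.norm_sub_mul_le hs.2 (hi.norm_c_le s hs.2)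
    · filter_upwards [ae_restrict_Icc_ne_zero S] with s hs
      exact (hc s hs.2).const_mul _
  have t2 : Tendsto (fun i => ∫ s in Icc (-S) S, g s * r i s) l
      (𝓝 (∫ s in Icc (-S) S, g s * r₀ s)) := by
    refine tendsto_integral_filter_of_dominated_convergence _ ?_ ?_
      ((integrable_weight hg.measurableSet S).const_mul
        (C * (2 * m * S ^ (1 / 4 : ℝ) + m ^ 2 / 2 * S ^ (3 / 4 : ℝ)))) ?_
    · filter_upwards [hk] with i hi
      have := hi.measurable_r
      fun_prop
    · filter_upwards [hk] with i hi
      filter_upwards [ae_restrict_Icc_ne_zero S] with s hs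
      exact hg.norm_mul_le hm le_rfl hs.2 (abs_le.2 hs.1) (hi.norm_r_le s hs.2)
    · filter_upwards [ae_restrict_Icc_ne_zero S] with s hs
      exact (hr s hs.2).const_mul _
  have t3 := (t1.add (ha.const_mul (g 0))).add t2
  have e : (∫ s in Icc (-S) S, (g s - g 0) * c₀ s) + g 0 * a + ∫ s in Icc (-S) S, g s * r₀ s =
      g 0 * a + ((∫ s in Icc (-S) S, (g s - g 0) * c₀ s) + ∫ s in Icc (-S) S, g s * r₀ s) := by
    ring
  rw [e] at t3
  refine t3.congr' ?_
  filter_upwards [hk] with i hi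
  exact (hg.integral_split hm hi).2.2.2.symm

end Volkov

/-! ### The regularized and the truncated kernel as fibre kernels. -/

namespace Volkov

theorem measurable_regProperTime (δ : ℝ) :
    Measurable fun p : ℝ × ℝ => regProperTime δ p.1 p.2 := by
  unfold regProperTime
  refine (StronglyMeasurable.integral_prod_right (f := fun (p : ℝ × ℝ) (α : ℝ) =>
    Complex.exp (-Complex.I * ((p.1 ^ 2 : ℝ) : ℂ) / (4 * (α : ℂ)) -
    ((δ : ℂ) + Complex.I * (p.2 : ℂ)) * (α : ℂ))) ?_).measurable
  refine Measurable.stronglyMeasurable ?_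
  unfold Function.uncurry
  fun_prop

theorem measurable_besselJ1 : Measurable besselJ1 := by
  unfold besselJ1
  simp only [intervalIntegral.integral_of_le Real.pi_pos.le]
  refine Measurable.const_mul ?_ _
  refine (StronglyMeasurable.integral_prod_right (f := fun (x s : ℝ) =>
    Real.cos (s - x * Real.sin s)) ?_).measurable
  refine Measurable.stronglyMeasurable ?_
  unfold Function.uncurry
  fun_prop

theorem measurable_besselN1 : Measurable besselN1 := by
  unfold besselN1
  simp only [intervalIntegral.integral_of_le Real.pi_pos.le]
  refine Measurable.sub (Measurable.const_mul ?_ _) (Measurable.const_mul ?_ _)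
  · refine (StronglyMeasurable.integral_prod_right (f := fun (x s : ℝ) =>
      Real.sin (x * Real.sin s - s)) ?_).measurable
    refine Measurable.stronglyMeasurable ?_
    unfold Function.uncurry
    fun_prop
  · refine (StronglyMeasurable.integral_prod_right (f := fun (x t : ℝ) =>
      (Real.exp t - Real.exp (-t)) * Real.exp (-x * Real.sinh t)) ?_).measurable
    refine Measurable.stronglyMeasurable ?_
    unfold Function.uncurry
    fun_prop

theorem measurable_besselK1 : Measurable besselK1 := by
  unfold besselK1
  refine (StronglyMeasurable.integral_prod_right (f := fun (x t : ℝ) =>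
    Real.exp (-x * Real.cosh t) * Real.cosh t) ?_).measurable
  refine Measurable.stronglyMeasurable ?_
  unfold Function.uncurry
  fun_prop

theorem measurable_heaviside : Measurable heaviside :=
  Measurable.ite measurableSet_Ioi measurable_const measurable_const

theorem measurable_timelikeDensity :
    Measurable fun p : ℝ × ℝ => timelikeDensity p.1 p.2 := by
  have h1 := measurable_besselJ1
  have h2 := measurable_heaviside
  unfold timelikeDensity
  fun_prop

theorem measurable_delta1Density :
    Measurable fun p : ℝ × ℝ => delta1Density p.1 p.2 := by
  have h1 := measurable_besselN1
  have h2 := measurable_heaviside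
  have h3 := measurable_besselK1
  unfold delta1Density
  fun_prop

theorem measurable_properTimeDensity :
    Measurable fun p : ℝ × ℝ => properTimeDensity p.1 p.2 := by
  have h1 := measurable_timelikeDensity
  have h2 := measurable_delta1Density
  unfold properTimeDensity
  fun_prop

theorem abs_le_norm_add_I_mul (δ s : ℝ) : |s| ≤ ‖(δ + Complex.I * s : ℂ)‖ := by
  have := Complex.abs_im_le_norm (δ + Complex.I * s)
  simpa using this

theorem integral_Icc_inv_add {δ S : ℝ} (hδ : 0 < δ) (hS : 0 < S) :
    ∫ s in Icc (-S) S, 1 / (δ + Complex.I * s) =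
      -Complex.I * (Complex.log (δ + Complex.I * S) - Complex.log (δ + Complex.I * (-S : ℝ))) := by
  rw [integral_Icc_eq_integral_Ioc, ← intervalIntegral.integral_of_le (by linarith)]
  have hne : ∀ s : ℝ, (δ + Complex.I * s : ℂ) ≠ 0 := fun s h => by
    have := congrArg Complex.re h
    simp at this
    exact hδ.ne' this
  have := intervalIntegral.integral_eq_sub_of_hasDerivAt (a := -S) (b := S)
    (f := fun s : ℝ => -Complex.I * Complex.log (δ + Complex.I * s))
    (f' := fun s : ℝ => 1 / (δ + Complex.I * s)) ?_ ?_
  · rw [this]; ring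
  · intro s _
    have h1 : HasDerivAt (fun s : ℝ => (δ + Complex.I * s : ℂ)) Complex.I s := by
      simpa using ((Complex.ofRealCLM.hasDerivAt (x := s)).const_mul Complex.I).const_add (δ : ℂ)
    have h2 := (h1.clog_real (by left; simpa using hδ)).const_mul (-Complex.I)
    refine h2.congr_deriv ?_
    rw [← mul_div_assoc, neg_mul, Complex.I_mul_I, neg_neg]
  · refine Continuous.intervalIntegrable ?_ _ _
    exact continuous_const.div (by fun_prop) hne

theorem isFiberKernel_reg {S δ m : ℝ} (hS : 0 < S) (hδ : 0 < δ) (hm : 0 ≤ m) :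
    IsFiberKernel S m (fun s => 1 / (δ + Complex.I * s))
      (fun s => regProperTime δ m s - 1 / (δ + Complex.I * s)) where
  measurable_c := by fun_prop
  measurable_r := by
    have := (measurable_regProperTime δ).comp (measurable_prodMk_left (x := m))
    simp only [Function.comp_def] at this
    fun_prop
  integrable := by
    refine Continuous.integrableOn_Icc ?_
    refine continuous_const.div (by fun_prop) fun s h => ?_
    have := congrArg Complex.re h
    simp at this
    exact hδ.ne' this
  norm_c_le s hs := by
    rw [norm_div, norm_one, one_div]
    exact inv_anti₀ (abs_pos.2 hs) (abs_le_norm_add_I_mul δ s)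
  norm_r_le s hs := norm_regProperTime_sub_le hδ hm hs
  norm_integral_le := by
    rw [integral_Icc_inv_add hδ hS]
    -- The end points of the primitive are conjugate, so the difference of logarithms is 2i arg, and
    -- |arg| ≤ π/2 in the right half-plane.
    have hconj : (δ + Complex.I * (-S : ℝ) : ℂ) = (starRingEnd ℂ) (δ + Complex.I * S) := by
      simp
    have harg := Complex.abs_arg_le_pi_div_two_iff.2
      (show 0 ≤ (δ + Complex.I * S : ℂ).re by simpa using hδ.le)
    have hne : (δ + Complex.I * S : ℂ).arg ≠ Real.pi := fun h => by
      rw [h, abs_of_pos Real.pi_pos] at harg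
      linarith [Real.pi_pos]
    rw [hconj, Complex.log_conj _ hne, norm_mul, norm_neg, Complex.norm_I, one_mul]
    have : Complex.log (δ + Complex.I * S) - (starRingEnd ℂ) (Complex.log (δ + Complex.I * S)) =
        ((2 * (δ + Complex.I * S : ℂ).arg : ℝ) : ℂ) * Complex.I := by
      rw [Complex.sub_conj, Complex.log_im]
    rw [this, norm_mul, Complex.norm_I, mul_one, Complex.norm_real, Real.norm_eq_abs, abs_mul,
      abs_two]
    linarith

/-- The source of the coefficient π of δ(λ²): log(iS) − log(−iS) = iπ for every S > 0. -/
theorem tendsto_integral_Icc_inv_add {S : ℝ} (hS : 0 < S) :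
    Tendsto (fun δ : ℝ => ∫ s in Icc (-S) S, 1 / (δ + Complex.I * s)) (𝓝[>] 0) (𝓝 Real.pi) := by
  have hlim : Tendsto (fun δ : ℝ => -Complex.I * (Complex.log (δ + Complex.I * S) -
      Complex.log (δ + Complex.I * (-S : ℝ)))) (𝓝[>] 0) (𝓝 (-Complex.I *
        (Complex.log ((0 : ℝ) + Complex.I * S) - Complex.log ((0 : ℝ) + Complex.I * (-S : ℝ))))) := by
    refine Tendsto.mono_left ?_ nhdsWithin_le_nhds
    refine ContinuousAt.tendsto (f := fun δ : ℝ => -Complex.I *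
      (Complex.log (δ + Complex.I * S) - Complex.log (δ + Complex.I * (-S : ℝ)))) ?_
    refine continuousAt_const.mul (ContinuousAt.sub ?_ ?_)
    · refine ContinuousAt.clog (by fun_prop) (Or.inr ?_)
      simpa using hS.ne'
    · refine ContinuousAt.clog (by fun_prop) (Or.inr ?_)
      simpa using hS.ne'
  have hval : -Complex.I * (Complex.log ((0 : ℝ) + Complex.I * S) -
      Complex.log ((0 : ℝ) + Complex.I * (-S : ℝ))) = Real.pi := by
    have e1 : (((0 : ℝ) : ℂ) + Complex.I * S) = (S : ℝ) * Complex.I := by push_cast; ring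
    have e2 : (((0 : ℝ) : ℂ) + Complex.I * (-S : ℝ)) = (S : ℝ) * (-Complex.I) := by
      push_cast; ring
    rw [e1, e2, Complex.log_ofReal_mul hS Complex.I_ne_zero,
      Complex.log_ofReal_mul hS (neg_ne_zero.2 Complex.I_ne_zero), Complex.log_I, Complex.log_neg_I]
    linear_combination (-(Real.pi : ℂ)) * Complex.I_sq
  rw [hval] at hlim
  refine hlim.congr' ?_
  filter_upwards [self_mem_nhdsWithin] with δ hδ
  exact (integral_Icc_inv_add hδ hS).symm

/-- The part of a function of the Minkowski square off a neighbourhood of the light cone. -/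
noncomputable def offCone (ε : ℝ) (f : ℝ → ℂ) : ℝ → ℂ := {s : ℝ | ε < |s|}.indicator f

theorem measurableSet_offCone (ε : ℝ) : MeasurableSet {s : ℝ | ε < |s|} :=
  measurableSet_lt measurable_const (by fun_prop)

theorem norm_offCone_le (ε : ℝ) (f : ℝ → ℂ) (s : ℝ) : ‖offCone ε f s‖ ≤ ‖f s‖ :=
  norm_indicator_le_norm_self f s

/-- The truncation is symmetric and 1/s is odd. -/
theorem integral_offCone_inv (ε S : ℝ) (hS : 0 < S) :
    ∫ s in Icc (-S) S, offCone ε (fun s : ℝ => 1 / (Complex.I * s)) s = 0 := by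
  rw [integral_Icc_eq_integral_Ioc, ← intervalIntegral.integral_of_le (by linarith)]
  have h := intervalIntegral.integral_comp_neg (a := -S) (b := S)
    (offCone ε fun s : ℝ => 1 / (Complex.I * s))
  have hodd : ∀ s : ℝ, offCone ε (fun s : ℝ => 1 / (Complex.I * s)) (-s) =
      -offCone ε (fun s : ℝ => 1 / (Complex.I * s)) s := by
    intro s
    by_cases hs : ε < |s|
    · simp [offCone, indicator, hs]
    · simp [offCone, indicator, hs]
  simp only [hodd, neg_neg, intervalIntegral.integral_neg] at h
  have : (2 : ℂ) * ∫ s in (-S)..S, offCone ε (fun s : ℝ => 1 / (Complex.I * s)) s = 0 := by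
    linear_combination -h
  simpa using this

theorem norm_one_div_I_mul (s : ℝ) : ‖(1 / (Complex.I * s) : ℂ)‖ = |s|⁻¹ := by
  rw [norm_div, norm_one, norm_mul, Complex.norm_I, one_mul, Complex.norm_real, one_div,
    Real.norm_eq_abs]

theorem isFiberKernel_offCone {S ε m : ℝ} (hS : 0 < S) (hε : 0 < ε) (hm : 0 < m) :
    IsFiberKernel S m (offCone ε fun s => 1 / (Complex.I * s))
      (offCone ε fun s => properTimeDensity m s - 1 / (Complex.I * s)) where
  measurable_c := Measurable.indicator (by fun_prop) (measurableSet_offCone ε)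
  measurable_r := by
    have := measurable_properTimeDensity.comp (measurable_prodMk_left (x := m))
    simp only [Function.comp_def] at this
    exact Measurable.indicator (by fun_prop) (measurableSet_offCone ε)
  integrable := by
    refine Measure.integrableOn_of_bounded (M := ε⁻¹) (by simp)
      (Measurable.indicator (by fun_prop) (measurableSet_offCone ε)).aestronglyMeasurable
      (ae_of_all _ fun s => ?_)
    by_cases hs : ε < |s|
    · refine (norm_offCone_le _ _ _).trans ?_
      rw [norm_one_div_I_mul]
      exact inv_anti₀ hε hs.le
    · simp [offCone, indicator, hs, hε.le]
  norm_c_le s hs := (norm_offCone_le _ _ _).trans (norm_one_div_I_mul s).le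
  norm_r_le s hs := (norm_offCone_le _ _ _).trans (norm_properTimeDensity_add_le hm hs)
  norm_integral_le := by
    rw [integral_offCone_inv ε S hS, norm_zero]
    exact Real.pi_pos.le

theorem tendsto_offCone (f : ℝ → ℂ) {s : ℝ} (hs : s ≠ 0) :
    Tendsto (fun ε => offCone ε f s) (𝓝[>] 0) (𝓝 (f s)) := by
  refine tendsto_const_nhds.congr' ?_
  have : ∀ᶠ ε in 𝓝 (0 : ℝ), ε < |s| := gt_mem_nhds (abs_pos.2 hs)
  filter_upwards [nhdsWithin_le_nhds this] with ε hε
  exact (indicator_of_mem (s := {s : ℝ | ε < |s|}) hε f).symm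

variable {S H C m M : ℝ} {E : Set ℝ} {g : ℝ → ℂ}

theorem IsFiberFunction.integral_eq (hg : IsFiberFunction S H C E g) (k : ℝ → ℂ) :
    ∫ s, g s * k s = ∫ s in Icc (-S) S, g s * k s := by
  rw [setIntegral_eq_integral_of_forall_compl_eq_zero]
  intro s hs
  rw [hg.zero_of_lt s, zero_mul]
  by_contra! h
  exact hs (abs_le.1 h)

theorem IsFiberFunction.norm_integral_reg_le (hg : IsFiberFunction S H C E g) (hm : 0 < m)
    (hmM : m ≤ M) {δ : ℝ} (hδ : 0 < δ) :
    ‖∫ s, g s * regProperTime δ m s‖ ≤ (H + C) * fiberConst S M * fiberWeight S E := by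
  rw [hg.integral_eq]
  simpa using hg.norm_integral_le hm.le hmM (isFiberKernel_reg hg.pos hδ hm.le)

/-- The Plemelj formula on a fibre, with the mass-dependent correction carried along in
`fiberLimit`. -/
theorem IsFiberFunction.tendsto_integral_reg (hg : IsFiberFunction S H C E g) (hm : 0 < m) :
    Tendsto (fun δ => ∫ s, g s * regProperTime δ m s) (𝓝[>] 0)
      (𝓝 (g 0 * Real.pi + fiberLimit S m g)) := by
  have hinv : ∀ s : ℝ, s ≠ 0 → Tendsto (fun δ : ℝ => (1 : ℂ) / (δ + Complex.I * s)) (𝓝[>] 0)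
      (𝓝 (1 / (Complex.I * s))) := by
    intro s hs
    refine Tendsto.mono_left ?_ nhdsWithin_le_nhds
    have : ContinuousAt (fun δ : ℝ => (1 : ℂ) / (δ + Complex.I * s)) 0 :=
      ContinuousAt.div (by fun_prop) (by fun_prop) (by simp [hs])
    simpa [ContinuousAt] using this
  have := hg.tendsto_integral hm.le (l := 𝓝[>] 0)
    (c := fun δ s => 1 / (δ + Complex.I * s))
    (r := fun δ s => regProperTime δ m s - 1 / (δ + Complex.I * s))
    (eventually_mem_nhdsWithin.mono fun δ hδ => isFiberKernel_reg hg.pos hδ hm.le) hinv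
    (fun s hs => (tendsto_regProperTime hm hs).sub (hinv s hs))
    (tendsto_integral_Icc_inv_add hg.pos)
  refine this.congr fun δ => ?_
  rw [hg.integral_eq]
  simp

theorem offCone_split (ε m s : ℝ) :
    offCone ε (fun s => 1 / (Complex.I * s)) s +
      offCone ε (fun s => properTimeDensity m s - 1 / (Complex.I * s)) s =
      offCone ε (properTimeDensity m) s := by
  by_cases hs : ε < |s| <;> simp [offCone, indicator, hs]

theorem IsFiberFunction.norm_integral_offCone_le (hg : IsFiberFunction S H C E g) (hm : 0 < m)
    (hmM : m ≤ M) {ε : ℝ} (hε : 0 < ε) :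
    ‖∫ s, g s * offCone ε (properTimeDensity m) s‖ ≤
      (H + C) * fiberConst S M * fiberWeight S E := by
  rw [hg.integral_eq]
  simpa only [offCone_split] using
    hg.norm_integral_le hm.le hmM (isFiberKernel_offCone hg.pos hε hm)

theorem IsFiberFunction.tendsto_integral_offCone (hg : IsFiberFunction S H C E g) (hm : 0 < m) :
    Tendsto (fun ε => ∫ s, g s * offCone ε (properTimeDensity m) s) (𝓝[>] 0)
      (𝓝 (fiberLimit S m g)) := by
  have := hg.tendsto_integral hm.le (l := 𝓝[>] 0) (a := 0)
    (c := fun ε => offCone ε fun s => 1 / (Complex.I * s))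
    (r := fun ε => offCone ε fun s => properTimeDensity m s - 1 / (Complex.I * s))
    (eventually_mem_nhdsWithin.mono fun ε hε => isFiberKernel_offCone hg.pos hε hm)
    (fun s hs => tendsto_offCone _ hs) (fun s hs => tendsto_offCone _ hs)
    (by simp only [integral_offCone_inv _ S hg.pos]; exact tendsto_const_nhds)
  rw [mul_zero, zero_add] at this
  refine this.congr fun ε => ?_
  rw [hg.integral_eq]
  simp only [offCone_split]

end Volkov

/-! ### Light-cone coordinates and the dominating function on the base. -/

namespace Volkov

/-- Coordinates `((x₁, x₂, ξ), z)` on Minkowski space centred at `y`. -/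
def chart (y : Spacetime) (p : (ℝ × ℝ × ℝ) × ℝ) : Spacetime :=
  y + (p.1.2.2 + p.2, p.1.1, p.1.2.1, p.2)

theorem continuous_chart (y : Spacetime) : Continuous (chart y) := by
  unfold chart; fun_prop

theorem chart_injective (y : Spacetime) : Function.Injective (chart y) := by
  rintro ⟨⟨a, b, c⟩, d⟩ ⟨⟨a', b', c'⟩, d'⟩ h
  have h1 := add_left_cancel h
  simp only [Prod.mk.injEq] at h1 ⊢
  obtain ⟨h1, h2, h3, h4⟩ := h1
  exact ⟨⟨h2, h3, by linarith⟩, h4⟩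

theorem measurableEmbedding_chart (y : Spacetime) : MeasurableEmbedding (chart y) :=
  (continuous_chart y).measurableEmbedding (chart_injective y)

/-- Apart from reassociations, a swap and a translation, the only step is the shear (ξ, z) ↦ (z, z +
ξ) in `s3`. -/
theorem measurePreserving_chart (y : Spacetime) : MeasurePreserving (chart y) := by
  have s1 : MeasurePreserving (fun p : (ℝ × ℝ × ℝ) × ℝ => (p.1.1, (p.1.2, p.2))) :=
    volume_preserving_prodAssoc
  have s2 : MeasurePreserving (fun p : (ℝ × ℝ) × ℝ => (p.1.1, (p.1.2, p.2))) :=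
    volume_preserving_prodAssoc
  have s3 : MeasurePreserving (fun p : ℝ × ℝ => (p.2, p.2 + p.1)) :=
    measurePreserving_prod_add_swap volume volume
  have s4 : MeasurePreserving (fun p : ℝ × ℝ × ℝ => ((p.1, p.2.1), p.2.2)) :=
    volume_preserving_prodAssoc.symm
  have s5 : MeasurePreserving (fun p : ℝ × (ℝ × ℝ) × ℝ => ((p.1, p.2.1), p.2.2)) :=
    volume_preserving_prodAssoc.symm
  have s6 : MeasurePreserving (Prod.swap : (ℝ × ℝ × ℝ) × ℝ → ℝ × ℝ × ℝ × ℝ) :=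
    Measure.measurePreserving_swap
  have id1 : MeasurePreserving (id : ℝ → ℝ) := MeasurePreserving.id volume
  have s0 : ∀ a : ℝ, MeasurePreserving (fun x : ℝ => a + x) := measurePreserving_add_left volume
  have s7 : MeasurePreserving (fun x : Spacetime => y + x) :=
    (s0 y.1).prod ((s0 y.2.1).prod ((s0 y.2.2.1).prod (s0 y.2.2.2)))
  have := s7.comp (s6.comp (s5.comp ((id1.prod s4).comp ((id1.prod (id1.prod s3)).comp
    ((id1.prod s2).comp s1)))))
  convert this using 1
  ext p <;> simp [chart, add_comm]

/-- The terms quadratic in z cancel, which is the point of these coordinates: on a fibre the square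
is affine in z with slope 2ξ. -/
theorem minkSq_chart (y : Spacetime) (p : (ℝ × ℝ × ℝ) × ℝ) :
    minkSq (chart y p - y) =
      2 * p.1.2.2 * p.2 + (p.1.2.2 ^ 2 - p.1.1 ^ 2 - p.1.2.1 ^ 2) := by
  simp only [chart, minkSq, add_sub_cancel_left]
  ring

/-- The coordinate `z` as a function of the Minkowski square. -/
noncomputable def zOf (w : ℝ × ℝ × ℝ) (s : ℝ) : ℝ :=
  (s + w.1 ^ 2 + w.2.1 ^ 2 - w.2.2 ^ 2) / (2 * w.2.2)

/-- The values of the Minkowski square over the part `|z| ≤ M` of a fibre. -/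
def fiberSet (M : ℝ) (w : ℝ × ℝ × ℝ) : Set ℝ := {s | |zOf w s| ≤ M}

/-- The cube `|x₁|, |x₂|, |ξ| ≤ M`. -/
def cube (M : ℝ) : Set (ℝ × ℝ × ℝ) := {w | |w.1| ≤ M ∧ |w.2.1| ≤ M ∧ |w.2.2| ≤ M}

theorem measurableSet_cube (M : ℝ) : MeasurableSet (cube M) :=
  (measurableSet_le (f := fun w : ℝ × ℝ × ℝ => |w.1|) (by fun_prop) measurable_const).inter
    ((measurableSet_le (f := fun w : ℝ × ℝ × ℝ => |w.2.1|) (by fun_prop) measurable_const).inter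
    (measurableSet_le (f := fun w : ℝ × ℝ × ℝ => |w.2.2|) (by fun_prop) measurable_const))

/-- The integrable function on the base that dominates all fibre integrals. -/
noncomputable def fiberDom (S M : ℝ) (w : ℝ × ℝ × ℝ) : ℝ :=
  (cube M).indicator 1 w * |w.2.2| ^ (-(5 / 4) : ℝ) * fiberWeight S (fiberSet M w)

/-- The set lies in two intervals ±[√p, √(p + 2h)], and √(p + 2h) − √p ≤ √(2h). With h = 2M|ξ| this
is the gain |ξ|^(1/2) that makes the fibre bounds integrable over the base. -/
theorem volume_abs_sq_add_le (c : ℝ) {h : ℝ} (hh : 0 ≤ h) :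
    volume.real {x : ℝ | |x ^ 2 + c| ≤ h} ≤ 2 * Real.sqrt (2 * h) := by
  set p := max 0 (-c - h) with hp
  have hp0 : 0 ≤ p := le_max_left _ _
  set a := Real.sqrt p
  set b := Real.sqrt (p + 2 * h)
  have hab : a ≤ b := Real.sqrt_le_sqrt (by linarith)
  have hb : b ≤ a + Real.sqrt (2 * h) := by
    apply Real.sqrt_le_iff.2
    have := Real.sqrt_nonneg p
    have h2 := Real.sqrt_nonneg (2 * h)
    refine ⟨by positivity, ?_⟩
    nlinarith [Real.sq_sqrt hp0, Real.sq_sqrt (show 0 ≤ 2 * h by linarith), mul_nonneg this h2]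
  have hsub : {x : ℝ | |x ^ 2 + c| ≤ h} ⊆ Icc a b ∪ Icc (-b) (-a) := by
    intro x hx
    rw [mem_ofPred_eq] at hx
    have hx' := abs_le.1 hx
    have h1 : a ≤ |x| := by
      refine Real.sqrt_le_iff.2 ⟨abs_nonneg x, ?_⟩
      rw [sq_abs]
      exact max_le (sq_nonneg x) (by linarith [hx'.1])
    have h2 : |x| ≤ b := by
      refine Real.le_sqrt_of_sq_le ?_
      rw [sq_abs]
      linarith [hx'.2, le_max_right 0 (-c - h)]
    rcases le_total 0 x with h0 | h0
    · rw [abs_of_nonneg h0] at h1 h2; exact Or.inl ⟨h1, h2⟩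
    · rw [abs_of_nonpos h0] at h1 h2; exact Or.inr ⟨by linarith, by linarith⟩
  calc volume.real {x : ℝ | |x ^ 2 + c| ≤ h} ≤ volume.real (Icc a b ∪ Icc (-b) (-a)) :=
        measureReal_mono hsub (by
          refine (measure_union_lt_top ?_ ?_).ne <;> simp)
    _ ≤ volume.real (Icc a b) + volume.real (Icc (-b) (-a)) := measureReal_union_le _ _
    _ = 2 * (b - a) := by
        rw [Real.volume_real_Icc_of_le hab, Real.volume_real_Icc_of_le (by linarith)]; ring
    _ ≤ _ := by linarith

theorem mem_fiberSet_iff {M : ℝ} {w : ℝ × ℝ × ℝ} (hw : w.2.2 ≠ 0) {s : ℝ} :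
    s ∈ fiberSet M w ↔ |w.1 ^ 2 + (s + w.2.1 ^ 2 - w.2.2 ^ 2)| ≤ 2 * M * |w.2.2| := by
  have : 0 < |2 * w.2.2| := abs_pos.2 (mul_ne_zero two_ne_zero hw)
  rw [fiberSet, mem_ofPred_eq, zOf, abs_div, div_le_iff₀ this, abs_mul 2, abs_two]
  have e : s + w.1 ^ 2 + w.2.1 ^ 2 - w.2.2 ^ 2 = w.1 ^ 2 + (s + w.2.1 ^ 2 - w.2.2 ^ 2) := by ring
  rw [e, ← mul_assoc, mul_comm M 2]

theorem measurable_zOf : Measurable fun p : (ℝ × ℝ × ℝ) × ℝ => zOf p.1 p.2 := by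
  unfold zOf; fun_prop

theorem measurableSet_fiberSet (M : ℝ) (w : ℝ × ℝ × ℝ) : MeasurableSet (fiberSet M w) := by
  have := measurable_zOf.comp (measurable_prodMk_left (x := w))
  exact measurableSet_le (this.norm) measurable_const

/-- The integrand of the dominating function. -/
noncomputable def domIntegrand (M : ℝ) (k : ℝ → ℝ) (p : (ℝ × ℝ × ℝ) × ℝ) : ℝ :=
  (cube M).indicator 1 p.1 * |p.1.2.2| ^ (-(5 / 4) : ℝ) *
    (k p.2 * (fiberSet M p.1).indicator 1 p.2)

theorem measurable_domIntegrand (M : ℝ) {k : ℝ → ℝ} (hk : Measurable k) :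
    Measurable (domIntegrand M k) := by
  have h1 : Measurable fun p : (ℝ × ℝ × ℝ) × ℝ => (fiberSet M p.1).indicator (1 : ℝ → ℝ) p.2 :=
    Measurable.indicator (f := fun _ : (ℝ × ℝ × ℝ) × ℝ => (1 : ℝ)) measurable_const
      (measurableSet_le measurable_zOf.norm (measurable_const (a := M)))
  have h2 : Measurable fun p : (ℝ × ℝ × ℝ) × ℝ => (cube M).indicator (1 : ℝ × ℝ × ℝ → ℝ) p.1 :=
    (measurable_const.indicator (measurableSet_cube M)).comp measurable_fst
  unfold domIntegrand
  fun_prop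

/-- Integrating over x₁ first replaces |ξ|^(−5/4) by |ξ|^(−3/4), which is integrable on bounded
sets. The measure `ν` in s is left open in order to cover both Lebesgue measure and the Dirac mass
at 0. -/
theorem integrable_domIntegrand {M : ℝ} (hM : 0 ≤ M) {k : ℝ → ℝ} (hk : Measurable k)
    (hk0 : ∀ s, 0 ≤ k s) {ν : Measure ℝ} [SFinite ν] (hkν : Integrable k ν) :
    Integrable (domIntegrand M k) ((volume : Measure (ℝ × ℝ × ℝ)).prod ν) := by
  have hmeas := measurable_domIntegrand M hk
  have hassoc := measurePreserving_prodAssoc (volume : Measure ℝ) (volume : Measure (ℝ × ℝ)) ν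
  change Integrable _ (((volume : Measure ℝ).prod (volume : Measure (ℝ × ℝ))).prod ν)
  rw [← (hassoc.symm _).integrable_comp_emb (MeasurableEquiv.measurableEmbedding _)]
  have hcomp : Measurable (domIntegrand M k ∘ (MeasurableEquiv.prodAssoc
      (α := ℝ) (β := ℝ × ℝ) (γ := ℝ)).symm) := hmeas.comp (MeasurableEquiv.measurable _)
  have hform : ∀ (q : (ℝ × ℝ) × ℝ) (x : ℝ),
      ‖domIntegrand M k ((x, q.1), q.2)‖ ≤ (if |q.1.1| ≤ M ∧ |q.1.2| ≤ M then 1 else 0) *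
        (|q.1.2| ^ (-(5 / 4) : ℝ) * k q.2) * {x : ℝ | |x ^ 2 + (q.2 + q.1.1 ^ 2 - q.1.2 ^ 2)| ≤
          2 * M * |q.1.2|}.indicator 1 x := by
    intro q x
    have hk' := hk0 q.2
    -- At ξ = 0 both sides vanish, because a negative power of 0 is 0 by convention.
    by_cases hq0 : q.1.2 = 0
    · simp [domIntegrand, hq0]
    by_cases hq : ((x, q.1) : ℝ × ℝ × ℝ) ∈ cube M
    · by_cases hs : q.2 ∈ fiberSet M (x, q.1)
      · have hs' := (mem_fiberSet_iff (w := (x, q.1)) hq0).1 hs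
        rw [indicator_of_mem (s := {x : ℝ | |x ^ 2 + (q.2 + q.1.1 ^ 2 - q.1.2 ^ 2)| ≤
          2 * M * |q.1.2|}) hs', if_pos hq.2]
        simp only [domIntegrand, indicator_of_mem hq, indicator_of_mem hs, Pi.one_apply, one_mul,
          mul_one]
        rw [Real.norm_of_nonneg (by positivity)]
      · simp only [domIntegrand, indicator_of_notMem hs, mul_zero, norm_zero]
        refine mul_nonneg (mul_nonneg ?_ (by positivity)) (indicator_nonneg (by simp) _)
        split_ifs <;> norm_num
    · simp only [domIntegrand, indicator_of_notMem hq, zero_mul, norm_zero]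
      refine mul_nonneg (mul_nonneg ?_ (by positivity)) (indicator_nonneg (by simp) _)
      split_ifs <;> norm_num
  have hset : ∀ (c h : ℝ), MeasurableSet {x : ℝ | |x ^ 2 + c| ≤ h} := fun c h =>
    (isClosed_le (by fun_prop) (by fun_prop)).measurableSet
  have hfin : ∀ (c h : ℝ), volume {x : ℝ | |x ^ 2 + c| ≤ h} ≠ ⊤ := fun c h => by
    refine ne_top_of_le_ne_top (b := volume (Icc (-(|c| + h + 1)) (|c| + h + 1))) (by simp)
      (measure_mono fun x hx => ?_)
    rw [mem_ofPred_eq] at hx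
    rw [mem_Icc, ← abs_le]
    have h1 : x ^ 2 ≤ |c| + h := by
      have := (abs_le.1 hx).2
      linarith [neg_abs_le c]
    nlinarith [sq_abs x, abs_nonneg x]
  have hind : ∀ (c h : ℝ), Integrable ({x : ℝ | |x ^ 2 + c| ≤ h}.indicator (1 : ℝ → ℝ)) :=
    fun c h => (integrable_indicator_iff (hset c h)).2
      (integrableOn_const (hfin c h))
  have hdomq : Integrable (fun q : (ℝ × ℝ) × ℝ =>
      ((Icc (-M) M).indicator 1 q.1.1 * ((Icc (-M) M).indicator
        (fun ξ => 2 * Real.sqrt (4 * M) * |ξ| ^ (-(3 / 4) : ℝ)) q.1.2)) * k q.2)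
      ((volume : Measure (ℝ × ℝ)).prod ν) := by
    refine Integrable.mul_prod (f := fun q : ℝ × ℝ => (Icc (-M) M).indicator 1 q.1 *
      ((Icc (-M) M).indicator (fun ξ => 2 * Real.sqrt (4 * M) * |ξ| ^ (-(3 / 4) : ℝ)) q.2)) ?_ hkν
    refine Integrable.mul_prod (f := (Icc (-M) M).indicator (1 : ℝ → ℝ)) ?_ ?_
    · exact (integrable_indicator_iff measurableSet_Icc).2 (integrableOn_const (by simp))
    · exact (integrable_indicator_iff measurableSet_Icc).2
        ((integrable_abs_rpow_Icc (by norm_num) M).const_mul _)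
  rw [integrable_prod_iff' hcomp.aestronglyMeasurable]
  refine ⟨ae_of_all _ fun q => ?_, ?_⟩
  · refine Integrable.mono' ((hind _ _).const_mul _)
      (hcomp.comp measurable_prodMk_right).aestronglyMeasurable (ae_of_all _ fun x => hform q x)
  · refine hdomq.mono' ?_ (ae_of_all _ fun q => ?_)
    · exact (hcomp.norm.stronglyMeasurable.integral_prod_left').aestronglyMeasurable
    · rw [Real.norm_of_nonneg (integral_nonneg fun _ => norm_nonneg _)]
      refine (integral_mono_of_nonneg (ae_of_all _ fun _ => norm_nonneg _)
        ((hind _ _).const_mul _) (ae_of_all _ fun x => hform q x)).trans ?_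
      rw [integral_const_mul, integral_indicator_one (hset _ _)]
      have hvol := volume_abs_sq_add_le (q.2 + q.1.1 ^ 2 - q.1.2 ^ 2)
        (h := 2 * M * |q.1.2|) (by positivity)
      have hk' := hk0 q.2
      by_cases hq : |q.1.1| ≤ M ∧ |q.1.2| ≤ M
      · rw [if_pos hq, indicator_of_mem (mem_Icc.2 (abs_le.1 hq.1)),
          indicator_of_mem (mem_Icc.2 (abs_le.1 hq.2)),
          Pi.one_apply, one_mul, one_mul]
        rcases eq_or_ne q.1.2 0 with h0 | h0
        · simp [h0]
        have hp := abs_pos.2 h0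
        have e1 : Real.sqrt (2 * (2 * M * |q.1.2|)) =
            Real.sqrt (4 * M) * |q.1.2| ^ (1 / 2 : ℝ) := by
          rw [← Real.sqrt_eq_rpow, ← Real.sqrt_mul (by positivity)]; ring_nf
        have e2 : |q.1.2| ^ (-(3 / 4) : ℝ) =
            |q.1.2| ^ (-(5 / 4) : ℝ) * |q.1.2| ^ (1 / 2 : ℝ) := by
          rw [← Real.rpow_add hp]; norm_num
        calc |q.1.2| ^ (-(5 / 4) : ℝ) * k q.2 * _
            ≤ |q.1.2| ^ (-(5 / 4) : ℝ) * k q.2 * (2 * Real.sqrt (2 * (2 * M * |q.1.2|))) := by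
              gcongr
          _ = _ := by rw [e1, e2]; ring
      · rw [if_neg hq, zero_mul, zero_mul]
        refine mul_nonneg (mul_nonneg (indicator_nonneg (by simp) _)
          (indicator_nonneg (fun _ _ => by positivity) _)) hk'

/-- The two summands of `fiberWeight` come from Lebesgue measure on [−S, S] and from the Dirac mass
at 0. -/
theorem integrable_fiberDom {M : ℝ} (hM : 0 ≤ M) (S : ℝ) : Integrable (fiberDom S M) := by
  have h1 := (integrable_domIntegrand hM (k := fun s => |s| ^ (-(3 / 4) : ℝ)) (by fun_prop)
    (fun s => by positivity) (ν := volume.restrict (Icc (-S) S))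
    (integrable_abs_rpow_Icc (by norm_num) S)).integral_prod_left
  have h2 := (integrable_domIntegrand hM (k := fun _ => 1) (by fun_prop)
    (fun s => zero_le_one) (ν := Measure.dirac 0) (integrable_const 1)).integral_prod_left
  refine (h1.add h2).congr (ae_of_all _ fun w => ?_)
  simp only [Pi.add_apply, domIntegrand, integral_dirac, one_mul, fiberDom, fiberWeight]
  rw [integral_const_mul, mul_add]

end Volkov

/-! ### Disintegration over the fibres and passage to the limit under the base integral. -/

namespace Volkov

/-- A test function in the coordinates of `chart`: continuous, supported in a cube, bounded and
Lipschitz in `z`. -/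
structure IsChartFunction (M C : ℝ) (Ψ : (ℝ × ℝ × ℝ) × ℝ → ℂ) : Prop where
  continuous : Continuous Ψ
  pos : 0 < M
  nonneg : 0 ≤ C
  bound : ∀ p, ‖Ψ p‖ ≤ C
  zero_of_notMem : ∀ w z, w ∉ cube M → Ψ (w, z) = 0
  zero_of_lt : ∀ w z, M < |z| → Ψ (w, z) = 0
  lipschitz : ∀ w z z', ‖Ψ (w, z) - Ψ (w, z')‖ ≤ C * |z - z'|

/-- The Minkowski square in the coordinates of `chart`. -/
def sOf (p : (ℝ × ℝ × ℝ) × ℝ) : ℝ :=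
  2 * p.1.2.2 * p.2 + (p.1.2.2 ^ 2 - p.1.1 ^ 2 - p.1.2.1 ^ 2)

/-- The restriction of a function to a fibre, as a function of the Minkowski square. -/
noncomputable def fiberFun (Ψ : (ℝ × ℝ × ℝ) × ℝ → ℂ) (w : ℝ × ℝ × ℝ) (s : ℝ) : ℂ :=
  Ψ (w, zOf w s)

variable {M C : ℝ} {Ψ : (ℝ × ℝ × ℝ) × ℝ → ℂ} {w : ℝ × ℝ × ℝ}

theorem zOf_sOf (hw : w.2.2 ≠ 0) (z : ℝ) : zOf w (sOf (w, z)) = z := by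
  simp only [zOf, sOf]; field_simp; ring

theorem sOf_zOf (hw : w.2.2 ≠ 0) (s : ℝ) : sOf (w, zOf w s) = s := by
  simp only [zOf, sOf]; field_simp; ring

theorem measurable_sOf : Measurable sOf := by unfold sOf; fun_prop

theorem abs_sOf_le {z : ℝ} (hw : w ∈ cube M) (hz : |z| ≤ M) : |sOf (w, z)| ≤ 6 * M ^ 2 := by
  obtain ⟨h1, h2, h3⟩ := hw
  have e1 := sq_le_sq' (abs_le.1 h1).1 (abs_le.1 h1).2
  have e2 := sq_le_sq' (abs_le.1 h2).1 (abs_le.1 h2).2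
  have e3 := sq_le_sq' (abs_le.1 h3).1 (abs_le.1 h3).2
  have e4 : |w.2.2 * z| ≤ M * M := by
    rw [abs_mul]; exact mul_le_mul h3 hz (abs_nonneg _) ((abs_nonneg _).trans h3)
  have e5 := abs_le.1 e4
  simp only [sOf]
  rw [abs_le]
  constructor <;> nlinarith [sq_nonneg w.1, sq_nonneg w.2.1, sq_nonneg w.2.2]

theorem indicator_fiberSet (s : ℝ) :
    (fiberSet M w).indicator (1 : ℝ → ℝ) s = if |zOf w s| ≤ M then 1 else 0 := by
  by_cases h : |zOf w s| ≤ M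
  · rw [if_pos h, indicator_of_mem (show s ∈ fiberSet M w from h)]; rfl
  · rw [if_neg h, indicator_of_notMem (show s ∉ fiberSet M w from h)]

theorem min_one_le_rpow {x : ℝ} (hx : 0 ≤ x) : min 1 x ≤ x ^ (1 / 4 : ℝ) := by
  rcases le_total x 1 with h | h
  · exact (min_le_right _ _).trans (Real.self_le_rpow_of_le_one hx h (by norm_num))
  · exact (min_le_left _ _).trans (Real.one_le_rpow h (by norm_num))

/-- As a function of s the restriction has Lipschitz constant of order C/|ξ|, too large to be summed
over the base. Interpolation with the bound 2C by min(1, x) ≤ x^(1/4) lowers the cost to |ξ|^(−1/4).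
-/
theorem IsChartFunction.isFiberFunction (hΨ : IsChartFunction M C Ψ) (hw : w.2.2 ≠ 0)
    (hcube : w ∈ cube M) :
    IsFiberFunction (6 * M ^ 2) (2 * C * |w.2.2| ^ (-(1 / 4) : ℝ)) C (fiberSet M w)
      (fiberFun Ψ w) := by
  have hM := hΨ.pos
  have hC := hΨ.nonneg
  have hbd : ∀ s, ‖fiberFun Ψ w s‖ ≤ C * (fiberSet M w).indicator (1 : ℝ → ℝ) s := by
    intro s
    rw [indicator_fiberSet]
    split_ifs with h
    · rw [mul_one]; exact hΨ.bound _
    · rw [fiberFun, hΨ.zero_of_lt _ _ (not_le.1 h), norm_zero, mul_zero]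
  refine ⟨?_, by positivity, by positivity, hC, measurableSet_fiberSet M w, ?_, ?_, hbd⟩
  · have := hΨ.continuous.measurable
    have := measurable_zOf.comp (measurable_prodMk_left (x := w))
    simp only [Function.comp_def] at this
    unfold fiberFun
    fun_prop
  · intro s hs
    refine hΨ.zero_of_lt _ _ ?_
    by_contra! h
    have := abs_sOf_le hcube h
    rw [sOf_zOf hw] at this
    linarith
  · intro s
    have h0 := indicator_one_mem (fiberSet M w) s
    have h1 := indicator_one_mem (fiberSet M w) 0
    have hp := abs_pos.2 hw
    have hx : |s| ^ (1 / 4 : ℝ) * |w.2.2| ^ (-(1 / 4) : ℝ) = (|s| / |w.2.2|) ^ (1 / 4 : ℝ) := by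
      rw [Real.div_rpow (abs_nonneg _) hp.le, Real.rpow_neg hp.le]
      rfl
    have hzz : |zOf w s - zOf w 0| = |s| / |w.2.2| / 2 := by
      have : zOf w s - zOf w 0 = s / w.2.2 / 2 := by simp only [zOf]; field_simp; ring
      rw [this, abs_div, abs_div, abs_two]
    have hm : 0 ≤ |s| / |w.2.2| := by positivity
    rw [mul_right_comm (2 * C), mul_assoc (2 * C), hx]
    have hle : ‖fiberFun Ψ w s - fiberFun Ψ w 0‖ ≤ 2 * C * (|s| / |w.2.2|) ^ (1 / 4 : ℝ) := by
      have b0 : ∀ s, ‖fiberFun Ψ w s‖ ≤ C := fun s => hΨ.bound (w, zOf w s)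
      have b1 : ‖fiberFun Ψ w s - fiberFun Ψ w 0‖ ≤ 2 * C :=
        (norm_sub_le _ _).trans (by linarith [b0 s, b0 0])
      have b2 : ‖fiberFun Ψ w s - fiberFun Ψ w 0‖ ≤ 2 * C * (|s| / |w.2.2|) := by
        refine (hΨ.lipschitz w _ _).trans ?_
        rw [hzz]
        nlinarith [mul_nonneg hC hm]
      calc _ ≤ 2 * C * min 1 (|s| / |w.2.2|) := by
            rw [mul_min_of_nonneg _ _ (by positivity), mul_one]; exact le_min b1 b2
        _ ≤ _ := by gcongr; exact min_one_le_rpow hm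
    -- If neither s nor 0 lies in `fiberSet M w`, both values of the function are 0.
    by_cases hs : 1 ≤ (fiberSet M w).indicator (1 : ℝ → ℝ) s +
        (fiberSet M w).indicator (1 : ℝ → ℝ) 0
    · exact hle.trans (le_mul_of_one_le_right (by positivity) hs)
    · have z1 : (fiberSet M w).indicator (1 : ℝ → ℝ) s = 0 := by
        rw [indicator_fiberSet] at hs ⊢
        split_ifs at hs ⊢ with h
        · exact absurd (by linarith [h1.1]) hs
        · rfl
      have z2 : (fiberSet M w).indicator (1 : ℝ → ℝ) 0 = 0 := by
        rw [indicator_fiberSet 0] at hs ⊢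
        split_ifs at hs ⊢ with h
        · exact absurd (by linarith [h0.1]) hs
        · rfl
      have g1 := hbd s
      have g2 := hbd 0
      rw [z1, mul_zero] at g1
      rw [z2, mul_zero] at g2
      rw [norm_le_zero_iff.1 g1, norm_le_zero_iff.1 g2, z1, z2]
      simp

theorem integral_fiber (hw : w.2.2 ≠ 0) (k : ℝ → ℂ) :
    ∫ z, Ψ (w, z) * k (sOf (w, z)) = (2 * |w.2.2|)⁻¹ • ∫ s, fiberFun Ψ w s * k s := by
  have h1 := Measure.integral_comp_mul_left (fun s => fiberFun Ψ w (s + (w.2.2 ^ 2 - w.1 ^ 2 -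
    w.2.1 ^ 2)) * k (s + (w.2.2 ^ 2 - w.1 ^ 2 - w.2.1 ^ 2))) (2 * w.2.2)
  rw [integral_add_right_eq_self (fun s => fiberFun Ψ w s * k s), abs_inv, abs_mul, abs_two] at h1
  rw [← h1]
  refine integral_congr_ae (ae_of_all _ fun z => ?_)
  change _ = Ψ (w, zOf w (sOf (w, z))) * k (sOf (w, z))
  rw [zOf_sOf hw]

/-- The constant in front of `fiberDom` in the domination of the fibre integrals. -/
noncomputable def domConst (M C m : ℝ) : ℝ :=
  (2 * C + C * M ^ (1 / 4 : ℝ)) / 2 * fiberConst (6 * M ^ 2) m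

/-- The Jacobian 1/(2|ξ|) times the Hölder constant gives the exponent −5/4 of `fiberDom`; the sup
bound `C` is brought to the same power by |ξ| ≤ M. -/
theorem IsChartFunction.norm_fiber_le (hΨ : IsChartFunction M C Ψ) (hw : w.2.2 ≠ 0) {m : ℝ}
    {k : ℝ → ℂ} (hk : ∀ H g, IsFiberFunction (6 * M ^ 2) H C (fiberSet M w) g →
      ‖∫ s, g s * k s‖ ≤ (H + C) * fiberConst (6 * M ^ 2) m * fiberWeight (6 * M ^ 2) (fiberSet M w))
    (hm : 0 ≤ m) :
    ‖∫ z, Ψ (w, z) * k (sOf (w, z))‖ ≤ domConst M C m * fiberDom (6 * M ^ 2) M w := by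
  have hM := hΨ.pos
  have hC := hΨ.nonneg
  by_cases hcube : w ∈ cube M
  · have hp := abs_pos.2 hw
    rw [integral_fiber hw, norm_smul, Real.norm_of_nonneg (by positivity)]
    refine (mul_le_mul_of_nonneg_left (hk _ _ (hΨ.isFiberFunction hw hcube))
      (by positivity)).trans ?_
    rw [domConst, fiberDom, indicator_of_mem hcube, Pi.one_apply, one_mul]
    set F := fiberConst (6 * M ^ 2) m with hF
    set W := fiberWeight (6 * M ^ 2) (fiberSet M w)
    have hF0 : 0 ≤ F := by
      have : 0 ≤ ∫ s in Icc (-(6 * M ^ 2)) (6 * M ^ 2), |s| ^ (-(3 / 4) : ℝ) :=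
        integral_nonneg fun s => by positivity
      have hpi := Real.pi_pos
      rw [hF, fiberConst]; positivity
    have hW0 : 0 ≤ W := fiberWeight_nonneg _ _
    have e1 : |w.2.2| ^ (-(5 / 4) : ℝ) = |w.2.2| ^ (-(1 / 4) : ℝ) * |w.2.2|⁻¹ := by
      rw [← Real.rpow_neg_one, ← Real.rpow_add hp]; norm_num
    have e2 : C ≤ C * M ^ (1 / 4 : ℝ) * |w.2.2| ^ (-(1 / 4) : ℝ) := by
      rw [mul_assoc, Real.rpow_neg hp.le]
      refine le_mul_of_one_le_right hC ?_
      rw [← div_eq_mul_inv, one_le_div (by positivity)]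
      exact Real.rpow_le_rpow hp.le hcube.2.2 (by norm_num)
    calc (2 * |w.2.2|)⁻¹ * ((2 * C * |w.2.2| ^ (-(1 / 4) : ℝ) + C) * F * W)
        ≤ (2 * |w.2.2|)⁻¹ * ((2 * C * |w.2.2| ^ (-(1 / 4) : ℝ) +
            C * M ^ (1 / 4 : ℝ) * |w.2.2| ^ (-(1 / 4) : ℝ)) * F * W) := by gcongr
      _ = _ := by rw [e1, mul_inv]; ring
  · have : ∀ z, Ψ (w, z) = 0 := fun z => hΨ.zero_of_notMem w z hcube
    simp [this, fiberDom, hcube]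

variable {μ : ℝ → ℝ} {m₁ : ℝ}

theorem ae_base_ne_zero : ∀ᵐ w : ℝ × ℝ × ℝ, w.2.2 ≠ 0 := by
  have h1 : ∀ᵐ q : ℝ × ℝ, q.2 ≠ 0 :=
    Measure.quasiMeasurePreserving_snd.ae (Measure.ae_ne volume 0)
  exact Measure.quasiMeasurePreserving_snd.ae (p := fun q : ℝ × ℝ => q.2 ≠ 0) h1

theorem aestronglyMeasurable_fiber_integral {K : (ℝ × ℝ × ℝ) × ℝ → ℂ} (hK : Measurable K)
    (hΨ : IsChartFunction M C Ψ) :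
    AEStronglyMeasurable fun w : ℝ × ℝ × ℝ => ∫ z, Ψ (w, z) * K (w, z) := by
  have := hΨ.continuous.measurable
  have h : StronglyMeasurable fun p => Ψ p * K p :=
    Measurable.stronglyMeasurable (by fun_prop)
  exact h.integral_prod_right'.aestronglyMeasurable

/-- Domination of the fibre integrals, abstractly in the kernel. -/
theorem IsChartFunction.tendsto_integral_fiber (hΨ : IsChartFunction M C Ψ)
    {k : ℝ → ℝ × ℝ → ℂ} (hkm : ∀ i, Measurable (k i)) (hμm : Measurable μ)
    {L : ℝ × ℝ × ℝ → ℂ} (hm₁ : 0 ≤ m₁)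
    (hk : ∀ w : ℝ × ℝ × ℝ, w ∈ cube M → ∀ i > 0, ∀ H g,
      IsFiberFunction (6 * M ^ 2) H C (fiberSet M w) g → ‖∫ s, g s * k i (μ w.2.2, s)‖ ≤
        (H + C) * fiberConst (6 * M ^ 2) m₁ * fiberWeight (6 * M ^ 2) (fiberSet M w))
    (hL : ∀ w : ℝ × ℝ × ℝ, w.2.2 ≠ 0 → w ∈ cube M →
      Tendsto (fun i => ∫ s, fiberFun Ψ w s * k i (μ w.2.2, s)) (𝓝[>] 0) (𝓝 (L w))) :
    Integrable (fun w => (cube M).indicator (fun w => (2 * |w.2.2|)⁻¹ • L w) w) ∧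
    Tendsto (fun i => ∫ w, ∫ z, Ψ (w, z) * k i (μ w.2.2, sOf (w, z))) (𝓝[>] 0)
      (𝓝 (∫ w, (cube M).indicator (fun w => (2 * |w.2.2|)⁻¹ • L w) w)) := by
  have hmeas : ∀ i, AEStronglyMeasurable fun w : ℝ × ℝ × ℝ =>
      ∫ z, Ψ (w, z) * k i (μ w.2.2, sOf (w, z)) := fun i => by
    have h1 := hkm i
    have h2 := measurable_sOf
    exact aestronglyMeasurable_fiber_integral
      (K := fun p => k i (μ p.1.2.2, sOf p)) (by fun_prop) hΨ
  have hbound : ∀ i > 0, ∀ w : ℝ × ℝ × ℝ, w.2.2 ≠ 0 →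
      ‖∫ z, Ψ (w, z) * k i (μ w.2.2, sOf (w, z))‖ ≤
        domConst M C m₁ * fiberDom (6 * M ^ 2) M w := by
    intro i hi w hw
    by_cases hcube : w ∈ cube M
    · exact hΨ.norm_fiber_le hw (k := fun s => k i (μ w.2.2, s)) (hk w hcube i hi) hm₁
    · have : ∀ z, Ψ (w, z) = 0 := fun z => hΨ.zero_of_notMem w z hcube
      simp [this, fiberDom, hcube]
  have hlim : ∀ᵐ w : ℝ × ℝ × ℝ, Tendsto (fun i => ∫ z, Ψ (w, z) * k i (μ w.2.2, sOf (w, z)))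
      (𝓝[>] 0) (𝓝 ((cube M).indicator (fun w => (2 * |w.2.2|)⁻¹ • L w) w)) := by
    filter_upwards [ae_base_ne_zero] with w hw
    by_cases hcube : w ∈ cube M
    · rw [indicator_of_mem hcube]
      refine ((hL w hw hcube).const_smul (2 * |w.2.2|)⁻¹).congr fun i => ?_
      exact (integral_fiber hw fun s => k i (μ w.2.2, s)).symm
    · have : ∀ z, Ψ (w, z) = 0 := fun z => hΨ.zero_of_notMem w z hcube
      simp [this, hcube]
  have hdom := (integrable_fiberDom hΨ.pos.le (6 * M ^ 2)).const_mul (domConst M C m₁)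
  refine ⟨?_, tendsto_integral_filter_of_dominated_convergence _
    (Eventually.of_forall hmeas) ?_ hdom hlim⟩
  · refine hdom.mono' (aestronglyMeasurable_of_tendsto_ae (𝓝[>] (0 : ℝ)) hmeas hlim) ?_
    filter_upwards [ae_base_ne_zero, hlim] with w hw hl
    refine le_of_tendsto hl.norm ?_
    filter_upwards [self_mem_nhdsWithin] with i hi
    exact hbound i hi w hw
  · filter_upwards [self_mem_nhdsWithin] with i hi
    filter_upwards [ae_base_ne_zero] with w hw
    exact hbound i hi w hw

theorem IsChartFunction.tendsto_reg (hΨ : IsChartFunction M C Ψ) (hμm : Measurable μ)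
    (hμ : ∀ ξ, 0 < μ ξ) (hμ₁ : ∀ ξ, |ξ| ≤ M → μ ξ ≤ m₁) :
    Integrable (fun w => (cube M).indicator (fun w => (2 * |w.2.2|)⁻¹ •
      (fiberFun Ψ w 0 * Real.pi + fiberLimit (6 * M ^ 2) (μ w.2.2) (fiberFun Ψ w))) w) ∧
    Tendsto (fun δ => ∫ w, ∫ z, Ψ (w, z) * regProperTime δ (μ w.2.2) (sOf (w, z))) (𝓝[>] 0)
      (𝓝 (∫ w, (cube M).indicator (fun w => (2 * |w.2.2|)⁻¹ •
        (fiberFun Ψ w 0 * Real.pi + fiberLimit (6 * M ^ 2) (μ w.2.2) (fiberFun Ψ w))) w)) :=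
  hΨ.tendsto_integral_fiber (k := fun δ p => regProperTime δ p.1 p.2)
    (fun δ => measurable_regProperTime δ) hμm
    ((hμ 0).le.trans (hμ₁ 0 (by simpa using hΨ.pos.le)))
    (fun w hw _ hδ _ _ hg => hg.norm_integral_reg_le (hμ _) (hμ₁ _ hw.2.2) hδ)
    fun _ hw hcube => (hΨ.isFiberFunction hw hcube).tendsto_integral_reg (hμ _)

theorem measurable_offCone_density (ε : ℝ) :
    Measurable fun p : ℝ × ℝ => offCone ε (properTimeDensity p.1) p.2 := by
  have h : MeasurableSet {p : ℝ × ℝ | ε < |p.2|} :=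
    measurableSet_lt measurable_const (by fun_prop)
  exact measurable_properTimeDensity.indicator h

theorem IsChartFunction.tendsto_offCone (hΨ : IsChartFunction M C Ψ) (hμm : Measurable μ)
    (hμ : ∀ ξ, 0 < μ ξ) (hμ₁ : ∀ ξ, |ξ| ≤ M → μ ξ ≤ m₁) :
    Integrable (fun w => (cube M).indicator (fun w => (2 * |w.2.2|)⁻¹ •
      fiberLimit (6 * M ^ 2) (μ w.2.2) (fiberFun Ψ w)) w) ∧
    Tendsto (fun ε => ∫ w, ∫ z, Ψ (w, z) * offCone ε (properTimeDensity (μ w.2.2)) (sOf (w, z)))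
      (𝓝[>] 0) (𝓝 (∫ w, (cube M).indicator (fun w => (2 * |w.2.2|)⁻¹ •
        fiberLimit (6 * M ^ 2) (μ w.2.2) (fiberFun Ψ w)) w)) :=
  hΨ.tendsto_integral_fiber (k := fun ε p => offCone ε (properTimeDensity p.1) p.2)
    measurable_offCone_density hμm
    ((hμ 0).le.trans (hμ₁ 0 (by simpa using hΨ.pos.le)))
    (fun w hw _ hε _ _ hg => hg.norm_integral_offCone_le (hμ _) (hμ₁ _ hw.2.2) hε)
    fun _ hw hcube => (hΨ.isFiberFunction hw hcube).tendsto_integral_offCone (hμ _)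

end Volkov

/-! ### The light-cone measure as evaluation of the fibres at s = 0. -/

namespace Volkov

variable {M C : ℝ} {y : Spacetime} {ψ : Spacetime → ℂ}

theorem eq_chart (y x : Spacetime) :
    y + x = chart y ((x.2.1, x.2.2.1, x.1 - x.2.2.2), x.2.2.2) := by
  simp [chart]

theorem continuous_of_chart (h : Continuous fun p => ψ (chart y p)) : Continuous ψ := by
  have e : ψ = fun x => ψ (chart y (((x - y).2.1, (x - y).2.2.1, (x - y).1 - (x - y).2.2.2),
      (x - y).2.2.2)) := by
    ext x; rw [← eq_chart, add_sub_cancel]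
  rw [e]
  exact h.comp (by fun_prop)

/-- Half of the cone density, on the sheet of the sign of `σ`. -/
noncomputable def sheetDensity (y : Spacetime) (ψ : Spacetime → ℂ) (σ : ℝ) (r : ℝ × ℝ × ℝ) : ℂ :=
  (2 * Real.sqrt (r.1 ^ 2 + r.2.1 ^ 2 + r.2.2 ^ 2))⁻¹ •
    ψ (y + (σ * Real.sqrt (r.1 ^ 2 + r.2.1 ^ 2 + r.2.2 ^ 2), r))

theorem coneDensity_eq_sheets (y : Spacetime) (ψ : Spacetime → ℂ) (r : ℝ × ℝ × ℝ) :
    coneDensity y ψ r = sheetDensity y ψ 1 r + sheetDensity y ψ (-1) r := by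
  rw [coneDensity, sheetDensity, sheetDensity, ← smul_add, Complex.real_smul, one_mul, neg_one_mul,
    div_eq_inv_mul, Complex.ofReal_inv]

/-- With r² ≥ x₁² + x₂² ≥ |x₁x₂|, the density 1/r is dominated by the product |x₁|^(−1/2)
|x₂|^(−1/2), integrable on bounded sets. -/
theorem integrable_coneDensity (hΨ : IsChartFunction M C fun p => ψ (chart y p)) :
    Integrable (coneDensity y ψ) := by
  have hψ := (continuous_of_chart hΨ.continuous).measurable
  have hC := hΨ.nonneg
  have hI : Integrable ((Icc (-M) M).indicator (fun x : ℝ => |x| ^ (-(1 / 2) : ℝ))) :=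
    (integrable_indicator_iff measurableSet_Icc).2 (integrable_abs_rpow_Icc (by norm_num) M)
  have h1 : Integrable ((Icc (-M) M).indicator (1 : ℝ → ℝ)) :=
    (integrable_indicator_iff measurableSet_Icc).2 (integrableOn_const (by simp))
  have hdom : Integrable fun r : ℝ × ℝ × ℝ =>
      C * ((Icc (-M) M).indicator (fun x : ℝ => |x| ^ (-(1 / 2) : ℝ)) r.1 *
        ((Icc (-M) M).indicator (fun x : ℝ => |x| ^ (-(1 / 2) : ℝ)) r.2.1 *
        (Icc (-M) M).indicator (1 : ℝ → ℝ) r.2.2)) :=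
    (hI.mul_prod (hI.mul_prod h1)).const_mul C
  refine hdom.mono' ?_ ?_
  · refine Measurable.aestronglyMeasurable ?_
    unfold coneDensity
    fun_prop
  have a1 : ∀ᵐ r : ℝ × ℝ × ℝ, r.1 ≠ 0 :=
    Measure.quasiMeasurePreserving_fst.ae (Measure.ae_ne volume 0)
  have a2 : ∀ᵐ q : ℝ × ℝ, q.1 ≠ 0 :=
    Measure.quasiMeasurePreserving_fst.ae (Measure.ae_ne volume 0)
  have a3 : ∀ᵐ r : ℝ × ℝ × ℝ, r.2.1 ≠ 0 :=
    Measure.quasiMeasurePreserving_snd.ae (p := fun q : ℝ × ℝ => q.1 ≠ 0) a2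
  filter_upwards [a1, a3] with r hr1 hr2
  have p1 := abs_pos.2 hr1
  have p2 := abs_pos.2 hr2
  set R := Real.sqrt (r.1 ^ 2 + r.2.1 ^ 2 + r.2.2 ^ 2) with hR
  have hRle : |r.1| ^ (1 / 2 : ℝ) * |r.2.1| ^ (1 / 2 : ℝ) ≤ R := by
    rw [← Real.sqrt_eq_rpow, ← Real.sqrt_eq_rpow, ← Real.sqrt_mul p1.le]
    refine Real.sqrt_le_sqrt ?_
    nlinarith [sq_abs r.1, sq_abs r.2.1, sq_nonneg (|r.1| - |r.2.1|), sq_nonneg r.2.2,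
      mul_nonneg p1.le p2.le]
  have hR0 : 0 < R := lt_of_lt_of_le (by positivity) hRle
  have hzero : ∀ t : ℝ, ¬(r.1 ∈ Icc (-M) M ∧ r.2.1 ∈ Icc (-M) M ∧ r.2.2 ∈ Icc (-M) M) →
      ψ (y + (t, r)) = 0 := by
    intro t ht
    rw [eq_chart]
    by_cases hz : M < |r.2.2|
    · exact hΨ.zero_of_lt _ _ hz
    · refine hΨ.zero_of_notMem _ _ fun hc => ht ?_
      exact ⟨mem_Icc.2 (abs_le.1 hc.1), mem_Icc.2 (abs_le.1 hc.2.1),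
        mem_Icc.2 (abs_le.1 (not_lt.1 hz))⟩
  have hb : ∀ t : ℝ, ‖ψ (y + (t, r))‖ ≤ C := fun t => by rw [eq_chart]; exact hΨ.bound _
  by_cases hmem : r.1 ∈ Icc (-M) M ∧ r.2.1 ∈ Icc (-M) M ∧ r.2.2 ∈ Icc (-M) M
  · rw [indicator_of_mem hmem.1, indicator_of_mem hmem.2.1, indicator_of_mem hmem.2.2, Pi.one_apply,
      mul_one, coneDensity, norm_div, Complex.norm_real, Real.norm_of_nonneg (by positivity),
      ← hR, div_le_iff₀ (by positivity), Real.rpow_neg p1.le, Real.rpow_neg p2.le, ← mul_inv]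
    refine (norm_add_le _ _).trans ((add_le_add (hb _) (hb _)).trans ?_)
    have : 1 ≤ (|r.1| ^ (1 / 2 : ℝ) * |r.2.1| ^ (1 / 2 : ℝ))⁻¹ * R := by
      rw [inv_mul_eq_div, one_le_div (by positivity)]; exact hRle
    nlinarith
  · rw [coneDensity, hzero _ hmem, hzero _ hmem, add_zero, zero_div, norm_zero]
    refine mul_nonneg hC (mul_nonneg (indicator_nonneg (fun _ _ => by positivity) _)
      (mul_nonneg (indicator_nonneg (fun _ _ => by positivity) _)
        (indicator_nonneg (by simp) _)))

theorem hasDerivAt_zOf_zero (a b : ℝ) {ξ : ℝ} (hξ : ξ ≠ 0) :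
    HasDerivAt (fun ξ => zOf (a, b, ξ) 0) (-(a ^ 2 + b ^ 2 + ξ ^ 2) / (2 * ξ ^ 2)) ξ := by
  have h1 : HasDerivAt (fun ξ : ℝ => 0 + a ^ 2 + b ^ 2 - ξ ^ 2) (-(2 * ξ)) ξ := by
    exact ((hasDerivAt_pow 2 ξ).const_sub (0 + a ^ 2 + b ^ 2)).congr_deriv (by simp)
  have h2 : HasDerivAt (fun ξ : ℝ => 2 * ξ) 2 ξ := by
    simpa using (hasDerivAt_id ξ).const_mul 2
  refine (h1.div h2 (by simpa using hξ)).congr_deriv ?_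
  field_simp
  ring

theorem sqrt_zOf_zero (a b : ℝ) {σ ξ : ℝ} (hσ : σ = 1 ∨ σ = -1) (hξ : 0 < σ * ξ) :
    Real.sqrt (a ^ 2 + b ^ 2 + zOf (a, b, ξ) 0 ^ 2) =
      σ * ((a ^ 2 + b ^ 2 + ξ ^ 2) / (2 * ξ)) := by
  have hξ0 : ξ ≠ 0 := by rintro rfl; simp at hξ
  have hσ2 : σ ^ 2 = 1 := by rcases hσ with rfl | rfl <;> norm_num
  have e : a ^ 2 + b ^ 2 + zOf (a, b, ξ) 0 ^ 2 =
      (σ * ((a ^ 2 + b ^ 2 + ξ ^ 2) / (2 * ξ))) ^ 2 := by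
    rw [mul_pow, hσ2, one_mul]
    simp only [zOf]
    field_simp
    ring
  rw [e, Real.sqrt_sq]
  have : σ * ((a ^ 2 + b ^ 2 + ξ ^ 2) / (2 * ξ)) = (a ^ 2 + b ^ 2 + ξ ^ 2) / (2 * (σ * ξ)) := by
    rcases hσ with rfl | rfl
    · simp
    · simp [div_neg]
  rw [this]
  positivity

/-- On the sheet ct = σr one has ξ = σr − z, and for a ≠ 0 the map ξ ↦ z is a bijection of {σξ > 0}
onto ℝ, since r > |z|. Its derivative has modulus r/|ξ|, hence dξ/(2|ξ|) = dz/(2r). -/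
theorem sheet_change_of_variables {a b σ : ℝ} (hσ : σ = 1 ∨ σ = -1) (ha : a ≠ 0) :
    (IntegrableOn (fun ξ => (2 * |ξ|)⁻¹ • fiberFun (fun p => ψ (chart y p)) (a, b, ξ) 0)
      {ξ | 0 < σ * ξ} ↔ Integrable fun z => sheetDensity y ψ σ (a, b, z)) ∧
    ∫ ξ in {ξ | 0 < σ * ξ}, (2 * |ξ|)⁻¹ • fiberFun (fun p => ψ (chart y p)) (a, b, ξ) 0 =
      ∫ z, sheetDensity y ψ σ (a, b, z) := by
  have hs : MeasurableSet {ξ : ℝ | 0 < σ * ξ} := measurableSet_lt measurable_const (by fun_prop)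
  have hρ : 0 < a ^ 2 + b ^ 2 := by positivity
  have hσ2 : σ * σ = 1 := by rcases hσ with rfl | rfl <;> norm_num
  have hne : ∀ ξ ∈ {ξ : ℝ | 0 < σ * ξ}, ξ ≠ 0 := by
    rintro ξ hξ rfl
    simp at hξ
  have hd : ∀ ξ ∈ {ξ : ℝ | 0 < σ * ξ}, HasDerivWithinAt (fun ξ => zOf (a, b, ξ) 0)
      (-(a ^ 2 + b ^ 2 + ξ ^ 2) / (2 * ξ ^ 2)) {ξ : ℝ | 0 < σ * ξ} ξ :=
    fun ξ hξ => (hasDerivAt_zOf_zero a b (hne ξ hξ)).hasDerivWithinAt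
  have hrec : ∀ ξ ∈ {ξ : ℝ | 0 < σ * ξ},
      ξ = σ * Real.sqrt (a ^ 2 + b ^ 2 + zOf (a, b, ξ) 0 ^ 2) - zOf (a, b, ξ) 0 := by
    intro ξ hξ
    have h0 := hne ξ hξ
    rw [sqrt_zOf_zero a b hσ hξ, ← mul_assoc, hσ2, one_mul]
    simp only [zOf]
    field_simp
    ring
  have hinj : InjOn (fun ξ => zOf (a, b, ξ) 0) {ξ : ℝ | 0 < σ * ξ} := by
    intro ξ hξ ξ' hξ' h
    simp only at h
    rw [hrec ξ hξ, hrec ξ' hξ', h]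
  have himg : (fun ξ => zOf (a, b, ξ) 0) '' {ξ : ℝ | 0 < σ * ξ} = univ := by
    rw [eq_univ_iff_forall]
    intro z
    have hsq := Real.sq_sqrt (show 0 ≤ a ^ 2 + b ^ 2 + z ^ 2 by positivity)
    have hgt : |z| < Real.sqrt (a ^ 2 + b ^ 2 + z ^ 2) := by
      refine Real.lt_sqrt_of_sq_lt ?_
      rw [sq_abs]; linarith
    set R := Real.sqrt (a ^ 2 + b ^ 2 + z ^ 2)
    have hpos : 0 < σ * (σ * R - z) := by
      rw [mul_sub, ← mul_assoc, hσ2, one_mul]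
      rcases hσ with rfl | rfl
      · linarith [le_abs_self z]
      · linarith [neg_abs_le z]
    refine ⟨σ * R - z, hpos, ?_⟩
    have h0 : σ * R - z ≠ 0 := by
      intro h; rw [h] at hpos; simp at hpos
    simp only [zOf]
    rw [div_eq_iff (by simpa using h0)]
    have : (σ * R) ^ 2 = a ^ 2 + b ^ 2 + z ^ 2 := by rw [mul_pow, sq σ, hσ2, one_mul, hsq]
    linear_combination -this
  have hcongr : ∀ ξ ∈ {ξ : ℝ | 0 < σ * ξ},
      |-(a ^ 2 + b ^ 2 + ξ ^ 2) / (2 * ξ ^ 2)| • sheetDensity y ψ σ (a, b, zOf (a, b, ξ) 0) =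
      (2 * |ξ|)⁻¹ • fiberFun (fun p => ψ (chart y p)) (a, b, ξ) 0 := by
    intro ξ hξ
    have h0 := hne ξ hξ
    have habs : |ξ| = σ * ξ := by
      have hξ' : 0 < σ * ξ := hξ
      rcases hσ with rfl | rfl
      · rw [one_mul] at hξ' ⊢; exact abs_of_pos hξ'
      · rw [abs_of_neg (by linarith)]; ring
    have hpos : (0 : ℝ) < σ * ξ := hξ
    simp only [sheetDensity, fiberFun]
    rw [smul_smul, sqrt_zOf_zero a b hσ hξ, ← mul_assoc σ σ, hσ2, one_mul]
    congr 1
    · rw [abs_div, abs_neg, abs_of_pos (by positivity : 0 < a ^ 2 + b ^ 2 + ξ ^ 2),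
        abs_of_pos (by positivity : 0 < 2 * ξ ^ 2), habs]
      have hσ0 : σ ≠ 0 := by rcases hσ with rfl | rfl <;> norm_num
      field_simp
    · congr 1
      rw [eq_chart]
      simp only [zOf]
      congr 4
      field_simp
      ring
  constructor
  · have := integrableOn_image_iff_integrableOn_abs_deriv_smul hs hd hinj
      fun z => sheetDensity y ψ σ (a, b, z)
    rw [himg, integrableOn_univ] at this
    rw [this]
    exact (integrableOn_congr_fun hcongr hs).symm
  · have := integral_image_eq_integral_abs_deriv_smul hs hd hinj
      fun z => sheetDensity y ψ σ (a, b, z)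
    rw [himg, setIntegral_univ] at this
    rw [this]
    exact (setIntegral_congr_fun hs hcongr).symm

theorem integral_coneDensity_fiber {a b : ℝ} (ha : a ≠ 0)
    (hi : Integrable fun ξ => (2 * |ξ|)⁻¹ • fiberFun (fun p => ψ (chart y p)) (a, b, ξ) 0) :
    ∫ z, coneDensity y ψ (a, b, z) =
      ∫ ξ, (2 * |ξ|)⁻¹ • fiberFun (fun p => ψ (chart y p)) (a, b, ξ) 0 := by
  obtain ⟨i1, e1⟩ := sheet_change_of_variables (y := y) (ψ := ψ) (b := b) (Or.inl rfl) ha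
  obtain ⟨i2, e2⟩ := sheet_change_of_variables (y := y) (ψ := ψ) (b := b) (Or.inr rfl) ha
  simp only [coneDensity_eq_sheets]
  rw [integral_add (i1.1 hi.integrableOn) (i2.1 hi.integrableOn), ← e1, ← e2]
  have s1 : {ξ : ℝ | 0 < 1 * ξ} = Ioi 0 := by ext; simp
  have s2 : {ξ : ℝ | 0 < -1 * ξ} = Iio 0 := by ext; simp
  rw [s1, s2, ← integral_Iic_eq_integral_Iio, add_comm,
    intervalIntegral.integral_Iic_add_Ioi hi.integrableOn hi.integrableOn]

/-- Fubini's theorem; the null set a = 0, where the change of variables breaks down, may be left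
out. -/
theorem integral_eq_of_last_variable {F G : ℝ × ℝ × ℝ → ℂ} (hF : Integrable F) (hG : Integrable G)
    (h : ∀ a b : ℝ, a ≠ 0 → Integrable (fun c => G (a, b, c)) →
      ∫ c, F (a, b, c) = ∫ c, G (a, b, c)) :
    ∫ r, F r = ∫ r, G r := by
  have hassoc : MeasurePreserving (fun q : (ℝ × ℝ) × ℝ => (q.1.1, q.1.2, q.2))
    ((volume : Measure (ℝ × ℝ)).prod volume) volume := volume_preserving_prodAssoc
  have hemb : MeasurableEmbedding (fun q : (ℝ × ℝ) × ℝ => (q.1.1, q.1.2, q.2)) :=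
    (MeasurableEquiv.prodAssoc (α := ℝ) (β := ℝ) (γ := ℝ)).measurableEmbedding
  have hF' : Integrable (fun q : (ℝ × ℝ) × ℝ => F (q.1.1, q.1.2, q.2))
    ((volume : Measure (ℝ × ℝ)).prod volume) := (hassoc.integrable_comp_emb hemb).2 hF
  have hG' : Integrable (fun q : (ℝ × ℝ) × ℝ => G (q.1.1, q.1.2, q.2))
    ((volume : Measure (ℝ × ℝ)).prod volume) := (hassoc.integrable_comp_emb hemb).2 hG
  rw [← hassoc.integral_comp hemb F, ← hassoc.integral_comp hemb G, integral_prod _ hF',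
    integral_prod _ hG']
  refine integral_congr_ae ?_
  have a1 : ∀ᵐ q : ℝ × ℝ, q.1 ≠ 0 :=
    Measure.quasiMeasurePreserving_fst.ae (Measure.ae_ne volume 0)
  filter_upwards [a1, hG'.prod_right_ae] with q hq hqi
  exact h q.1 q.2 hq hqi

theorem integral_coneDensity (hΨ : IsChartFunction M C fun p => ψ (chart y p))
    (hi : Integrable fun w : ℝ × ℝ × ℝ =>
      (2 * |w.2.2|)⁻¹ • fiberFun (fun p => ψ (chart y p)) w 0) :
    ∫ r, coneDensity y ψ r =
      ∫ w : ℝ × ℝ × ℝ, (2 * |w.2.2|)⁻¹ • fiberFun (fun p => ψ (chart y p)) w 0 :=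
  integral_eq_of_last_variable (integrable_coneDensity hΨ) hi fun _ _ ha hqi =>
    integral_coneDensity_fiber ha hqi

end Volkov

/-! ### Oscillatory integrals in x₁ and z. -/

namespace Volkov

theorem integrable_of_support_Icc {f : ℝ → ℂ} (hf : Continuous f) {M : ℝ}
    (h0 : ∀ x, M < |x| → f x = 0) : Integrable f := by
  refine hf.integrable_of_hasCompactSupport
    (HasCompactSupport.intro (isCompact_Icc (a := -M) (b := M)) fun x hx => h0 x ?_)
  by_contra! h
  exact hx (mem_Icc.2 (abs_le.1 h))

/-- Second-derivative (van der Corput) estimate for the phase `α x²`. -/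
theorem norm_integral_mul_exp_sq_le {f f' : ℝ → ℂ} {C M α : ℝ} (hf : Continuous f)
    (hf' : Continuous f') (hd : ∀ x, HasDerivAt f (f' x) x) (hM : 0 ≤ M) (hα : 0 < α)
    (hC : ∀ x, ‖f x‖ ≤ C) (hC' : ∀ x, ‖f' x‖ ≤ C) (h0 : ∀ x, M < |x| → f x = 0)
    (h0' : ∀ x, M < |x| → f' x = 0) :
    ‖∫ x, f x * Complex.exp (Complex.I * α * x ^ 2)‖ ≤
      (M + 4 * Real.pi) * C / Real.sqrt α := by
  have hC0 : 0 ≤ C := (norm_nonneg _).trans (hC 0)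
  -- D(x) exp(iαx²) is the derivative of x exp(iαx²). Integrating by parts against f/D works through
  -- the stationary point, since D has no zero.
  set D : ℝ → ℂ := fun x => 1 + 2 * Complex.I * α * x ^ 2 with hD
  have hDn : ∀ x, ‖D x‖ ^ 2 = 1 + 4 * α ^ 2 * x ^ 4 := by
    intro x
    have : D x = ⟨1, 2 * α * x ^ 2⟩ := by
      apply Complex.ext <;> simp [hD, ← Complex.ofReal_pow]
    rw [this, Complex.sq_norm, Complex.normSq_mk]; ring
  have hD0 : ∀ x, D x ≠ 0 := by
    intro x h
    have := hDn x
    rw [h, norm_zero] at this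
    have : 0 ≤ 4 * α ^ 2 * x ^ 4 := by positivity
    linarith
  have hDc : Continuous D := by rw [hD]; fun_prop
  have hDd : ∀ x : ℝ, HasDerivAt D (4 * Complex.I * α * x) x := by
    intro x
    have h1 := (((hasDerivAt_pow 2 (x : ℂ)).comp_ofReal).const_mul (2 * Complex.I * α)).const_add 1
    refine h1.congr_deriv ?_
    push_cast; ring
  set u : ℝ → ℂ := fun x => f x / D x
  set u' : ℝ → ℂ := fun x => (f' x * D x - f x * (4 * Complex.I * α * x)) / D x ^ 2
  set v : ℝ → ℂ := fun x => x * Complex.exp (Complex.I * α * x ^ 2)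
  set v' : ℝ → ℂ := fun x => D x * Complex.exp (Complex.I * α * x ^ 2)
  have hu : ∀ x, HasDerivAt u (u' x) x := fun x => (hd x).div (hDd x) (hD0 x)
  have hv : ∀ x, HasDerivAt v (v' x) x := by
    intro x
    have h1 := (((hasDerivAt_pow 2 (x : ℂ)).comp_ofReal).const_mul (Complex.I * α)).cexp
    have h2 := (Complex.ofRealCLM.hasDerivAt (x := x)).mul h1
    refine h2.congr_deriv ?_
    simp only [Complex.ofRealCLM_apply, v', hD]
    push_cast; ring
  have huc : Continuous u := hf.div hDc hD0
  have hu'c : Continuous u' := by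
    refine Continuous.div (by fun_prop) (by fun_prop) fun x => pow_ne_zero 2 (hD0 x)
  have hvc : Continuous v := by fun_prop
  have hv'c : Continuous v' := by fun_prop
  have hu0 : ∀ x, M < |x| → u x = 0 := fun x hx => by simp [u, h0 x hx]
  have hu'0 : ∀ x, M < |x| → u' x = 0 := fun x hx => by simp [u', h0 x hx, h0' x hx]
  have hparts := integral_mul_deriv_eq_deriv_mul_of_integrable (u := u) (v := v) (u' := u') (v' := v')
    (fun x _ => hu x) (fun x _ => hv x)
    (integrable_of_support_Icc (M := M) (huc.mul hv'c) fun x hx => by simp [hu0 x hx])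
    (integrable_of_support_Icc (M := M) (hu'c.mul hvc) fun x hx => by simp [hu'0 x hx])
    (integrable_of_support_Icc (M := M) (huc.mul hvc) fun x hx => by simp [hu0 x hx])
  have heq : ∀ x : ℝ, f x * Complex.exp (Complex.I * α * x ^ 2) = u x * v' x := by
    intro x
    have := hD0 x
    simp only [u, v']
    field_simp
  simp only [heq]
  rw [hparts, norm_neg]
  have hsα := Real.sqrt_pos.2 hα
  have hs2α : 0 < Real.sqrt (2 * α) := Real.sqrt_pos.2 (by positivity)
  have i1 : Integrable ((Icc (-M) M).indicator fun _ : ℝ => C / (2 * Real.sqrt α)) :=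
    (integrable_indicator_iff measurableSet_Icc).2 (integrableOn_const (by simp))
  have i2 : Integrable fun x : ℝ => 4 * C * (1 + (Real.sqrt (2 * α) * x) ^ 2)⁻¹ :=
    (integrable_inv_one_add_sq.comp_mul_left' hs2α.ne').const_mul _
  have hbound : ∀ x, ‖u' x * v x‖ ≤ (Icc (-M) M).indicator (fun _ : ℝ => C / (2 * Real.sqrt α)) x +
      4 * C * (1 + (Real.sqrt (2 * α) * x) ^ 2)⁻¹ := by
    intro x
    have hvn : ‖v x‖ = |x| := by
      have : Complex.I * α * (x : ℂ) ^ 2 = ((α * x ^ 2 : ℝ) : ℂ) * Complex.I := by push_cast; ring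
      simp only [v]
      rw [norm_mul, this, Complex.norm_exp_ofReal_mul_I, mul_one, Complex.norm_real,
        Real.norm_eq_abs]
    have hDpos : 0 < ‖D x‖ := norm_pos_iff.2 (hD0 x)
    have hx2 : Real.sqrt α ^ 2 = α := Real.sq_sqrt hα.le
    have hxx : |x| ^ 2 = x ^ 2 := sq_abs x
    by_cases hx : M < |x|
    · rw [hu'0 x hx, zero_mul, norm_zero]
      refine add_nonneg (indicator_nonneg (fun _ _ => by positivity) _) (by positivity)
    have hmem : x ∈ Icc (-M) M := mem_Icc.2 (abs_le.1 (not_lt.1 hx))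
    rw [indicator_of_mem hmem]
    -- The f'-term is at most C/(2√α) because |D| ≥ 2√α|x|, and integrates to MC/√α over [−M, M].
    -- The f-term is at most 4C/(1 + 2αx²), whose integral is below 4πC/√α.
    have hsplit : u' x * v x = f' x * v x / D x - f x * (4 * Complex.I * α * x) * v x / D x ^ 2 := by
      have := hD0 x
      simp only [u']
      field_simp
    rw [hsplit]
    refine (norm_sub_le _ _).trans (add_le_add ?_ ?_)
    · rw [norm_div, norm_mul, hvn, div_le_div_iff₀ hDpos (by positivity)]
      have h1 : |x| * (2 * Real.sqrt α) ≤ ‖D x‖ := by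
        apply le_of_sq_le_sq _ hDpos.le
        rw [hDn]
        nlinarith [sq_nonneg (1 - 2 * α * x ^ 2)]
      calc ‖f' x‖ * |x| * (2 * Real.sqrt α) = ‖f' x‖ * (|x| * (2 * Real.sqrt α)) := by ring
        _ ≤ C * ‖D x‖ := mul_le_mul (hC' x) h1 (by positivity) hC0
    · rw [norm_div, norm_mul, norm_mul, norm_pow, hDn, hvn, mul_pow, Real.sq_sqrt (by positivity)]
      have h4 : ‖(4 * Complex.I * α * x : ℂ)‖ = 4 * α * |x| := by
        simp [abs_of_pos hα]
      rw [h4, ← div_eq_mul_inv, div_le_div_iff₀ (by positivity) (by positivity)]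
      have h1 : 4 * α * |x| * |x| * (1 + 2 * α * x ^ 2) ≤ 4 * (1 + 4 * α ^ 2 * x ^ 4) := by
        have : 4 * α * |x| * |x| = 4 * α * x ^ 2 := by rw [← hxx]; ring
        rw [this]
        nlinarith [sq_nonneg (1 - 2 * α * x ^ 2)]
      calc ‖f x‖ * (4 * α * |x|) * |x| * (1 + 2 * α * x ^ 2)
          = ‖f x‖ * (4 * α * |x| * |x| * (1 + 2 * α * x ^ 2)) := by ring
        _ ≤ C * (4 * (1 + 4 * α ^ 2 * x ^ 4)) := mul_le_mul (hC x) h1 (by positivity) hC0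
        _ = _ := by ring
  refine (norm_integral_le_of_norm_le (i1.add i2) (ae_of_all _ hbound)).trans ?_
  simp only [Pi.add_apply]
  rw [integral_add i1 i2, integral_indicator_const _ measurableSet_Icc, integral_const_mul,
    Measure.integral_comp_mul_left (fun x : ℝ => (1 + x ^ 2)⁻¹), integral_univ_inv_one_add_sq,
    Real.volume_real_Icc_of_le (by linarith), abs_of_pos (inv_pos.2 hs2α), smul_eq_mul, smul_eq_mul]
  have h2 : (Real.sqrt (2 * α))⁻¹ ≤ (Real.sqrt α)⁻¹ :=
    inv_anti₀ hsα (Real.sqrt_le_sqrt (by linarith))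
  have hpi := Real.pi_pos
  calc (M - -M) * (C / (2 * Real.sqrt α)) + 4 * C * ((Real.sqrt (2 * α))⁻¹ * Real.pi)
      ≤ (M - -M) * (C / (2 * Real.sqrt α)) + 4 * C * ((Real.sqrt α)⁻¹ * Real.pi) := by gcongr
    _ = _ := by field_simp; ring

/-- The derivatives of a test function in the coordinates of `chart` that the decay of the
proper-time slices needs. -/
structure HasChartDerivs (M C : ℝ) (Ψ Ψz Ψa Ψaz : (ℝ × ℝ × ℝ) × ℝ → ℂ) : Prop where
  continuous : Continuous Ψ
  continuous_z : Continuous Ψz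
  continuous_a : Continuous Ψa
  continuous_az : Continuous Ψaz
  pos : 0 < M
  nonneg : 0 ≤ C
  bound : ∀ p, ‖Ψ p‖ ≤ C
  bound_z : ∀ p, ‖Ψz p‖ ≤ C
  bound_a : ∀ p, ‖Ψa p‖ ≤ C
  bound_az : ∀ p, ‖Ψaz p‖ ≤ C
  zero : ∀ w z, w ∉ cube M ∨ M < |z| →
    Ψ (w, z) = 0 ∧ Ψz (w, z) = 0 ∧ Ψa (w, z) = 0 ∧ Ψaz (w, z) = 0
  deriv_z : ∀ w z, HasDerivAt (fun z => Ψ (w, z)) (Ψz (w, z)) z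
  deriv_a : ∀ a q z, HasDerivAt (fun a => Ψ ((a, q), z)) (Ψa ((a, q), z)) a
  deriv_az : ∀ a q z, HasDerivAt (fun a => Ψz ((a, q), z)) (Ψaz ((a, q), z)) a

theorem norm_exp_neg_I_mul (c z : ℝ) : ‖Complex.exp (-Complex.I * c * z)‖ = 1 := by
  have : -Complex.I * c * z = ((-(c * z) : ℝ) : ℂ) * Complex.I := by push_cast; ring
  rw [this, Complex.norm_exp_ofReal_mul_I]

/-- After exchanging the order the phase in z is a unimodular constant for the inner x-integral; the
z-support then contributes the length 2M. -/
theorem norm_integral_integral_le {G G' : ℝ × ℝ → ℂ} {C M α : ℝ} (hG : Continuous G)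
    (hG' : Continuous G') (hd : ∀ x z, HasDerivAt (fun x => G (x, z)) (G' (x, z)) x) (hM : 0 ≤ M)
    (hα : 0 < α) (hC : ∀ p, ‖G p‖ ≤ C) (hC' : ∀ p, ‖G' p‖ ≤ C)
    (h0 : ∀ x z, M < |x| ∨ M < |z| → G (x, z) = 0)
    (h0' : ∀ x z, M < |x| ∨ M < |z| → G' (x, z) = 0) (c : ℝ) :
    ‖∫ x, (∫ z, G (x, z) * Complex.exp (-Complex.I * c * z)) *
      Complex.exp (Complex.I * α * x ^ 2)‖ ≤
      2 * M * ((M + 4 * Real.pi) * C / Real.sqrt α) := by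
  have hint : Integrable (fun p : ℝ × ℝ => G (p.1, p.2) * Complex.exp (-Complex.I * c * p.2) *
      Complex.exp (Complex.I * α * p.1 ^ 2)) (volume.prod volume) := by
    rw [← Measure.volume_eq_prod]
    refine Continuous.integrable_of_hasCompactSupport (by fun_prop) (HasCompactSupport.intro
      ((isCompact_Icc (a := -M) (b := M)).prod (isCompact_Icc (a := -M) (b := M))) fun p hp => ?_)
    rw [h0 p.1 p.2, zero_mul, zero_mul]
    by_contra! h
    exact hp ⟨mem_Icc.2 (abs_le.1 h.1), mem_Icc.2 (abs_le.1 h.2)⟩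
  simp only [← integral_mul_const]
  rw [integral_integral_swap hint]
  have hinner : ∀ z : ℝ, ‖∫ x, G (x, z) * Complex.exp (-Complex.I * c * z) *
      Complex.exp (Complex.I * α * x ^ 2)‖ ≤
      (Icc (-M) M).indicator (fun _ => (M + 4 * Real.pi) * C / Real.sqrt α) z := by
    intro z
    by_cases hz : M < |z|
    · simp only [h0 _ z (Or.inr hz), zero_mul, integral_zero, norm_zero]
      have hC0 := (norm_nonneg _).trans (hC (0, 0))
      have := Real.pi_pos
      exact indicator_nonneg (fun _ _ => by positivity) _
    · rw [indicator_of_mem (mem_Icc.2 (abs_le.1 (not_lt.1 hz)))]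
      have e : ∀ x : ℝ, G (x, z) * Complex.exp (-Complex.I * c * z) *
          Complex.exp (Complex.I * α * x ^ 2) = Complex.exp (-Complex.I * c * z) *
          (G (x, z) * Complex.exp (Complex.I * α * x ^ 2)) := fun x => by ring
      simp only [e]
      rw [integral_const_mul, norm_mul, norm_exp_neg_I_mul, one_mul]
      exact norm_integral_mul_exp_sq_le (f := fun x => G (x, z)) (f' := fun x => G' (x, z))
        (by fun_prop) (by fun_prop) (fun x => hd x z) hM hα
        (fun x => hC _) (fun x => hC' _) (fun x hx => h0 x z (Or.inl hx))
        (fun x hx => h0' x z (Or.inl hx))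
  refine (norm_integral_le_of_norm_le ?_ (ae_of_all _ hinner)).trans (le_of_eq ?_)
  · exact (integrable_indicator_iff measurableSet_Icc).2 (integrableOn_const (by simp))
  · rw [integral_indicator_const _ measurableSet_Icc, Real.volume_real_Icc_of_le (by linarith),
      smul_eq_mul]
    ring

theorem integral_mul_exp_eq_deriv {f f' : ℝ → ℂ} {M c : ℝ} (hf : Continuous f)
    (hf' : Continuous f') (hd : ∀ z, HasDerivAt f (f' z) z) (hc : c ≠ 0)
    (h0 : ∀ z, M < |z| → f z = 0) (h0' : ∀ z, M < |z| → f' z = 0) :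
    ∫ z, f z * Complex.exp (-Complex.I * c * z) =
      (Complex.I * c)⁻¹ * ∫ z, f' z * Complex.exp (-Complex.I * c * z) := by
  have hIc : (Complex.I * c : ℂ) ≠ 0 := mul_ne_zero Complex.I_ne_zero (by exact_mod_cast hc)
  have hv : ∀ z : ℝ, HasDerivAt (fun z : ℝ => -(Complex.I * c)⁻¹ *
      Complex.exp (-Complex.I * c * z)) (Complex.exp (-Complex.I * c * z)) z := by
    intro z
    have h1 := (((hasDerivAt_id (z : ℂ)).comp_ofReal.const_mul (-Complex.I * c)).cexp).const_mul
      (-(Complex.I * c)⁻¹)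
    refine h1.congr_deriv ?_
    have hc' : (c : ℂ) ≠ 0 := by exact_mod_cast hc
    simp only [id, mul_one]
    field_simp
  have := integral_mul_deriv_eq_deriv_mul_of_integrable (u := f) (u' := f')
    (v := fun z : ℝ => -(Complex.I * c : ℂ)⁻¹ * Complex.exp (-Complex.I * c * z))
    (v' := fun z : ℝ => Complex.exp (-Complex.I * c * z)) (fun x _ => hd x) (fun x _ => hv x)
    (integrable_of_support_Icc (M := M) (hf.mul (by fun_prop)) fun x hx => by simp [h0 x hx])
    (integrable_of_support_Icc (M := M) (hf'.mul (by fun_prop)) fun x hx => by simp [h0' x hx])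
    (integrable_of_support_Icc (M := M) (hf.mul (by fun_prop)) fun x hx => by simp [h0 x hx])
  rw [this, ← integral_neg, ← integral_const_mul]
  congr 1
  ext z
  ring

end Volkov

/-! ### Decay and integrability of the proper-time slices. -/

namespace Volkov

variable {M C : ℝ} {Ψ Ψz Ψa Ψaz : (ℝ × ℝ × ℝ) × ℝ → ℂ} {μ : ℝ → ℝ}

theorem HasChartDerivs.isChartFunction (h : HasChartDerivs M C Ψ Ψz Ψa Ψaz) :
    IsChartFunction M C Ψ where
  continuous := h.continuous
  pos := h.pos
  nonneg := h.nonneg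
  bound := h.bound
  zero_of_notMem w z hw := (h.zero w z (Or.inl hw)).1
  zero_of_lt w z hz := (h.zero w z (Or.inr hz)).1
  lipschitz w z z' := by
    have := Convex.norm_image_sub_le_of_norm_hasDerivWithin_le (s := univ) (C := C)
      (f := fun z => Ψ (w, z)) (f' := fun z => Ψz (w, z))
      (fun x _ => (h.deriv_z w x).hasDerivWithinAt) (fun x _ => h.bound_z _) convex_univ
      (mem_univ z') (mem_univ z)
    simpa using this

theorem cube_eq_prod (M : ℝ) : cube M = Icc (-M) M ×ˢ (Icc (-M) M ×ˢ Icc (-M) M) := by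
  ext w
  simp only [cube, mem_ofPred_eq, mem_prod, mem_Icc, abs_le]

theorem IsChartFunction.hasCompactSupport (h : IsChartFunction M C Ψ) : HasCompactSupport Ψ := by
  refine HasCompactSupport.intro (K := cube M ×ˢ Icc (-M) M) ?_ fun p hp => ?_
  · rw [cube_eq_prod]
    exact (isCompact_Icc.prod (isCompact_Icc.prod isCompact_Icc)).prod isCompact_Icc
  · by_cases hw : p.1 ∈ cube M
    · refine h.zero_of_lt p.1 p.2 ?_
      by_contra! hz
      exact hp ⟨hw, mem_Icc.2 (abs_le.1 hz)⟩
    · exact h.zero_of_notMem p.1 p.2 hw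

theorem IsChartFunction.integrable (h : IsChartFunction M C Ψ) : Integrable Ψ :=
  h.continuous.integrable_of_hasCompactSupport h.hasCompactSupport

/-- The proper-time kernel in the coordinates of `chart`. -/
noncomputable def chartKernel (μ : ℝ → ℝ) (α : ℝ) (p : (ℝ × ℝ × ℝ) × ℝ) : ℂ :=
  Complex.exp (-Complex.I * ((μ p.1.2.2 ^ 2 : ℝ) : ℂ) / (4 * (α : ℂ)) -
    Complex.I * (sOf p : ℂ) * (α : ℂ))

theorem norm_chartKernel (μ : ℝ → ℝ) (α : ℝ) (p : (ℝ × ℝ × ℝ) × ℝ) : ‖chartKernel μ α p‖ = 1 := by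
  have : -Complex.I * ((μ p.1.2.2 ^ 2 : ℝ) : ℂ) / (4 * (α : ℂ)) -
    Complex.I * (sOf p : ℂ) * (α : ℂ) =
      ((-(μ p.1.2.2 ^ 2 / (4 * α)) - sOf p * α : ℝ) : ℂ) * Complex.I := by
    push_cast; ring
  rw [chartKernel, this, Complex.norm_exp_ofReal_mul_I]

theorem measurable_chartKernel (hμ : Measurable μ) :
    Measurable fun q : ℝ × ((ℝ × ℝ × ℝ) × ℝ) => chartKernel μ q.1 q.2 := by
  have := measurable_sOf
  unfold chartKernel
  fun_prop

theorem IsChartFunction.integrable_chartKernel_mul (h : IsChartFunction M C Ψ) (hμ : Measurable μ)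
    (α : ℝ) : Integrable fun p => chartKernel μ α p * Ψ p := by
  refine h.integrable.bdd_mul (c := 1) ?_ (ae_of_all _ fun p => (norm_chartKernel μ α p).le)
  exact ((measurable_chartKernel hμ).comp measurable_prodMk_left).aestronglyMeasurable

/-- The partial integral of a proper-time slice over `z` and `x₁`. -/
noncomputable def planeIntegral (Ψ : (ℝ × ℝ × ℝ) × ℝ → ℂ) (α : ℝ) (q : ℝ × ℝ) : ℂ :=
  ∫ x : ℝ, (∫ z : ℝ, Ψ ((x, q), z) * Complex.exp (-Complex.I * (2 * α * q.2 : ℝ) * z)) *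
    Complex.exp (Complex.I * α * x ^ 2)

theorem HasChartDerivs.zero_plane (h : HasChartDerivs M C Ψ Ψz Ψa Ψaz) (q : ℝ × ℝ) (x z : ℝ)
    (hx : M < |x| ∨ M < |z|) : Ψ ((x, q), z) = 0 ∧ Ψz ((x, q), z) = 0 ∧ Ψa ((x, q), z) = 0 ∧
      Ψaz ((x, q), z) = 0 := by
  refine h.zero _ _ (hx.imp_left fun hx hw => ?_)
  exact absurd hw.1 (not_le.2 hx)

/-- The constant in the decay of `planeIntegral`. -/
noncomputable def planeConst (M C : ℝ) : ℝ := 2 * M * ((M + 4 * Real.pi) * C)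

theorem planeConst_nonneg (hM : 0 ≤ M) (hC : 0 ≤ C) : 0 ≤ planeConst M C := by
  have := Real.pi_pos
  unfold planeConst
  positivity

theorem HasChartDerivs.norm_planeIntegral_le (h : HasChartDerivs M C Ψ Ψz Ψa Ψaz) {α : ℝ}
    (hα : 0 < α) (q : ℝ × ℝ) : ‖planeIntegral Ψ α q‖ ≤ planeConst M C / Real.sqrt α := by
  have h1 := h.continuous
  have h2 := h.continuous_a
  refine (norm_integral_integral_le (G := fun p => Ψ ((p.1, q), p.2))
    (G' := fun p => Ψa ((p.1, q), p.2)) (by fun_prop) (by fun_prop) (fun x z => h.deriv_a x q z)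
    h.pos.le hα (fun p => h.bound _) (fun p => h.bound_a _)
    (fun x z hx => (h.zero_plane q x z hx).1)
    (fun x z hx => (h.zero_plane q x z hx).2.2.1) _).trans (le_of_eq ?_)
  unfold planeConst
  ring

/-- The phase in z is linear with frequency 2αξ, so one integration by parts gains 1/(2α|ξ|) on top
of the stationary phase in x₁. -/
theorem HasChartDerivs.norm_planeIntegral_le_div (h : HasChartDerivs M C Ψ Ψz Ψa Ψaz) {α : ℝ}
    (hα : 0 < α) {q : ℝ × ℝ} (hq : q.2 ≠ 0) :
    ‖planeIntegral Ψ α q‖ ≤ planeConst M C / Real.sqrt α / (2 * α * |q.2|) := by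
  have h0 := h.continuous
  have h1 := h.continuous_z
  have h2 := h.continuous_az
  have hc : 2 * α * q.2 ≠ 0 := by positivity
  have e : planeIntegral Ψ α q =
      (Complex.I * (2 * α * q.2 : ℝ))⁻¹ * planeIntegral Ψz α q := by
    rw [planeIntegral, planeIntegral, ← integral_const_mul]
    refine integral_congr_ae (ae_of_all _ fun x => ?_)
    simp only
    rw [integral_mul_exp_eq_deriv (f := fun z => Ψ ((x, q), z)) (f' := fun z => Ψz ((x, q), z))
      (M := M) (by fun_prop) (by fun_prop) (fun z => h.deriv_z _ z) hc
      (fun z hz => (h.zero_plane q x z (Or.inr hz)).1)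
      (fun z hz => (h.zero_plane q x z (Or.inr hz)).2.1), mul_assoc]
  have hn : ‖(Complex.I * (2 * α * q.2 : ℝ) : ℂ)⁻¹‖ = (2 * α * |q.2|)⁻¹ := by
    rw [norm_inv, norm_mul, Complex.norm_I, one_mul, Complex.norm_real, Real.norm_eq_abs, abs_mul,
      abs_of_pos (by positivity : 0 < 2 * α)]
  rw [e, norm_mul, hn, div_eq_inv_mul]
  refine mul_le_mul_of_nonneg_left ?_ (by positivity)
  refine (norm_integral_integral_le (G := fun p => Ψz ((p.1, q), p.2))
    (G' := fun p => Ψaz ((p.1, q), p.2)) (by fun_prop) (by fun_prop) (fun x z => h.deriv_az x q z)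
    h.pos.le hα (fun p => h.bound_z _) (fun p => h.bound_az _)
    (fun x z hx => (h.zero_plane q x z hx).2.1)
    (fun x z hx => (h.zero_plane q x z hx).2.2.2) _).trans (le_of_eq ?_)
  unfold planeConst
  ring

theorem min_one_inv_le_rpow {x : ℝ} (hx : 0 < x) : min 1 x⁻¹ ≤ x ^ (-(3 / 4) : ℝ) := by
  rcases le_total x 1 with h | h
  · exact (min_le_left _ _).trans (Real.one_le_rpow_of_pos_of_le_one_of_nonpos hx h (by norm_num))
  · refine (min_le_right _ _).trans ?_
    rw [← Real.rpow_neg_one]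
    exact Real.rpow_le_rpow_of_exponent_le h (by norm_num)

/-- Interpolation between the two bounds with exponent 3/4: it exceeds 1/2, so that together with
α^(−1/2) the decay is integrable at infinity, and stays below 1, so that |ξ|^(−3/4) is integrable at
0. -/
theorem HasChartDerivs.norm_planeIntegral_le_rpow (h : HasChartDerivs M C Ψ Ψz Ψa Ψaz) {α : ℝ}
    (hα : 0 < α) {q : ℝ × ℝ} (hq : q.2 ≠ 0) :
    ‖planeIntegral Ψ α q‖ ≤ planeConst M C * α ^ (-(5 / 4) : ℝ) *
      ((Icc (-M) M).indicator 1 q.1 *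
        (Icc (-M) M).indicator (fun ξ => |ξ| ^ (-(3 / 4) : ℝ)) q.2) := by
  have hK := planeConst_nonneg h.pos.le h.nonneg
  by_cases hq' : |q.1| ≤ M ∧ |q.2| ≤ M
  · rw [indicator_of_mem (mem_Icc.2 (abs_le.1 hq'.1)), indicator_of_mem (mem_Icc.2 (abs_le.1 hq'.2)),
      Pi.one_apply, one_mul]
    have hp := abs_pos.2 hq
    have hy : 0 < 2 * α * |q.2| := by positivity
    have b : ‖planeIntegral Ψ α q‖ ≤
        planeConst M C / Real.sqrt α * min 1 (2 * α * |q.2|)⁻¹ := by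
      rw [mul_min_of_nonneg _ _ (by positivity), mul_one, ← div_eq_mul_inv]
      exact le_min (h.norm_planeIntegral_le hα q) (h.norm_planeIntegral_le_div hα hq)
    have e1 : α ^ (-(5 / 4) : ℝ) = (Real.sqrt α)⁻¹ * α ^ (-(3 / 4) : ℝ) := by
      rw [Real.sqrt_eq_rpow, ← Real.rpow_neg hα.le, ← Real.rpow_add hα]; norm_num
    have e2 : (2 * α * |q.2|) ^ (-(3 / 4) : ℝ) ≤ α ^ (-(3 / 4) : ℝ) * |q.2| ^ (-(3 / 4) : ℝ) := by
      rw [← Real.mul_rpow hα.le hp.le]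
      refine Real.rpow_le_rpow_of_nonpos (by positivity) ?_ (by norm_num)
      nlinarith [mul_pos hα hp]
    calc _ ≤ planeConst M C / Real.sqrt α * min 1 (2 * α * |q.2|)⁻¹ := b
      _ ≤ planeConst M C / Real.sqrt α * (α ^ (-(3 / 4) : ℝ) * |q.2| ^ (-(3 / 4) : ℝ)) := by
          gcongr
          exact (min_one_inv_le_rpow hy).trans e2
      _ = _ := by rw [e1]; ring
  · have hz : ∀ x z, Ψ ((x, q), z) = 0 := fun x z =>
      (h.zero _ _ (Or.inl fun hw => hq' hw.2)).1
    simp only [planeIntegral, hz, zero_mul, integral_zero, norm_zero]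
    exact mul_nonneg (by positivity) (mul_nonneg (indicator_nonneg (by simp) _)
      (indicator_nonneg (fun _ _ => by positivity) _))

/-- The parts of the phase that involve the mass, ξ² and x₂² depend on (x₂, ξ) alone and come out as
a unimodular factor. This is why measurability of the mass suffices here. -/
theorem IsChartFunction.integral_chartKernel_mul (h : IsChartFunction M C Ψ) (hμ : Measurable μ)
    (α : ℝ) : ∃ u : ℝ × ℝ → ℂ, (∀ q, ‖u q‖ = 1) ∧
      ∫ p, chartKernel μ α p * Ψ p = ∫ q, u q * planeIntegral Ψ α q := by
  refine ⟨fun q => Complex.exp ((-(μ q.2 ^ 2 / (4 * α)) - (q.2 ^ 2 - q.1 ^ 2) * α : ℝ) * Complex.I),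
    fun q => Complex.norm_exp_ofReal_mul_I _, ?_⟩
  have hi := h.integrable_chartKernel_mul hμ α
  have hi' := hi
  rw [Measure.volume_eq_prod] at hi
  have e1 : ∫ p, chartKernel μ α p * Ψ p =
      ∫ w : ℝ × ℝ × ℝ, ∫ z, chartKernel μ α (w, z) * Ψ (w, z) := integral_prod _ hi
  have hi2 := hi.integral_prod_left
  rw [Measure.volume_eq_prod] at hi2
  rw [e1, Measure.volume_eq_prod ℝ (ℝ × ℝ), integral_prod_symm _ hi2]
  refine integral_congr_ae (ae_of_all _ fun q => ?_)
  simp only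
  rw [planeIntegral, ← integral_const_mul]
  refine integral_congr_ae (ae_of_all _ fun x => ?_)
  simp only
  rw [mul_comm (∫ z, _) (Complex.exp _), ← mul_assoc, ← integral_const_mul]
  refine integral_congr_ae (ae_of_all _ fun z => ?_)
  simp only
  rw [mul_comm (Ψ _) (Complex.exp _), ← mul_assoc, chartKernel, ← Complex.exp_add, ← Complex.exp_add]
  congr 2
  simp only [sOf]
  push_cast
  ring

theorem HasChartDerivs.exists_norm_slice_le (h : HasChartDerivs M C Ψ Ψz Ψa Ψaz)
    (hμ : Measurable μ) :
    ∃ K : ℝ, ∀ α > 0, ‖∫ p, chartKernel μ α p * Ψ p‖ ≤ K * α ^ (-(5 / 4) : ℝ) := by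
  refine ⟨planeConst M C * ∫ q : ℝ × ℝ, (Icc (-M) M).indicator 1 q.1 *
    (Icc (-M) M).indicator (fun ξ => |ξ| ^ (-(3 / 4) : ℝ)) q.2, fun α hα => ?_⟩
  obtain ⟨u, hu, e⟩ := h.isChartFunction.integral_chartKernel_mul hμ α
  have hint : Integrable fun q : ℝ × ℝ => (Icc (-M) M).indicator (1 : ℝ → ℝ) q.1 *
      (Icc (-M) M).indicator (fun ξ => |ξ| ^ (-(3 / 4) : ℝ)) q.2 := by
    refine Integrable.mul_prod (f := (Icc (-M) M).indicator (1 : ℝ → ℝ)) ?_ ?_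
    · exact (integrable_indicator_iff measurableSet_Icc).2 (integrableOn_const (by simp))
    · exact (integrable_indicator_iff measurableSet_Icc).2
        (integrable_abs_rpow_Icc (by norm_num) M)
  have hq0 : ∀ᵐ q : ℝ × ℝ, q.2 ≠ 0 :=
    Measure.quasiMeasurePreserving_snd.ae (Measure.ae_ne volume 0)
  rw [e]
  refine (norm_integral_le_of_norm_le (hint.const_mul (planeConst M C * α ^ (-(5 / 4) : ℝ))) ?_).trans
    (le_of_eq ?_)
  · filter_upwards [hq0] with q hq
    rw [norm_mul, hu, one_mul]
    exact h.norm_planeIntegral_le_rpow hα hq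
  · rw [integral_const_mul]; ring

theorem HasChartDerivs.integrableOn_slice (h : HasChartDerivs M C Ψ Ψz Ψa Ψaz)
    (hμ : Measurable μ) :
    IntegrableOn (fun α => ∫ p, chartKernel μ α p * Ψ p) (Ioi 0) := by
  obtain ⟨K, hK⟩ := h.exists_norm_slice_le hμ
  have hm : StronglyMeasurable fun α => ∫ p, chartKernel μ α p * Ψ p := by
    have h1 := h.continuous.measurable
    have h2 := measurable_chartKernel hμ
    exact StronglyMeasurable.integral_prod_right'
      (f := fun q : ℝ × ((ℝ × ℝ × ℝ) × ℝ) => chartKernel μ q.1 q.2 * Ψ q.2)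
      (Measurable.stronglyMeasurable (by fun_prop))
  have hb : ∀ α, ‖∫ p, chartKernel μ α p * Ψ p‖ ≤ ∫ p, ‖Ψ p‖ := fun α => by
    refine (norm_integral_le_integral_norm _).trans (le_of_eq ?_)
    simp only [norm_mul, norm_chartKernel, one_mul]
  rw [← Ioc_union_Ioi_eq_Ioi (zero_le_one' ℝ)]
  refine IntegrableOn.union ?_ ?_
  · exact Measure.integrableOn_of_bounded (by simp) hm.aestronglyMeasurable
      (ae_of_all _ hb)
  · refine Integrable.mono' ((integrableOn_Ioi_rpow_of_lt (by norm_num : -(5 / 4 : ℝ) < -1)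
      one_pos).const_mul K) hm.aestronglyMeasurable ?_
    filter_upwards [ae_restrict_mem measurableSet_Ioi] with α hα
    exact hK α (lt_trans one_pos hα)

end Volkov

/-! ### Abel summation of the proper-time integral. -/

namespace Volkov

variable {M C m₁ : ℝ} {Ψ Ψz Ψa Ψaz : (ℝ × ℝ × ℝ) × ℝ → ℂ} {μ : ℝ → ℝ}

theorem tendsto_abel {S : ℝ → ℂ} (hS : IntegrableOn S (Ioi 0)) :
    Tendsto (fun δ : ℝ => ∫ α in Ioi (0 : ℝ), Complex.exp (-(δ * α : ℝ)) * S α) (𝓝[>] 0)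
      (𝓝 (∫ α in Ioi (0 : ℝ), S α)) := by
  refine tendsto_integral_filter_of_dominated_convergence (fun α => ‖S α‖) ?_ ?_ hS.norm ?_
  · exact Eventually.of_forall fun δ =>
      (Continuous.aestronglyMeasurable (by fun_prop)).mul hS.aestronglyMeasurable
  · filter_upwards [self_mem_nhdsWithin] with δ hδ
    filter_upwards [ae_restrict_mem measurableSet_Ioi] with α hα
    rw [norm_mul, ← Complex.ofReal_neg, Complex.norm_exp_ofReal]
    refine mul_le_of_le_one_left (norm_nonneg _) (Real.exp_le_one_iff.2 ?_)
    have := mul_pos (mem_Ioi.1 hδ) (mem_Ioi.1 hα)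
    linarith
  · refine ae_of_all _ fun α => ?_
    have : Continuous fun δ : ℝ => Complex.exp (-(δ * α : ℝ)) * S α := by fun_prop
    have h := this.tendsto 0
    simp only [zero_mul, Complex.ofReal_zero, neg_zero, Complex.exp_zero, one_mul] at h
    exact h.mono_left nhdsWithin_le_nhds

/-- With the factor exp(−δα) the double integral converges absolutely, so α may be integrated first.
-/
theorem IsChartFunction.integral_abel (h : IsChartFunction M C Ψ) (hμ : Measurable μ) {δ : ℝ}
    (hδ : 0 < δ) :
    ∫ α in Ioi (0 : ℝ), Complex.exp (-(δ * α : ℝ)) * ∫ p, chartKernel μ α p * Ψ p =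
      ∫ w : ℝ × ℝ × ℝ, ∫ z, Ψ (w, z) * regProperTime δ (μ w.2.2) (sOf (w, z)) := by
  have h1 := h.continuous.measurable
  have h2 := measurable_chartKernel hμ
  have hexp : IntegrableOn (fun α : ℝ => Real.exp (-(δ * α))) (Ioi 0) := by
    simpa only [neg_mul] using exp_neg_integrableOn_Ioi 0 hδ
  have hint : Integrable (fun q : ℝ × ((ℝ × ℝ × ℝ) × ℝ) =>
      Complex.exp (-(δ * q.1 : ℝ)) * (chartKernel μ q.1 q.2 * Ψ q.2))
      ((volume.restrict (Ioi (0 : ℝ))).prod volume) := by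
    refine Integrable.mono' (hexp.mul_prod h.integrable.norm)
      (Measurable.aestronglyMeasurable (by fun_prop)) (ae_of_all _ fun q => ?_)
    rw [norm_mul, norm_mul, norm_chartKernel, one_mul, ← Complex.ofReal_neg,
      Complex.norm_exp_ofReal]
  have hreg : ∀ p : (ℝ × ℝ × ℝ) × ℝ, ∫ α in Ioi (0 : ℝ),
      Complex.exp (-(δ * α : ℝ)) * (chartKernel μ α p * Ψ p) =
      Ψ p * regProperTime δ (μ p.1.2.2) (sOf p) := by
    intro p
    rw [regProperTime, ← integral_const_mul]
    refine integral_congr_ae (ae_of_all _ fun α => ?_)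
    simp only
    rw [← mul_assoc, chartKernel, ← Complex.exp_add, mul_comm]
    congr 2
    push_cast
    ring
  simp only [← integral_const_mul]
  rw [integral_integral_swap hint]
  simp only [hreg]
  have hi := hint.integral_prod_right
  simp only [hreg] at hi
  rw [Measure.volume_eq_prod] at hi
  exact integral_prod _ hi

/-- The Abel means have two limits: the unregularized integral, by integrability of the slices, and
the base integral of the fibre limits. They must agree. -/
theorem HasChartDerivs.integral_slice (h : HasChartDerivs M C Ψ Ψz Ψa Ψaz) (hμm : Measurable μ)
    (hμ : ∀ ξ, 0 < μ ξ) (hμ₁ : ∀ ξ, |ξ| ≤ M → μ ξ ≤ m₁) :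
    ∫ α in Ioi (0 : ℝ), ∫ p, chartKernel μ α p * Ψ p =
      ∫ w, (cube M).indicator (fun w => (2 * |w.2.2|)⁻¹ •
        (fiberFun Ψ w 0 * Real.pi + fiberLimit (6 * M ^ 2) (μ w.2.2) (fiberFun Ψ w))) w := by
  refine tendsto_nhds_unique (tendsto_abel (h.integrableOn_slice hμm)) ?_
  refine (h.isChartFunction.tendsto_reg hμm hμ hμ₁).2.congr' ?_
  filter_upwards [self_mem_nhdsWithin] with δ hδ
  exact (h.isChartFunction.integral_abel hμm hδ).symm

/-- Integrability of the delta term is read off from that of the regularized and the truncated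
limits, whose difference it is up to the factor π. -/
theorem IsChartFunction.fiberFun_zero_split (h : IsChartFunction M C Ψ) (hμm : Measurable μ)
    (hμ : ∀ ξ, 0 < μ ξ) (hμ₁ : ∀ ξ, |ξ| ≤ M → μ ξ ≤ m₁) :
    Integrable (fun w : ℝ × ℝ × ℝ => (2 * |w.2.2|)⁻¹ • fiberFun Ψ w 0) ∧
    ∫ w, (cube M).indicator (fun w => (2 * |w.2.2|)⁻¹ •
        (fiberFun Ψ w 0 * Real.pi + fiberLimit (6 * M ^ 2) (μ w.2.2) (fiberFun Ψ w))) w =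
      Real.pi * (∫ w : ℝ × ℝ × ℝ, (2 * |w.2.2|)⁻¹ • fiberFun Ψ w 0) +
      ∫ w, (cube M).indicator (fun w => (2 * |w.2.2|)⁻¹ •
        fiberLimit (6 * M ^ 2) (μ w.2.2) (fiberFun Ψ w)) w := by
  have hA := (h.tendsto_reg hμm hμ hμ₁).1
  have hB := (h.tendsto_offCone hμm hμ hμ₁).1
  have hpi : (Real.pi : ℂ) ≠ 0 := by exact_mod_cast Real.pi_ne_zero
  have e : ∀ w : ℝ × ℝ × ℝ, (cube M).indicator (fun w => (2 * |w.2.2|)⁻¹ •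
        (fiberFun Ψ w 0 * Real.pi + fiberLimit (6 * M ^ 2) (μ w.2.2) (fiberFun Ψ w))) w -
      (cube M).indicator (fun w => (2 * |w.2.2|)⁻¹ •
        fiberLimit (6 * M ^ 2) (μ w.2.2) (fiberFun Ψ w)) w =
      Real.pi * ((2 * |w.2.2|)⁻¹ • fiberFun Ψ w 0) := by
    intro w
    by_cases hw : w ∈ cube M
    · rw [indicator_of_mem hw, indicator_of_mem hw, ← smul_sub, add_sub_cancel_right,
        mul_comm (fiberFun Ψ w 0), mul_smul_comm]
    · rw [indicator_of_notMem hw, indicator_of_notMem hw, fiberFun, h.zero_of_notMem _ _ hw]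
      simp
  have hi := hA.sub hB
  have hi' : Integrable fun w : ℝ × ℝ × ℝ => (Real.pi : ℂ) * ((2 * |w.2.2|)⁻¹ • fiberFun Ψ w 0) :=
    hi.congr (ae_of_all _ e)
  refine ⟨?_, ?_⟩
  · refine (hi'.const_mul (Real.pi : ℂ)⁻¹).congr (ae_of_all _ fun w => ?_)
    simp only
    rw [inv_mul_cancel_left₀ hpi]
  · rw [← integral_const_mul, ← sub_eq_iff_eq_add, ← integral_sub hA hB]
    exact integral_congr_ae (ae_of_all _ e)

/-- The factor |ξ| compensates the Jacobian 1/(2|ξ|) of the passage from z to s. -/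
theorem integrable_abs_mul_comp_sOf {D : (ℝ × ℝ × ℝ) × ℝ → ℝ} (hD : Measurable D)
    (hi : Integrable D) : Integrable fun p : (ℝ × ℝ × ℝ) × ℝ => |p.1.2.2| * D (p.1, sOf p) := by
  have hs := measurable_sOf
  have hm : Measurable fun p : (ℝ × ℝ × ℝ) × ℝ => |p.1.2.2| * D (p.1, sOf p) := by fun_prop
  rw [Measure.volume_eq_prod] at hi ⊢
  rw [integrable_prod_iff hm.aestronglyMeasurable]
  obtain ⟨i1, i2⟩ := (integrable_prod_iff hD.aestronglyMeasurable).1 hi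
  refine ⟨?_, ?_⟩
  · filter_upwards [i1, ae_base_ne_zero] with w hw hw0
    refine Integrable.const_mul ?_ _
    have := (hw.comp_add_right (w.2.2 ^ 2 - w.1 ^ 2 - w.2.1 ^ 2)).comp_mul_left'
      (R := 2 * w.2.2) (by positivity)
    exact this
  · refine (i2.const_mul 2⁻¹).congr ?_
    filter_upwards [ae_base_ne_zero] with w hw0
    have h1 := Measure.integral_comp_mul_left (fun s => ‖D (w, s + (w.2.2 ^ 2 - w.1 ^ 2 -
      w.2.1 ^ 2))‖) (2 * w.2.2)
    rw [integral_add_right_eq_self (fun s => ‖D (w, s)‖), abs_inv, abs_mul, abs_two,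
      smul_eq_mul] at h1
    simp only [norm_mul, integral_const_mul]
    have h2 : ∫ z, ‖D (w, sOf (w, z))‖ = (2 * |w.2.2|)⁻¹ * ∫ s, ‖D (w, s)‖ := h1
    rw [h2, Real.norm_eq_abs, abs_abs]
    have := abs_pos.2 hw0
    field_simp

end Volkov

/-! ### The kernels in light-cone coordinates and the identity for a mass depending on ξ. -/

namespace Volkov

variable {M C m₁ : ℝ} {Ψ Ψz Ψa Ψaz : (ℝ × ℝ × ℝ) × ℝ → ℂ} {μ : ℝ → ℝ}

/-- The coefficient in the bound of the kernels by a power of the Minkowski square. -/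
noncomputable def mildConst (M m₁ : ℝ) : ℝ :=
  2 * m₁ * (6 * M ^ 2) ^ (1 / 4 : ℝ) + m₁ ^ 2 / 2 * (6 * M ^ 2) ^ (3 / 4 : ℝ)

theorem mildConst_nonneg (M : ℝ) (hm : 0 ≤ m₁) : 0 ≤ mildConst M m₁ := by
  unfold mildConst; positivity

theorem norm_properTimeDensity_sub_le_mildConst {m s : ℝ} (hm : 0 < m) (hm₁ : m ≤ m₁)
    (hs : s ≠ 0) (hsM : |s| ≤ 6 * M ^ 2) :
    ‖properTimeDensity m s - 1 / (Complex.I * s)‖ ≤ mildConst M m₁ * |s| ^ (-(3 / 4) : ℝ) :=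
  (norm_properTimeDensity_add_le hm hs).trans (rpow_mild_le hm.le hm₁ hs hsM)

theorem timelikeDensity_zero (m : ℝ) : timelikeDensity m 0 = 0 := by simp [timelikeDensity]

theorem properTimeDensity_re (m s : ℝ) :
    (properTimeDensity m s).re = -(Real.pi * timelikeDensity m s) := by
  simp only [properTimeDensity, Complex.add_re, Complex.neg_re, Complex.ofReal_re, Complex.mul_re,
    Complex.I_re, Complex.I_im, Complex.ofReal_im]
  ring

/-- Since 1/(is) is purely imaginary, the real part of the estimate for `properTimeDensity` already
bounds the J₁-kernel; the factor π is dropped by π ≥ 1. -/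
theorem abs_timelikeDensity_le {m s : ℝ} (hm : 0 < m) (hm₁ : m ≤ m₁) (hsM : |s| ≤ 6 * M ^ 2) :
    |timelikeDensity m s| ≤ mildConst M m₁ * |s| ^ (-(3 / 4) : ℝ) := by
  have hK := mildConst_nonneg M (hm.le.trans hm₁)
  rcases eq_or_ne s 0 with rfl | hs
  · rw [timelikeDensity_zero, abs_zero]; positivity
  have h1 := Complex.abs_re_le_norm (properTimeDensity m s - 1 / (Complex.I * s))
  have h2 : (1 / (Complex.I * s) : ℂ).re = 0 := by
    have : (1 / (Complex.I * s) : ℂ) = ((-s⁻¹ : ℝ) : ℂ) * Complex.I := by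
      have : (s : ℂ) ≠ 0 := by exact_mod_cast hs
      push_cast
      field_simp
      simp
    rw [this, Complex.re_ofReal_mul, Complex.I_re, mul_zero]
  rw [Complex.sub_re, h2, sub_zero, properTimeDensity_re, abs_neg, abs_mul,
    abs_of_pos Real.pi_pos] at h1
  have h3 := h1.trans (norm_properTimeDensity_sub_le_mildConst hm hm₁ hs hsM)
  have h4 : 1 ≤ Real.pi := by linarith [Real.pi_gt_three]
  nlinarith [abs_nonneg (timelikeDensity m s)]

theorem IsChartFunction.mem_of_ne_zero (h : IsChartFunction M C Ψ) {p : (ℝ × ℝ × ℝ) × ℝ}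
    (hp : Ψ p ≠ 0) : p.1 ∈ cube M ∧ |p.2| ≤ M := by
  constructor
  · by_contra hc; exact hp (h.zero_of_notMem p.1 p.2 hc)
  · by_contra! hc; exact hp (h.zero_of_lt p.1 p.2 hc)

/-- A power of the Minkowski square on the support of the chart functions. -/
noncomputable def mildWeight (M : ℝ) : ℝ → ℝ :=
  (Icc (-(6 * M ^ 2)) (6 * M ^ 2)).indicator fun s => |s| ^ (-(3 / 4) : ℝ)

/-- Domination by `domIntegrand` in the variable s. The available power is |ξ|·|ξ|^(−5/4) =
|ξ|^(−1/4), which is at least M^(−1/4) on the support. -/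
theorem IsChartFunction.integrable_timelike (h : IsChartFunction M C Ψ) (hμm : Measurable μ)
    (hμ : ∀ ξ, 0 < μ ξ) (hμ₁ : ∀ ξ, |ξ| ≤ M → μ ξ ≤ m₁) :
    Integrable fun p => (timelikeDensity (μ p.1.2.2) (sOf p) : ℂ) * Ψ p := by
  have hM := h.pos
  have hC := h.nonneg
  have hk : Measurable (mildWeight M) :=
    Measurable.indicator (by fun_prop) measurableSet_Icc
  have hk0 : ∀ s, 0 ≤ mildWeight M s := fun s => indicator_nonneg (fun _ _ => by positivity) _
  have hki : Integrable (mildWeight M) := (integrable_indicator_iff measurableSet_Icc).2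
    (integrable_abs_rpow_Icc (by norm_num) _)
  have hm₁ : 0 ≤ m₁ := (hμ 0).le.trans (hμ₁ 0 (by simpa using hM.le))
  have hK := mildConst_nonneg M hm₁
  have hdom := (integrable_abs_mul_comp_sOf (measurable_domIntegrand M hk)
    (integrable_domIntegrand hM.le hk hk0 hki)).const_mul (mildConst M m₁ * C * M ^ (1 / 4 : ℝ))
  have hw : ∀ᵐ p : (ℝ × ℝ × ℝ) × ℝ, p.1.2.2 ≠ 0 :=
    Measure.quasiMeasurePreserving_fst.ae ae_base_ne_zero
  refine hdom.mono' ?_ ?_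
  · have h1 := measurable_timelikeDensity
    have h2 := measurable_sOf
    have h3 := h.continuous.measurable
    have h4 : Measurable fun p : (ℝ × ℝ × ℝ) × ℝ => timelikeDensity (μ p.1.2.2) (sOf p) :=
      h1.comp (f := fun p : (ℝ × ℝ × ℝ) × ℝ => (μ p.1.2.2, sOf p)) (by fun_prop)
    exact Measurable.aestronglyMeasurable (by fun_prop)
  filter_upwards [hw] with p hp0
  have hpos := abs_pos.2 hp0
  by_cases hp : Ψ p = 0
  · rw [hp, mul_zero, norm_zero]
    have h1 := hk0 (sOf p)
    have h2 : 0 ≤ (cube M).indicator (1 : ℝ × ℝ × ℝ → ℝ) p.1 := indicator_nonneg (by simp) _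
    have h3 : 0 ≤ (fiberSet M p.1).indicator (1 : ℝ → ℝ) (sOf p) := indicator_nonneg (by simp) _
    unfold domIntegrand
    positivity
  obtain ⟨hc, hz⟩ := h.mem_of_ne_zero hp
  have hs : |sOf p| ≤ 6 * M ^ 2 := abs_sOf_le hc hz
  have hfib : sOf p ∈ fiberSet M p.1 := by
    have : zOf p.1 (sOf p) = p.2 := zOf_sOf hp0 p.2
    rw [fiberSet, mem_ofPred_eq, this]
    exact hz
  simp only [domIntegrand, indicator_of_mem hc, indicator_of_mem hfib, mildWeight,
    indicator_of_mem (mem_Icc.2 (abs_le.1 hs)), Pi.one_apply, one_mul, mul_one]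
  have h1 : |p.1.2.2| * |p.1.2.2| ^ (-(5 / 4) : ℝ) = |p.1.2.2| ^ (-(1 / 4) : ℝ) := by
    nth_rewrite 1 [← Real.rpow_one |p.1.2.2|]
    rw [← Real.rpow_add hpos]; norm_num
  have h2 : 1 ≤ M ^ (1 / 4 : ℝ) * |p.1.2.2| ^ (-(1 / 4) : ℝ) := by
    have : |p.1.2.2| ^ (1 / 4 : ℝ) * |p.1.2.2| ^ (-(1 / 4) : ℝ) = 1 := by
      rw [← Real.rpow_add hpos]; norm_num
    exact this.ge.trans (mul_le_mul_of_nonneg_right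
      (Real.rpow_le_rpow hpos.le hc.2.2 (by norm_num)) (by positivity))
  rw [norm_mul, Complex.norm_real, Real.norm_eq_abs]
  calc |timelikeDensity (μ p.1.2.2) (sOf p)| * ‖Ψ p‖
      ≤ mildConst M m₁ * |sOf p| ^ (-(3 / 4) : ℝ) * C :=
        mul_le_mul (abs_timelikeDensity_le (hμ _) (hμ₁ _ hc.2.2) hs) (h.bound p) (norm_nonneg _)
          (by positivity)
    _ = mildConst M m₁ * C * |sOf p| ^ (-(3 / 4) : ℝ) * 1 := by ring
    _ ≤ mildConst M m₁ * C * |sOf p| ^ (-(3 / 4) : ℝ) *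
          (M ^ (1 / 4 : ℝ) * |p.1.2.2| ^ (-(1 / 4) : ℝ)) := by gcongr
    _ = _ := by rw [← h1]; ring

/-- The region `|x²| > ε` in the coordinates of `chart`. -/
def offConeSet (ε : ℝ) : Set ((ℝ × ℝ × ℝ) × ℝ) := {p | ε < |sOf p|}

theorem measurableSet_offConeSet (ε : ℝ) : MeasurableSet (offConeSet ε) := by
  have := measurable_sOf
  exact measurableSet_lt measurable_const this.norm

theorem offCone_mul_eq_indicator (ε : ℝ) (k : ℝ → ℝ → ℂ) (p : (ℝ × ℝ × ℝ) × ℝ) :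
    Ψ p * offCone ε (k (μ p.1.2.2)) (sOf p) =
      (offConeSet ε).indicator (fun p => k (μ p.1.2.2) (sOf p) * Ψ p) p := by
  by_cases hp : ε < |sOf p|
  · rw [offCone, indicator_of_mem (s := {s : ℝ | ε < |s|}) hp,
      indicator_of_mem (s := offConeSet ε) hp, mul_comm]
  · rw [offCone, indicator_of_notMem (s := {s : ℝ | ε < |s|}) hp,
      indicator_of_notMem (s := offConeSet ε) hp, mul_zero]

theorem IsChartFunction.integrableOn_density (h : IsChartFunction M C Ψ) (hμm : Measurable μ)
    (hμ : ∀ ξ, 0 < μ ξ) (hμ₁ : ∀ ξ, |ξ| ≤ M → μ ξ ≤ m₁) {ε : ℝ} (hε : 0 < ε) :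
    IntegrableOn (fun p => properTimeDensity (μ p.1.2.2) (sOf p) * Ψ p) (offConeSet ε) := by
  have hm₁ : 0 ≤ m₁ := (hμ 0).le.trans (hμ₁ 0 (by simpa using h.pos.le))
  have hK := mildConst_nonneg M hm₁
  have h1 := measurable_properTimeDensity
  have h2 := measurable_sOf
  have h3 := h.continuous.measurable
  have h4 : Measurable fun p : (ℝ × ℝ × ℝ) × ℝ => properTimeDensity (μ p.1.2.2) (sOf p) :=
    h1.comp (f := fun p : (ℝ × ℝ × ℝ) × ℝ => (μ p.1.2.2, sOf p)) (by fun_prop)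
  refine Integrable.mono' (h.integrable.norm.const_mul
    (mildConst M m₁ * ε ^ (-(3 / 4) : ℝ) + ε⁻¹)).integrableOn
    (Measurable.aestronglyMeasurable (by fun_prop)) ?_
  filter_upwards [ae_restrict_mem (measurableSet_offConeSet ε)] with p hpε
  by_cases hp : Ψ p = 0
  · simp [hp]
  obtain ⟨hc, hz⟩ := h.mem_of_ne_zero hp
  have hs : |sOf p| ≤ 6 * M ^ 2 := abs_sOf_le hc hz
  have hs' : ε < |sOf p| := hpε
  have hs0 : sOf p ≠ 0 := abs_pos.1 (hε.trans hs')
  rw [norm_mul]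
  refine mul_le_mul_of_nonneg_right ?_ (norm_nonneg _)
  have e : properTimeDensity (μ p.1.2.2) (sOf p) =
    (properTimeDensity (μ p.1.2.2) (sOf p) - 1 / (Complex.I * sOf p)) +
      1 / (Complex.I * sOf p) := by ring
  rw [e]
  refine (norm_add_le _ _).trans (add_le_add ?_ ?_)
  · refine (norm_properTimeDensity_sub_le_mildConst (hμ _) (hμ₁ _ hc.2.2) hs0 hs).trans ?_
    exact mul_le_mul_of_nonneg_left
      (Real.rpow_le_rpow_of_nonpos hε hs'.le (by norm_num)) hK
  · rw [norm_one_div_I_mul]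
    exact inv_anti₀ hε hs'.le

/-- Lets the kernel Δ⁽¹⁾ inherit its integrability and its principal value from `properTimeDensity`
and the harmless J₁-kernel. -/
theorem delta1Density_eq (m s : ℝ) : (delta1Density m s : ℂ) =
    (2 * Real.pi ^ 2 * Complex.I)⁻¹ *
      (properTimeDensity m s + Real.pi * (timelikeDensity m s : ℂ)) := by
  have hpi : (Real.pi : ℂ) ≠ 0 := by exact_mod_cast Real.pi_ne_zero
  have hI := Complex.I_ne_zero
  simp only [properTimeDensity]
  push_cast
  field_simp
  ring

theorem IsChartFunction.integrableOn_delta1 (h : IsChartFunction M C Ψ) (hμm : Measurable μ)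
    (hμ : ∀ ξ, 0 < μ ξ) (hμ₁ : ∀ ξ, |ξ| ≤ M → μ ξ ≤ m₁) {ε : ℝ} (hε : 0 < ε) :
    IntegrableOn (fun p => (delta1Density (μ p.1.2.2) (sOf p) : ℂ) * Ψ p) (offConeSet ε) := by
  refine (((h.integrableOn_density hμm hμ hμ₁ hε).add
    ((h.integrable_timelike hμm hμ hμ₁).integrableOn.const_mul (Real.pi : ℂ))).const_mul
    (2 * Real.pi ^ 2 * Complex.I : ℂ)⁻¹).congr (ae_of_all _ fun p => ?_)
  simp only [Pi.add_apply]
  rw [delta1Density_eq]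
  ring

theorem IsChartFunction.setIntegral_delta1 (h : IsChartFunction M C Ψ) (hμm : Measurable μ)
    (hμ : ∀ ξ, 0 < μ ξ) (hμ₁ : ∀ ξ, |ξ| ≤ M → μ ξ ≤ m₁) {ε : ℝ} (hε : 0 < ε) :
    ∫ p in offConeSet ε, (delta1Density (μ p.1.2.2) (sOf p) : ℂ) * Ψ p =
      (2 * Real.pi ^ 2 * Complex.I : ℂ)⁻¹ *
        ((∫ w, ∫ z, Ψ (w, z) * offCone ε (properTimeDensity (μ w.2.2)) (sOf (w, z))) +
          Real.pi * ∫ p in offConeSet ε, (timelikeDensity (μ p.1.2.2) (sOf p) : ℂ) * Ψ p) := by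
  have i1 := h.integrableOn_density hμm hμ hμ₁ hε
  have i2 := (h.integrable_timelike hμm hμ hμ₁).integrableOn (s := offConeSet ε)
  have i3 : Integrable (fun p => Ψ p * offCone ε (properTimeDensity (μ p.1.2.2)) (sOf p)) :=
    (i1.integrable_indicator (measurableSet_offConeSet ε)).congr (ae_of_all _ fun p =>
      (offCone_mul_eq_indicator ε properTimeDensity p).symm)
  have e : ∫ w : ℝ × ℝ × ℝ, ∫ z, Ψ (w, z) * offCone ε (properTimeDensity (μ w.2.2)) (sOf (w, z)) =
      ∫ p in offConeSet ε, properTimeDensity (μ p.1.2.2) (sOf p) * Ψ p := by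
    rw [← integral_indicator (measurableSet_offConeSet ε)]
    simp only [← offCone_mul_eq_indicator ε properTimeDensity]
    rw [Measure.volume_eq_prod] at i3
    exact (integral_prod _ i3).symm
  rw [e, ← integral_const_mul (Real.pi : ℂ), ← integral_add i1 (i2.const_mul _),
    ← integral_const_mul]
  refine integral_congr_ae (ae_of_all _ fun p => ?_)
  simp only
  rw [delta1Density_eq]
  ring

theorem tendsto_setIntegral_timelike
    (hi : Integrable fun p => (timelikeDensity (μ p.1.2.2) (sOf p) : ℂ) * Ψ p) :
    Tendsto (fun ε => ∫ p in offConeSet ε, (timelikeDensity (μ p.1.2.2) (sOf p) : ℂ) * Ψ p)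
      (𝓝[>] 0) (𝓝 (∫ p, (timelikeDensity (μ p.1.2.2) (sOf p) : ℂ) * Ψ p)) := by
  simp only [← integral_indicator (measurableSet_offConeSet _)]
  refine tendsto_integral_filter_of_dominated_convergence _ ?_ ?_ hi.norm ?_
  · exact Eventually.of_forall fun ε =>
      hi.aestronglyMeasurable.indicator (measurableSet_offConeSet ε)
  · exact Eventually.of_forall fun ε => ae_of_all _ fun p => norm_indicator_le_norm_self _ _
  · refine ae_of_all _ fun p => tendsto_const_nhds.congr' ?_
    rcases eq_or_ne (sOf p) 0 with hs | hs
    -- On the cone itself the density is 0 by convention, so convergence holds there as well.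
    · refine Eventually.of_forall fun ε => ?_
      simp only [indicator, hs, timelikeDensity_zero, Complex.ofReal_zero, zero_mul, ite_self]
    · have : ∀ᶠ ε in 𝓝 (0 : ℝ), ε < |sOf p| := gt_mem_nhds (abs_pos.2 hs)
      filter_upwards [nhdsWithin_le_nhds this] with ε hε
      exact (indicator_of_mem (s := offConeSet ε) hε
        fun p => (timelikeDensity (μ p.1.2.2) (sOf p) : ℂ) * Ψ p).symm

theorem IsChartFunction.tendsto_delta1 (h : IsChartFunction M C Ψ) (hμm : Measurable μ)
    (hμ : ∀ ξ, 0 < μ ξ) (hμ₁ : ∀ ξ, |ξ| ≤ M → μ ξ ≤ m₁) :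
    Tendsto (fun ε => ∫ p in offConeSet ε, (delta1Density (μ p.1.2.2) (sOf p) : ℂ) * Ψ p)
      (𝓝[>] 0) (𝓝 ((2 * Real.pi ^ 2 * Complex.I : ℂ)⁻¹ *
        ((∫ w, (cube M).indicator (fun w => (2 * |w.2.2|)⁻¹ •
          fiberLimit (6 * M ^ 2) (μ w.2.2) (fiberFun Ψ w)) w) +
          Real.pi * ∫ p, (timelikeDensity (μ p.1.2.2) (sOf p) : ℂ) * Ψ p))) := by
  have h1 := (h.tendsto_offCone hμm hμ hμ₁).2
  have h2 := tendsto_setIntegral_timelike (h.integrable_timelike hμm hμ hμ₁)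
  refine ((h1.add (h2.const_mul _)).const_mul _).congr' ?_
  filter_upwards [self_mem_nhdsWithin] with ε hε
  exact (h.setIntegral_delta1 hμm hμ hμ₁ hε).symm

variable {y : Spacetime} {ψ : Spacetime → ℂ} {msq κ : Spacetime → ℝ}

theorem properTimeKernel_chart (hmsq : ∀ p, msq (chart y p) = μ p.1.2.2 ^ 2) (α : ℝ)
    (p : (ℝ × ℝ × ℝ) × ℝ) : properTimeKernel msq y α (chart y p) = chartKernel μ α p := by
  rw [properTimeKernel, chartKernel, hmsq, minkSq_chart]
  rfl

theorem integral_chart (f : Spacetime → ℂ) : ∫ p, f (chart y p) = ∫ x, f x :=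
  (measurePreserving_chart y).integral_comp (measurableEmbedding_chart y) f

theorem integrable_chart {f : Spacetime → ℂ} :
    Integrable (fun p => f (chart y p)) ↔ Integrable f :=
  (measurePreserving_chart y).integrable_comp_emb (measurableEmbedding_chart y)

theorem preimage_chart_offCone (ε : ℝ) :
    chart y ⁻¹' {x' | ε < |minkSq (x' - y)|} = offConeSet ε := by
  ext p
  rw [mem_preimage, mem_ofPred_eq, minkSq_chart]
  rfl

theorem properTimeSlice_eq (hmsq : ∀ p, msq (chart y p) = μ p.1.2.2 ^ 2) (α : ℝ) :
    properTimeSlice msq y ψ α = ∫ p, chartKernel μ α p * ψ (chart y p) := by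
  rw [properTimeSlice, ← integral_chart (y := y)]
  simp only [properTimeKernel_chart hmsq]

/-- The pairing of the proper-time integral with a test function in terms of the causal function,
for a mass that depends on `ξ` only. -/
theorem properTimeIntegral_eq (h : HasChartDerivs M C (fun p => ψ (chart y p)) Ψz Ψa Ψaz)
    (hμc : Continuous μ) (hμ : ∀ ξ, 0 < μ ξ) (hmsq : ∀ p, msq (chart y p) = μ p.1.2.2 ^ 2)
    (hκ : ∀ p, κ (chart y p) = μ p.1.2.2) :
    ProperTimePairingExists msq y ψ ∧ CausalPairingExists κ y ψ ∧
      properTimeIntegral msq y ψ =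
        Real.pi * bracket κ y ψ + 2 * Real.pi ^ 2 * Complex.I * delta1 κ y ψ := by
  have hf := h.isChartFunction
  have hμm := hμc.measurable
  obtain ⟨m₁, hμ₁⟩ : ∃ m₁, ∀ ξ, |ξ| ≤ M → μ ξ ≤ m₁ := by
    obtain ⟨m₁, hm⟩ := (isCompact_Icc (a := -M) (b := M)).bddAbove_image hμc.continuousOn
    exact ⟨m₁, fun ξ hξ => hm ⟨ξ, mem_Icc.2 (abs_le.1 hξ), rfl⟩⟩
  have hpi : (Real.pi : ℂ) ≠ 0 := by exact_mod_cast Real.pi_ne_zero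
  have hT : ∀ p, (timelikeKernel (κ (chart y p)) (chart y p - y) : ℂ) * ψ (chart y p) =
      (timelikeDensity (μ p.1.2.2) (sOf p) : ℂ) * ψ (chart y p) := fun p => by
    rw [timelikeKernel, hκ, minkSq_chart]; rfl
  have hD : ∀ p, (delta1Kernel (κ (chart y p)) (chart y p - y) : ℂ) * ψ (chart y p) =
      (delta1Density (μ p.1.2.2) (sOf p) : ℂ) * ψ (chart y p) := fun p => by
    rw [delta1Kernel, hκ, minkSq_chart]; rfl
  have hIT : Integrable (fun x' : Spacetime => (timelikeKernel (κ x') (x' - y) : ℂ) * ψ x') := by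
    rw [← integrable_chart (y := y)]
    simp only [hT]
    exact hf.integrable_timelike hμm hμ hμ₁
  have htrunc : ∀ ε, delta1Trunc κ y ψ ε =
      ∫ p in offConeSet ε, (delta1Density (μ p.1.2.2) (sOf p) : ℂ) * ψ (chart y p) := fun ε => by
    rw [delta1Trunc, ← (measurePreserving_chart y).setIntegral_preimage_emb
      (measurableEmbedding_chart y), preimage_chart_offCone]
    simp only [hD]
  have hlim := hf.tendsto_delta1 hμm hμ hμ₁
  simp only [← htrunc] at hlim
  -- Existence of the limit is what identifies the `limUnder` in `delta1` with it.
  have hδ := hlim.limUnder_eq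
  change delta1 κ y ψ = _ at hδ
  have hsplit := hf.fiberFun_zero_split hμm hμ hμ₁
  refine ⟨⟨fun α _ => ?_, ?_⟩, ⟨integrable_coneDensity hf, hIT, fun ε hε => ?_, ?_⟩, ?_⟩
  · rw [← integrable_chart (y := y)]
    simp only [properTimeKernel_chart hmsq]
    exact hf.integrable_chartKernel_mul hμm α
  · simp only [funext (properTimeSlice_eq (ψ := ψ) hmsq)]
    exact h.integrableOn_slice hμm
  · rw [← (measurePreserving_chart y).integrableOn_comp_preimage (measurableEmbedding_chart y),
      preimage_chart_offCone]
    simp only [Function.comp_def, hD]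
    exact hf.integrableOn_delta1 hμm hμ hμ₁ hε
  · rw [hδ]; exact hlim
  · rw [hδ, properTimeIntegral]
    simp only [properTimeSlice_eq (ψ := ψ) hmsq]
    rw [h.integral_slice hμm hμ hμ₁, hsplit.2, bracket, integral_coneDensity hf hsplit.1,
      ← integral_chart (y := y) (f := fun x' => (timelikeKernel (κ x') (x' - y) : ℂ) * ψ x')]
    simp only [hT]
    have hI := Complex.I_ne_zero
    field_simp
    ring

end Volkov

/-! ### The shifted mass, the gauge factor and phased test functions. -/

namespace Volkov

/-- The mean value of `f` over the segment from `a` to `a + ξ`. -/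
noncomputable def segmentMean (f : ℝ → ℝ) (a ξ : ℝ) : ℝ := ∫ s in (0 : ℝ)..1, f (a + s * ξ)

/-- Unlike `mean`, which takes the value 0 at coincident end points, this form of the average is
continuous through ξ = 0. -/
theorem continuous_segmentMean {f : ℝ → ℝ} (hf : Continuous f) (a : ℝ) :
    Continuous (segmentMean f a) :=
  intervalIntegral.continuous_parametric_intervalIntegral_of_continuous'
    (f := fun ξ s => f (a + s * ξ)) (by fun_prop) 0 1

theorem mean_eq_segmentMean (f : ℝ → ℝ) {a b : ℝ} (h : b ≠ a) :
    mean f a b = segmentMean f a (b - a) := by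
  have hba : b - a ≠ 0 := sub_ne_zero.2 h
  have h1 := intervalIntegral.smul_integral_comp_add_mul (a := 0) (b := 1) f (b - a) a
  simp only [mul_zero, add_zero, mul_one, add_sub_cancel, smul_eq_mul] at h1
  rw [mean, ← h1, inv_mul_cancel_left₀ hba, segmentMean]
  simp only [mul_comm]

theorem mean_self (f : ℝ → ℝ) (a : ℝ) : mean f a a = 0 := by simp [mean]

theorem segmentMean_zero (f : ℝ → ℝ) (a : ℝ) : segmentMean f a 0 = f a := by simp [segmentMean]

/-- Nonnegativity of the variance of f over the segment. -/
theorem sq_segmentMean_le {f : ℝ → ℝ} (hf : Continuous f) (a ξ : ℝ) :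
    segmentMean f a ξ ^ 2 ≤ segmentMean (fun s => f s ^ 2) a ξ := by
  set c := segmentMean f a ξ with hc
  have h0 : 0 ≤ ∫ s in (0 : ℝ)..1, (f (a + s * ξ) - c) ^ 2 :=
    intervalIntegral.integral_nonneg zero_le_one fun _ _ => sq_nonneg _
  have i : ∀ g : ℝ → ℝ, Continuous g → IntervalIntegrable g volume 0 1 :=
    fun g hg => hg.intervalIntegrable 0 1
  have e : ∫ s in (0 : ℝ)..1, (f (a + s * ξ) - c) ^ 2 =
      (∫ s in (0 : ℝ)..1, f (a + s * ξ) ^ 2) - 2 * c * (∫ s in (0 : ℝ)..1, f (a + s * ξ)) +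
        c ^ 2 := by
    have e1 : ∀ s : ℝ, (f (a + s * ξ) - c) ^ 2 =
        f (a + s * ξ) ^ 2 - 2 * c * f (a + s * ξ) + c ^ 2 := fun s => by ring
    simp only [e1]
    rw [intervalIntegral.integral_add (i _ (by fun_prop)) (i _ (by fun_prop)),
      intervalIntegral.integral_sub (i _ (by fun_prop)) (i _ (by fun_prop)),
      intervalIntegral.integral_const_mul, intervalIntegral.integral_const]
    simp
  rw [e] at h0
  change 0 ≤ segmentMean (fun s => f s ^ 2) a ξ - 2 * c * c + c ^ 2 at h0
  linarith

/-- At ξ' = ξ'' every `mean` is 0 and every average is a point value; either way the corrections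
cancel and k₀² remains. -/
theorem massSq_eq (A₁ A₂ : ℝ → ℝ) (k₀ ξ' ξ'' : ℝ) :
    massSq A₁ A₂ k₀ ξ' ξ'' =
      k₀ ^ 2 + segmentMean (fun s => A₁ s ^ 2 + A₂ s ^ 2) ξ'' (ξ' - ξ'') -
        (segmentMean A₁ ξ'' (ξ' - ξ'') ^ 2 + segmentMean A₂ ξ'' (ξ' - ξ'') ^ 2) := by
  rw [massSq]
  rcases eq_or_ne ξ' ξ'' with rfl | h
  · simp only [mean_self, sub_self, segmentMean_zero]
    ring
  · simp only [mean_eq_segmentMean _ h]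

theorem sq_le_massSq {A₁ A₂ : ℝ → ℝ} (hA₁ : Continuous A₁) (hA₂ : Continuous A₂)
    (k₀ ξ' ξ'' : ℝ) : k₀ ^ 2 ≤ massSq A₁ A₂ k₀ ξ' ξ'' := by
  rw [massSq_eq]
  have h1 := sq_segmentMean_le hA₁ ξ'' (ξ' - ξ'')
  have h2 := sq_segmentMean_le hA₂ ξ'' (ξ' - ξ'')
  have h3 : segmentMean (fun s => A₁ s ^ 2 + A₂ s ^ 2) ξ'' (ξ' - ξ'') =
      segmentMean (fun s => A₁ s ^ 2) ξ'' (ξ' - ξ'') +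
        segmentMean (fun s => A₂ s ^ 2) ξ'' (ξ' - ξ'') :=
    intervalIntegral.integral_add (Continuous.intervalIntegrable (by fun_prop) 0 1)
      (Continuous.intervalIntegrable (by fun_prop) 0 1)
  linarith

theorem continuous_massSq {A₁ A₂ : ℝ → ℝ} (hA₁ : Continuous A₁) (hA₂ : Continuous A₂)
    (k₀ ξ'' : ℝ) : Continuous fun ξ => massSq A₁ A₂ k₀ (ξ'' + ξ) ξ'' := by
  simp only [massSq_eq, add_sub_cancel_left]
  have h1 := continuous_segmentMean hA₁ ξ''
  have h2 := continuous_segmentMean hA₂ ξ''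
  have h3 := continuous_segmentMean (f := fun s => A₁ s ^ 2 + A₂ s ^ 2) (by fun_prop) ξ''
  fun_prop

/-- ξ is affine along the straight segment, so the line integral is an average over [ξ'', ξ']. The
formula includes ξ' = ξ''. -/
theorem gaugeFactor_eq {A₁ A₂ : ℝ → ℝ} (hA₁ : Continuous A₁) (hA₂ : Continuous A₂)
    (x' x'' : Spacetime) :
    gaugeFactor A₁ A₂ x' x'' = Complex.exp (-Complex.I *
      (((x' - x'').2.1 * segmentMean A₁ (xi x'') (xi x' - xi x'') +
        (x' - x'').2.2.1 * segmentMean A₂ (xi x'') (xi x' - xi x'') : ℝ) : ℂ)) := by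
  have e : ∀ s : ℝ, xi (x'' + s • (x' - x'')) = xi x'' + s * (xi x' - xi x'') := fun s => by
    simp only [xi, Prod.fst_add, Prod.snd_add, Prod.smul_fst, Prod.smul_snd, Prod.fst_sub,
      Prod.snd_sub, smul_eq_mul]
    ring
  rw [gaugeFactor]
  simp only [e]
  rw [intervalIntegral.integral_add (Continuous.intervalIntegrable (by fun_prop) 0 1)
      (Continuous.intervalIntegrable (by fun_prop) 0 1), intervalIntegral.integral_const_mul,
    intervalIntegral.integral_const_mul]
  rfl

theorem gaugeFactor_eq_volkovPhase {A₁ A₂ : ℝ → ℝ} (hA₁ : Continuous A₁) (hA₂ : Continuous A₂)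
    {x' x'' : Spacetime} (h : xi x' ≠ xi x'') :
    gaugeFactor A₁ A₂ x' x'' = volkovPhase A₁ A₂ x' x'' := by
  rw [gaugeFactor_eq hA₁ hA₂, volkovPhase, mean_eq_segmentMean _ h, mean_eq_segmentMean _ h]

theorem xi_chart (y : Spacetime) (p : (ℝ × ℝ × ℝ) × ℝ) : xi (chart y p) = xi y + p.1.2.2 := by
  simp only [xi, chart, Prod.fst_add, Prod.snd_add]
  ring

/-- A test function times the phase of a potential that depends on `ξ` only. -/
noncomputable def phased (P Q : ℝ → ℝ) (y : Spacetime) (Φ : Spacetime → ℂ)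
    (p : (ℝ × ℝ × ℝ) × ℝ) : ℂ :=
  Complex.exp (-Complex.I * ((p.1.1 * P p.1.2.2 + p.1.2.1 * Q p.1.2.2 : ℝ) : ℂ)) * Φ (chart y p)

theorem continuous_phased {P Q : ℝ → ℝ} (hP : Continuous P) (hQ : Continuous Q) (y : Spacetime)
    {Φ : Spacetime → ℂ} (hΦ : Continuous Φ) : Continuous (phased P Q y Φ) := by
  have := continuous_chart y
  unfold phased
  fun_prop

theorem hasDerivAt_chart_z (y : Spacetime) (w : ℝ × ℝ × ℝ) (z : ℝ) :
    HasDerivAt (fun z => chart y (w, z)) (1, 0, 0, 1) z := by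
  have h1 : HasDerivAt (fun z : ℝ => (w.2.2 + z, w.1, w.2.1, z)) (1, 0, 0, 1) z :=
    ((hasDerivAt_id z).const_add w.2.2).prodMk
      ((hasDerivAt_const z w.1).prodMk ((hasDerivAt_const z w.2.1).prodMk (hasDerivAt_id z)))
  exact h1.const_add y

theorem hasDerivAt_chart_a (y : Spacetime) (a : ℝ) (q : ℝ × ℝ) (z : ℝ) :
    HasDerivAt (fun a => chart y ((a, q), z)) (0, 1, 0, 0) a := by
  have h1 : HasDerivAt (fun a : ℝ => (q.2 + z, a, q.1, z)) (0, 1, 0, 0) a :=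
    (hasDerivAt_const a (q.2 + z)).prodMk
      ((hasDerivAt_id a).prodMk ((hasDerivAt_const a q.1).prodMk (hasDerivAt_const a z)))
  exact h1.const_add y

/-- At fixed ξ the phase does not depend on z, so no derivative falls on the potential. -/
theorem hasDerivAt_phased_z (P Q : ℝ → ℝ) (y : Spacetime) {Φ : Spacetime → ℂ}
    (hΦ : Differentiable ℝ Φ) (w : ℝ × ℝ × ℝ) (z : ℝ) :
    HasDerivAt (fun z => phased P Q y Φ (w, z))
      (phased P Q y (fun x => fderiv ℝ Φ x (1, 0, 0, 1)) (w, z)) z :=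
  ((hΦ (chart y (w, z))).hasFDerivAt.comp_hasDerivAt z (hasDerivAt_chart_z y w z)).const_mul
    (Complex.exp (-Complex.I * ((w.1 * P w.2.2 + w.2.1 * Q w.2.2 : ℝ) : ℂ)))

/-- The phase is linear in x₁, so differentiation only brings down the coefficient P(ξ), for which
continuity is enough. -/
theorem hasDerivAt_phased_a (P Q : ℝ → ℝ) (y : Spacetime) {Φ : Spacetime → ℂ}
    (hΦ : Differentiable ℝ Φ) (a : ℝ) (q : ℝ × ℝ) (z : ℝ) :
    HasDerivAt (fun a => phased P Q y Φ ((a, q), z))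
      (-Complex.I * P q.2 * phased P Q y Φ ((a, q), z) +
        phased P Q y (fun x => fderiv ℝ Φ x (0, 1, 0, 0)) ((a, q), z)) a := by
  have h1 := (hΦ (chart y ((a, q), z))).hasFDerivAt.comp_hasDerivAt a (hasDerivAt_chart_a y a q z)
  have h2 : HasDerivAt (fun a : ℝ => a * P q.2 + q.1 * Q q.2) (P q.2) a := by
    simpa using ((hasDerivAt_id a).mul_const (P q.2)).add_const (q.1 * Q q.2)
  have h3 := (h2.ofReal_comp.const_mul (-Complex.I)).cexp
  refine (h3.mul h1).congr_deriv ?_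
  simp only [phased, Function.comp_apply]
  ring

theorem exists_hasChartDerivs {P Q : ℝ → ℝ} (hP : Continuous P) (hQ : Continuous Q)
    (y : Spacetime) {Φ : Spacetime → ℂ} (hΦ : ContDiff ℝ ∞ Φ) (hc : HasCompactSupport Φ) :
    ∃ M C Ψz Ψa Ψaz, HasChartDerivs M C (phased P Q y Φ) Ψz Ψa Ψaz := by
  set Φz : Spacetime → ℂ := fun x => fderiv ℝ Φ x (1, 0, 0, 1) with hΦz
  have cz : ContDiff ℝ ∞ Φz := (hΦ.fderiv_right (m := ∞) (by simp)).clm_apply contDiff_const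
  set Φa : Spacetime → ℂ := fun x => fderiv ℝ Φ x (0, 1, 0, 0) with hΦa
  have ca : ContDiff ℝ ∞ Φa := (hΦ.fderiv_right (m := ∞) (by simp)).clm_apply contDiff_const
  set Φaz : Spacetime → ℂ := fun x => fderiv ℝ Φz x (0, 1, 0, 0) with hΦaz
  have caz : ContDiff ℝ ∞ Φaz := (cz.fderiv_right (m := ∞) (by simp)).clm_apply contDiff_const
  have s0 : ∀ x, x ∉ tsupport Φ → Φ x = 0 := fun x => image_eq_zero_of_notMem_tsupport
  have hfd : ∀ (F : Spacetime → ℂ) (v : Spacetime), tsupport F ⊆ tsupport Φ →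
      tsupport (fun x => fderiv ℝ F x v) ⊆ tsupport Φ := fun F v hF =>
    (tsupport_fderiv_apply_subset ℝ v).trans hF
  have tz := hfd Φ (1, 0, 0, 1) subset_rfl
  have ta := hfd Φ (0, 1, 0, 0) subset_rfl
  have taz := hfd Φz (0, 1, 0, 0) tz
  have sz : ∀ x, x ∉ tsupport Φ → Φz x = 0 := fun x hx =>
    image_eq_zero_of_notMem_tsupport fun h => hx (tz h)
  have sa : ∀ x, x ∉ tsupport Φ → Φa x = 0 := fun x hx =>
    image_eq_zero_of_notMem_tsupport fun h => hx (ta h)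
  have saz : ∀ x, x ∉ tsupport Φ → Φaz x = 0 := fun x hx =>
    image_eq_zero_of_notMem_tsupport fun h => hx (taz h)
  have hinv : Continuous fun x : Spacetime => (((x - y).2.1, (x - y).2.2.1,
    (x - y).1 - (x - y).2.2.2), (x - y).2.2.2) := by fun_prop
  -- The support is compact in the coordinates of `chart`, and the norm of a product is the maximum
  -- norm, so a norm bound is a cube.
  obtain ⟨M, hM, hbd⟩ := (hc.isCompact.image hinv).isBounded.exists_pos_norm_le
  have hout : ∀ w z, w ∉ cube M ∨ M < |z| → chart y (w, z) ∉ tsupport Φ := by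
    intro w z hwz hmem
    have h1 := hbd _ ⟨_, hmem, rfl⟩
    simp only [chart, add_sub_cancel_left, Prod.norm_def, sup_le_iff, Real.norm_eq_abs] at h1
    rcases hwz with h | h
    · exact h ⟨h1.1.1, h1.1.2.1, by simpa using h1.1.2.2⟩
    · exact absurd h1.2 (not_le.2 h)
  have p0 := continuous_phased hP hQ y hΦ.continuous
  have pz := continuous_phased hP hQ y cz.continuous
  have pa := continuous_phased hP hQ y ca.continuous
  have paz := continuous_phased hP hQ y caz.continuous
  set Ψa : (ℝ × ℝ × ℝ) × ℝ → ℂ := fun p =>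
    -Complex.I * P p.1.2.2 * phased P Q y Φ p + phased P Q y Φa p with hΨa
  set Ψaz : (ℝ × ℝ × ℝ) × ℝ → ℂ := fun p =>
    -Complex.I * P p.1.2.2 * phased P Q y Φz p + phased P Q y Φaz p with hΨaz
  have da : Continuous Ψa := by fun_prop
  have daz : Continuous Ψaz := by fun_prop
  have zero : ∀ w z, w ∉ cube M ∨ M < |z| → phased P Q y Φ (w, z) = 0 ∧
      phased P Q y Φz (w, z) = 0 ∧ Ψa (w, z) = 0 ∧ Ψaz (w, z) = 0 := by
    intro w z hwz
    have := hout w z hwz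
    simp only [hΨa, hΨaz, phased, s0 _ this, sz _ this, sa _ this, saz _ this, mul_zero, add_zero,
      and_self]
  have bdd : ∀ F : (ℝ × ℝ × ℝ) × ℝ → ℂ, Continuous F →
      (∀ w z, w ∉ cube M ∨ M < |z| → F (w, z) = 0) → ∃ C, 0 ≤ C ∧ ∀ p, ‖F p‖ ≤ C := by
    intro F hF h0
    have hcs : HasCompactSupport F := by
      refine HasCompactSupport.intro (K := cube M ×ˢ Icc (-M) M) ?_ fun p hp => h0 p.1 p.2 ?_
      · rw [cube_eq_prod]
        exact (isCompact_Icc.prod (isCompact_Icc.prod isCompact_Icc)).prod isCompact_Icc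
      · by_contra! h
        exact hp ⟨h.1, mem_Icc.2 (abs_le.1 h.2)⟩
    obtain ⟨C, hC⟩ := hcs.exists_bound_of_continuous hF
    exact ⟨C, (norm_nonneg _).trans (hC 0), hC⟩
  obtain ⟨C₁, n1, b1⟩ := bdd _ p0 fun w z h => (zero w z h).1
  obtain ⟨C₂, n2, b2⟩ := bdd _ pz fun w z h => (zero w z h).2.1
  obtain ⟨C₃, n3, b3⟩ := bdd _ da fun w z h => (zero w z h).2.2.1
  obtain ⟨C₄, n4, b4⟩ := bdd _ daz fun w z h => (zero w z h).2.2.2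
  refine ⟨M, C₁ + C₂ + C₃ + C₄, phased P Q y Φz, Ψa, Ψaz, p0, pz, da, daz, hM, by positivity,
    fun p => (b1 p).trans (by linarith), fun p => (b2 p).trans (by linarith),
    fun p => (b3 p).trans (by linarith), fun p => (b4 p).trans (by linarith), zero,
    hasDerivAt_phased_z P Q y (hΦ.differentiable (by simp)),
    hasDerivAt_phased_a P Q y (hΦ.differentiable (by simp)),
    hasDerivAt_phased_a P Q y (cz.differentiable (by simp))⟩

end Volkov

/-! ### Assembly: real and imaginary parts, and the null hyperplane ξ' = ξ''. -/

namespace Volkov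

variable {A₁ A₂ : ℝ → ℝ} {k₀ : ℝ} {y : Spacetime} {κ : Spacetime → ℝ} {ψ ψ' : Spacetime → ℂ}

theorem massSq_pos (hA₁ : Continuous A₁) (hA₂ : Continuous A₂) (hk₀ : 0 < k₀) (ξ' ξ'' : ℝ) :
    0 < massSq A₁ A₂ k₀ ξ' ξ'' :=
  (pow_pos hk₀ 2).trans_le (sq_le_massSq hA₁ hA₂ k₀ ξ' ξ'')

/-- The pairing of the proper-time integral of the Volkov interaction in terms of the causal
function with shifted mass. -/
theorem volkov_properTimeIntegral_eq (hA₁ : Continuous A₁) (hA₂ : Continuous A₂) (hk₀ : 0 < k₀)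
    (y : Spacetime) {P Q : ℝ → ℝ} (hP : Continuous P) (hQ : Continuous Q) {Φ : Spacetime → ℂ}
    (hΦ : ContDiff ℝ ∞ Φ) (hc : HasCompactSupport Φ)
    (hψ : ∀ p, ψ (chart y p) = phased P Q y Φ p) :
    ProperTimePairingExists (fun x' => massSq A₁ A₂ k₀ (xi x') (xi y)) y ψ ∧
      CausalPairingExists (fun x' => mass A₁ A₂ k₀ (xi x') (xi y)) y ψ ∧
      properTimeIntegral (fun x' => massSq A₁ A₂ k₀ (xi x') (xi y)) y ψ =
        Real.pi * bracket (fun x' => mass A₁ A₂ k₀ (xi x') (xi y)) y ψ +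
          2 * Real.pi ^ 2 * Complex.I *
            delta1 (fun x' => mass A₁ A₂ k₀ (xi x') (xi y)) y ψ := by
  obtain ⟨M, C, Ψz, Ψa, Ψaz, h⟩ := exists_hasChartDerivs hP hQ y hΦ hc
  have e : phased P Q y Φ = fun p => ψ (chart y p) := (funext hψ).symm
  rw [e] at h
  refine properTimeIntegral_eq (μ := fun ξ => mass A₁ A₂ k₀ (xi y + ξ) (xi y)) h
    (continuous_massSq hA₁ hA₂ k₀ (xi y)).sqrt
    (fun ξ => Real.sqrt_pos.2 (massSq_pos hA₁ hA₂ hk₀ _ _)) (fun p => ?_) fun p => ?_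
  · rw [xi_chart, mass, Real.sq_sqrt (massSq_pos hA₁ hA₂ hk₀ _ _).le]
  · rw [xi_chart]

theorem im_integral_eq_zero {X : Type*} [MeasurableSpace X] {ν : Measure X} {f : X → ℂ}
    (hf : ∀ x, (f x).im = 0) : (∫ x, f x ∂ν).im = 0 := by
  have : f = fun x => (((f x).re : ℝ) : ℂ) := by
    ext x
    exact Complex.ext (by simp) (by simp [hf x])
  rw [this]
  exact (congrArg Complex.im integral_ofReal).trans (Complex.ofReal_im _)

theorem bracket_im (κ : Spacetime → ℝ) (y : Spacetime) (hψ : ∀ x, (ψ x).im = 0) :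
    (bracket κ y ψ).im = 0 := by
  rw [bracket, Complex.sub_im, im_integral_eq_zero, im_integral_eq_zero, sub_zero]
  · intro x; simp [hψ x]
  · intro r
    rw [coneDensity, Complex.div_ofReal_im, Complex.add_im, hψ, hψ, add_zero, zero_div]

theorem delta1_im (hψ : ∀ x, (ψ x).im = 0)
    (h : Tendsto (delta1Trunc κ y ψ) (𝓝[>] (0 : ℝ)) (𝓝 (delta1 κ y ψ))) :
    (delta1 κ y ψ).im = 0 := by
  have h1 := (Complex.continuous_im.tendsto _).comp h
  have h2 : Complex.im ∘ delta1Trunc κ y ψ = fun _ => 0 := by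
    ext ε
    exact im_integral_eq_zero fun x => by simp [hψ x]
  rw [h2] at h1
  exact (tendsto_nhds_unique h1 tendsto_const_nhds)

theorem ae_xi_ne (y : Spacetime) : ∀ᵐ x' : Spacetime, xi x' ≠ xi y := by
  have h := measurePreserving_chart y
  rw [ae_iff, ← h.measure_preimage_emb (measurableEmbedding_chart y)]
  have : ∀ᵐ p : (ℝ × ℝ × ℝ) × ℝ, p.1.2.2 ≠ 0 :=
    Measure.quasiMeasurePreserving_fst.ae ae_base_ne_zero
  rw [ae_iff] at this
  convert this using 2
  ext p
  simp [xi_chart]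

/-- On the cone ct = z forces x₁ = x₂ = 0, so the hyperplane meets it in a single line of
generators, excluded by x₁ ≠ 0. -/
theorem coneDensity_congr_ae (h : ∀ x', xi x' ≠ xi y → ψ x' = ψ' x') :
    coneDensity y ψ =ᵐ[volume] coneDensity y ψ' := by
  have a1 : ∀ᵐ r : ℝ × ℝ × ℝ, r.1 ≠ 0 :=
    Measure.quasiMeasurePreserving_fst.ae (Measure.ae_ne volume 0)
  filter_upwards [a1] with r hr
  have hpos : 0 < r.1 ^ 2 := by positivity
  have hne : ∀ t : ℝ, t ^ 2 = r.1 ^ 2 + r.2.1 ^ 2 + r.2.2 ^ 2 → xi (y + (t, r)) ≠ xi y := by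
    intro t ht he
    simp only [xi, Prod.fst_add, Prod.snd_add] at he
    have : t = r.2.2 := by linarith
    rw [this] at ht
    nlinarith [sq_nonneg r.2.1]
  have hs : Real.sqrt (r.1 ^ 2 + r.2.1 ^ 2 + r.2.2 ^ 2) ^ 2 = r.1 ^ 2 + r.2.1 ^ 2 + r.2.2 ^ 2 :=
    Real.sq_sqrt (by positivity)
  rw [coneDensity, coneDensity, h _ (hne _ hs), h _ (hne _ (by rw [neg_sq, hs]))]

/-- The causal function does not see the hyperplane `ξ' = ξ''`. -/
theorem CausalPairingExists.congr (hψ : CausalPairingExists κ y ψ)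
    (h : ∀ x', xi x' ≠ xi y → ψ x' = ψ' x') :
    CausalPairingExists κ y ψ' ∧ deltaC κ y ψ' = deltaC κ y ψ := by
  have hae : ψ =ᵐ[volume] ψ' := (ae_xi_ne y).mono h
  have hcone := coneDensity_congr_ae h
  have hmul : ∀ f : Spacetime → ℂ, (fun x => f x * ψ x) =ᵐ[volume] fun x => f x * ψ' x :=
    fun f => hae.mono fun x hx => by simp only [hx]
  have htr : delta1Trunc κ y ψ' = delta1Trunc κ y ψ := by
    ext ε
    exact integral_congr_ae (ae_restrict_of_ae (hmul _).symm)
  have hd : delta1 κ y ψ' = delta1 κ y ψ := by rw [delta1, delta1, htr]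
  have hb : bracket κ y ψ' = bracket κ y ψ := by
    rw [bracket, bracket, integral_congr_ae hcone, integral_congr_ae (hmul _)]
  obtain ⟨h1, h2, h3, h4⟩ := hψ
  refine ⟨⟨h1.congr hcone, h2.congr (hmul _), fun ε hε =>
    (h3 ε hε).congr (ae_restrict_of_ae (hmul _)), ?_⟩, ?_⟩
  · rw [htr, hd]; exact h4
  · rw [deltaC, deltaC, deltaS, deltaS, hb, hd]

/-- For real test functions both pairings are real, so the complex identity separates into its two
parts. -/
theorem properTimeIntegral_re_im {I b d : ℂ} (h : I = Real.pi * b + 2 * Real.pi ^ 2 * Complex.I * d)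
    (hb : b.im = 0) (hd : d.im = 0) :
    (I.re : ℂ) = Real.pi * b ∧ (I.im : ℂ) = 2 * Real.pi ^ 2 * d := by
  have eb : b = ((b.re : ℝ) : ℂ) := Complex.ext (by simp) (by simp [hb])
  have ed : d = ((d.re : ℝ) : ℂ) := Complex.ext (by simp) (by simp [hd])
  have e : I = ((Real.pi * b.re : ℝ) : ℂ) + ((2 * Real.pi ^ 2 * d.re : ℝ) : ℂ) * Complex.I := by
    rw [h, eb, ed]
    push_cast
    simp only [Complex.ofReal_re]
    ring
  have h1 : I.re = Real.pi * b.re := by rw [e]; simp [-Complex.ofReal_pow]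
  have h2 : I.im = 2 * Real.pi ^ 2 * d.re := by rw [e]; simp [-Complex.ofReal_pow]
  rw [h1, h2]
  nth_rewrite 2 [eb]
  nth_rewrite 2 [ed]
  push_cast
  exact ⟨rfl, rfl⟩

theorem gaugeFactor_mul_chart (hA₁ : Continuous A₁) (hA₂ : Continuous A₂) (y : Spacetime)
    (Φ : Spacetime → ℂ) (p : (ℝ × ℝ × ℝ) × ℝ) :
    gaugeFactor A₁ A₂ (chart y p) y * Φ (chart y p) =
      phased (segmentMean A₁ (xi y)) (segmentMean A₂ (xi y)) y Φ p := by
  rw [gaugeFactor_eq hA₁ hA₂, phased, xi_chart, add_sub_cancel_left, chart, add_sub_cancel_left]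

end Volkov

theorem mainTheorem2 (A₁ A₂ : ℝ → ℝ) (hA₁ : Continuous A₁) (hA₂ : Continuous A₂)
    (k₀ : ℝ) (hk₀ : 0 < k₀) (x'' : Volkov.Spacetime) :
    -- the shifted mass is real, and not less than `k₀`
    (∀ x' : Volkov.Spacetime,
      k₀ ^ 2 ≤ Volkov.massSq A₁ A₂ k₀ (Volkov.xi x') (Volkov.xi x'')) ∧
    -- the factor `C` of Schwinger's propagator is the phase factor
    (∀ x' : Volkov.Spacetime, Volkov.xi x' ≠ Volkov.xi x'' →
      Volkov.gaugeFactor A₁ A₂ x' x'' = Volkov.volkovPhase A₁ A₂ x' x'') ∧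
    -- real and imaginary parts of the proper-time integral
    (∀ φ : 𝓓((⊤ : TopologicalSpace.Opens Volkov.Spacetime), ℝ),
      Volkov.ProperTimePairingExists
        (fun x' => Volkov.massSq A₁ A₂ k₀ (Volkov.xi x') (Volkov.xi x'')) x''
        (fun x' => (φ x' : ℂ)) ∧
      Volkov.CausalPairingExists
        (fun x' => Volkov.mass A₁ A₂ k₀ (Volkov.xi x') (Volkov.xi x'')) x''
        (fun x' => (φ x' : ℂ)) ∧
      ((Volkov.properTimeIntegral
          (fun x' => Volkov.massSq A₁ A₂ k₀ (Volkov.xi x') (Volkov.xi x'')) x''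
          (fun x' => (φ x' : ℂ))).re : ℂ) =
        (Real.pi : ℂ) * Volkov.bracket
          (fun x' => Volkov.mass A₁ A₂ k₀ (Volkov.xi x') (Volkov.xi x'')) x''
          (fun x' => (φ x' : ℂ)) ∧
      ((Volkov.properTimeIntegral
          (fun x' => Volkov.massSq A₁ A₂ k₀ (Volkov.xi x') (Volkov.xi x'')) x''
          (fun x' => (φ x' : ℂ))).im : ℂ) =
        (2 * Real.pi ^ 2 : ℂ) * Volkov.delta1
          (fun x' => Volkov.mass A₁ A₂ k₀ (Volkov.xi x') (Volkov.xi x'')) x''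
          (fun x' => (φ x' : ℂ))) ∧
    -- Schwinger's propagator is, up to sign and phase, the causal function with shifted mass
    (∀ φ : 𝓓((⊤ : TopologicalSpace.Opens Volkov.Spacetime), ℂ),
      Volkov.ProperTimePairingExists
        (fun x' => Volkov.massSq A₁ A₂ k₀ (Volkov.xi x') (Volkov.xi x'')) x''
        (fun x' => Volkov.gaugeFactor A₁ A₂ x' x'' * φ x') ∧
      Volkov.CausalPairingExists
        (fun x' => Volkov.mass A₁ A₂ k₀ (Volkov.xi x') (Volkov.xi x'')) x''
        (fun x' => Volkov.volkovPhase A₁ A₂ x' x'' * φ x') ∧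
      Volkov.schwingerPropagator A₁ A₂ k₀ x'' φ =
        -Volkov.deltaC
          (fun x' => Volkov.mass A₁ A₂ k₀ (Volkov.xi x') (Volkov.xi x'')) x''
          (fun x' => Volkov.volkovPhase A₁ A₂ x' x'' * φ x')) := by
  refine ⟨fun x' => Volkov.sq_le_massSq hA₁ hA₂ k₀ _ _,
    fun x' h => Volkov.gaugeFactor_eq_volkovPhase hA₁ hA₂ h, fun φ => ?_, fun φ => ?_⟩
  -- Without the gauge factor the phase is trivial: P = Q = 0.
  · obtain ⟨h1, h2, h3⟩ := Volkov.volkov_properTimeIntegral_eq (ψ := fun x' => (φ x' : ℂ)) hA₁ hA₂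
      hk₀ x'' (P := fun _ => 0) (Q := fun _ => 0) continuous_const continuous_const
      (Complex.ofRealCLM.contDiff.comp φ.contDiff)
      (φ.hasCompactSupport.comp_left Complex.ofReal_zero) (fun p => by simp [Volkov.phased])
    have him : ∀ x', ((φ x' : ℂ)).im = 0 := fun x' => Complex.ofReal_im _
    exact ⟨h1, h2, Volkov.properTimeIntegral_re_im h3 (Volkov.bracket_im _ _ him)
      (Volkov.delta1_im him h2.2.2.2)⟩
  · obtain ⟨h1, h2, h3⟩ := Volkov.volkov_properTimeIntegral_eq
      (ψ := fun x' => Volkov.gaugeFactor A₁ A₂ x' x'' * φ x') hA₁ hA₂ hk₀ x''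
      (Volkov.continuous_segmentMean hA₁ _) (Volkov.continuous_segmentMean hA₂ _) φ.contDiff
      φ.hasCompactSupport (Volkov.gaugeFactor_mul_chart hA₁ hA₂ x'' φ)
    -- The identity is first obtained with `gaugeFactor`, which is continuous across ξ' = ξ''; only
    -- then is it replaced by `volkovPhase`, which may differ from it on that hyperplane.
    obtain ⟨h4, h5⟩ := h2.congr (ψ' := fun x' => Volkov.volkovPhase A₁ A₂ x' x'' * φ x')
      fun x' hx => by rw [Volkov.gaugeFactor_eq_volkovPhase hA₁ hA₂ hx]
    refine ⟨h1, h4, ?_⟩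
    have hpi : (Real.pi : ℂ) ≠ 0 := by exact_mod_cast Real.pi_ne_zero
    rw [h5, Volkov.schwingerPropagator, h3, Volkov.deltaC, Volkov.deltaS]
    field_simp
    ring
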